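/- Let $a<0<b$, let $U$ be a smooth real-valued function on $[a,b]$, let $\Psi,\Phi,\Upsilon_1,\Upsilon_2$ be smooth real-valued functions on $\mathbb R$ whose supports lie in $[-1,1]$, with $\operatorname{supp}\Psi=[-1,1]$, and let $\alpha,\beta,\gamma_1,\gamma_2\in\mathbb R$. For $\varepsilon\in(0,1)$ put $$\Psi_\varepsilon(x)=\alpha\varepsilon^{-4}\Psi(x/\varepsilon)+\beta\varepsilon^{-3}\Phi(x/\varepsilon)+\gamma_1\varepsilon^{-2}\Upsilon_1(x/\varepsilon)+\gamma_2\varepsilon^{-1}\Upsilon_2(x/\varepsilon),$$ and let $\mathcal S_\varepsilon=\frac{d^4}{dx^4}+U+\Psi_\varepsilon$ in $L_2(a,b)$ with domain $\{f\in W_2^4(a,b): f(a)=f'(a)=f(b)=f'(b)=0\}$. Let $\lambda_1^\varepsilon\le\lambda_2^\varepsilon\le\dots$ be the eigenvalues of $\mathcal S_\varepsilon$, counted with multiplicity. Let the resonant set $\Sigma_\Psi$ be the set of all $\alpha\in\mathbb R$ for which the problem $$w^{(4)}+\alpha\Psi w=0\ \text{ on }(-1,1),\qquad w''(\pm1)=w'''(\pm1)=0,$$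 has a nontrivial solution $w=w_\alpha$. Assume that if $\alpha\in\Sigma_\Psi$, then the solution space of this problem is one-dimensional and $w_\alpha'(-1)\,w_\alpha'(1)\ne0$; in that case put $\theta=w_\alpha'(1)/w_\alpha'(-1)$ and $\kappa=\beta\int_{-1}^1\Phi(\xi)\,\bigl(w_\alpha(\xi)/w_\alpha'(-1)\bigr)^2d\xi$ (these do not depend on the choice of $w_\alpha$). Let $\mathcal S_{\alpha,\beta}(\Psi,\Phi)$ be the operator $f\mapsto f^{(4)}+Uf$ in $L_2(a,b)$ whose domain consists of all $f\in W_2^4((a,0)\cup(0,b))$ with $f(a)=f'(a)=f(b)=f'(b)=0$ and - $f(-0)=f'(-0)=f(+0)=f'(+0)=0$, if $\alpha\notin\Sigma_\Psi$; - $f(-0)=f(+0)=0$, $f'(+0)=\theta f'(-0)$, $\theta f''(+0)-f''(-0)=\kappa f'(-0)$, if $\alpha\in\Sigma_\Psi$. Then: 1. Let $\mathcal I\subseteq(0,1)$ be a set with accumulation point $0$ (for instance $\mathcal I=(0,1)$) and let $k\ge1$. If $\lambda_k^\varepsilon$ is bounded from below as $\mathcal I\ni\varepsilon\to0$, then $\lambda_k^\varepsilon$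 has a finite limit as $\mathcal I\ni\varepsilon\to0$, and this limit is a point of the spectrum of $\mathcal S_{\alpha,\beta}(\Psi,\Phi)$. 2. For each simple eigenvalue $\lambda$ of $\mathcal S_{\alpha,\beta}(\Psi,\Phi)$ there is exactly one index $k$ such that $\lambda_k^\varepsilon\to\lambda$ as $\varepsilon\to0$. -/

import Mathlib

open MeasureTheory Set Filter Topology
open scoped ContDiff

namespace SingularFourthOrder

/-! ### Sobolev functions of order four on a bounded interval -/

/-- `D 0` is a function of class `W₂⁴(c, d)` and `D 1, …, D 4` are its first four derivatives:
`D 0, …, D 3` are absolutely continuous on `[c, d]`, that is, each of them is a primitive of the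
next function in the list, and the fourth derivative `D 4` is square integrable on `(c, d)`.
For `j ≤ 3` the number `D j x` is the value at `x ∈ [c, d]` of the continuous representative of the
`j`-th derivative; at the end points `x = c, d` it is the trace. (The terms `D j`, `5 ≤ j`,
play no role.) -/
structure IsSobolevFour {𝕜 : Type*} [RCLike 𝕜] (c d : ℝ) (D : ℕ → ℝ → 𝕜) : Prop where
  memLp : MemLp (D 4) 2 (volume.restrict (Ioo c d))
  primitive : ∀ j < 4, ∀ x ∈ Icc c d, D j x = D j c + ∫ t in c..x, D (j + 1) t

section Sobolev

variable {𝕜 : Type*} [RCLike 𝕜] {c d : ℝ} {D D' : ℕ → ℝ → 𝕜}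

theorem IsSobolevFour.integrableOn_four (h : IsSobolevFour c d D) :
    IntegrableOn (D 4) (Icc c d) := by
  rw [integrableOn_Icc_iff_integrableOn_Ioo]
  exact h.memLp.integrable (by norm_num)

theorem IsSobolevFour.continuousOn_of_integrableOn (h : IsSobolevFour c d D) {j : ℕ} (hj : j < 4)
    (hi : IntegrableOn (D (j + 1)) (Icc c d)) : ContinuousOn (D j) (Icc c d) := by
  have h1 : ContinuousOn (fun x => D j c + ∫ t in c..x, D (j + 1) t) (Icc c d) := by
    refine continuousOn_const.add ?_
    rcases le_or_gt c d with hcd | hcd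
    · have := intervalIntegral.continuousOn_primitive_interval (μ := volume)
        (f := D (j + 1)) (a := c) (b := d) (by rwa [uIcc_of_le hcd])
      rwa [uIcc_of_le hcd] at this
    · rw [Icc_eq_empty (not_le.2 hcd)]
      exact continuousOn_empty _
  exact h1.congr fun x hx => h.primitive j hj x hx

theorem IsSobolevFour.integrableOn (h : IsSobolevFour c d D) {j : ℕ} (hj : j ≤ 4) :
    IntegrableOn (D j) (Icc c d) := by
  have h3 := (h.continuousOn_of_integrableOn (j := 3) (by norm_num)
    h.integrableOn_four).integrableOn_Icc (μ := volume)
  have h2 := (h.continuousOn_of_integrableOn (j := 2) (by norm_num) h3).integrableOn_Icc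
    (μ := volume)
  have h1 := (h.continuousOn_of_integrableOn (j := 1) (by norm_num) h2).integrableOn_Icc
    (μ := volume)
  have h0 := (h.continuousOn_of_integrableOn (j := 0) (by norm_num) h1).integrableOn_Icc
    (μ := volume)
  interval_cases j
  exacts [h0, h1, h2, h3, h.integrableOn_four]

theorem IsSobolevFour.continuousOn (h : IsSobolevFour c d D) {j : ℕ} (hj : j < 4) :
    ContinuousOn (D j) (Icc c d) :=
  h.continuousOn_of_integrableOn hj (h.integrableOn hj)

theorem IsSobolevFour.intervalIntegrable (h : IsSobolevFour c d D) {j : ℕ} (hj : j ≤ 4)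
    {x : ℝ} (hx : x ∈ Icc c d) : IntervalIntegrable (D j) volume c x :=
  (intervalIntegrable_iff_integrableOn_Icc_of_le hx.1).2
    ((h.integrableOn hj).mono_set (Icc_subset_Icc_right hx.2))

theorem IsSobolevFour.zero : IsSobolevFour c d (0 : ℕ → ℝ → 𝕜) :=
  ⟨MemLp.zero, by simp⟩

theorem IsSobolevFour.add (h : IsSobolevFour c d D) (h' : IsSobolevFour c d D') :
    IsSobolevFour c d (D + D') := by
  refine ⟨h.memLp.add h'.memLp, fun j hj x hx => ?_⟩
  simp only [Pi.add_apply]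
  rw [intervalIntegral.integral_add (h.intervalIntegrable hj hx) (h'.intervalIntegrable hj hx),
    h.primitive j hj x hx, h'.primitive j hj x hx]
  ring

theorem IsSobolevFour.smul (r : 𝕜) (h : IsSobolevFour c d D) : IsSobolevFour c d (r • D) := by
  refine ⟨h.memLp.const_smul r, fun j hj x hx => ?_⟩
  simp only [Pi.smul_apply, smul_eq_mul]
  rw [intervalIntegral.integral_const_mul, h.primitive j hj x hx]
  ring

/-- If a Sobolev function vanishes almost everywhere, so does its fourth derivative. -/
theorem IsSobolevFour.four_ae_eq_zero (h : IsSobolevFour c d D)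
    (h0 : ∀ᵐ x ∂(volume.restrict (Ioo c d)), D 0 x = 0) :
    ∀ᵐ x ∂(volume.restrict (Ioo c d)), D 4 x = 0 := by
  rcases le_or_gt d c with hdc | hcd
  · simp [Ioo_eq_empty (not_lt.2 hdc)]
  have key : ∀ j < 4, (∀ᵐ x ∂(volume.restrict (Ioo c d)), D j x = 0) →
      ∀ᵐ x ∂(volume.restrict (Ioo c d)), D (j + 1) x = 0 := by
    intro j hj hz
    have hz' : EqOn (D j) (fun _ => 0) (Icc c d) := by
      refine Measure.eqOn_Icc_of_ae_eq volume hcd.ne ?_ (h.continuousOn hj) continuousOn_const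
      rw [← Measure.restrict_congr_set Ioo_ae_eq_Icc]
      exact hz
    have hint := h.intervalIntegrable (j := j + 1) hj (right_mem_Icc.2 hcd.le)
    have hder := hint.ae_hasDerivAt_integral
    rw [ae_restrict_iff' measurableSet_Ioo]
    filter_upwards [hder] with x hx hxI
    have hd := hx (by rw [uIcc_of_le hcd.le]; exact Ioo_subset_Icc_self hxI) c
      (by rw [uIcc_of_le hcd.le]; exact left_mem_Icc.2 hcd.le)
    have hev : (fun y => ∫ t in c..y, D (j + 1) t) =ᶠ[𝓝 x] fun _ => (0 : 𝕜) := by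
      filter_upwards [Ioo_mem_nhds hxI.1 hxI.2] with y hy
      have hy' := h.primitive j hj y (Ioo_subset_Icc_self hy)
      rw [hz' (Ioo_subset_Icc_self hy), hz' (left_mem_Icc.2 hcd.le)] at hy'
      simpa using hy'.symm
    exact hd.unique ((hasDerivAt_const x (0 : 𝕜)).congr_of_eventuallyEq hev)
  exact key 3 (by norm_num) (key 2 (by norm_num) (key 1 (by norm_num) (key 0 (by norm_num) h0)))

end Sobolev

/-! ### Unbounded operators -/

section Operators

variable {H : Type*} [NormedAddCommGroup H] [NormedSpace ℂ H]

/-- The eigenspace `ker (T - z)` of an unbounded operator. -/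
def eigenspace (T : H →ₗ.[ℂ] H) (z : ℂ) : Submodule ℂ H :=
  (LinearMap.ker (T.toFun - z • T.domain.subtype)).map T.domain.subtype

/-- The resolvent set: all `z` for which `T - z : D(T) → H` is a bijection with bounded inverse
`R`. -/
def resolventSet (T : H →ₗ.[ℂ] H) : Set ℂ :=
  {z | ∃ R : H →L[ℂ] H,
    (∀ h : H, ∃ hd : R h ∈ T.domain, T ⟨R h, hd⟩ - z • R h = h) ∧
    ∀ u : T.domain, R (T u - z • (u : H)) = u}

/-- The spectrum of an unbounded operator. -/
def opSpectrum (T : H →ₗ.[ℂ] H) : Set ℂ := (resolventSet T)ᶜ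

/-- `lam 0 ≤ lam 1 ≤ …` are all eigenvalues of `T`, each of them repeated according to its
(finite) multiplicity. -/
structure IsEigenvalueEnumeration (T : H →ₗ.[ℂ] H) (lam : ℕ → ℝ) : Prop where
  monotone : Monotone lam
  finite : ∀ z : ℂ, {k : ℕ | (lam k : ℂ) = z}.Finite
  finiteDimensional : ∀ z : ℂ, FiniteDimensional ℂ (eigenspace T z)
  multiplicity : ∀ z : ℂ,
    Module.finrank ℂ (eigenspace T z) = {k : ℕ | (lam k : ℂ) = z}.ncard

/-- `z` is a simple eigenvalue of `T`. -/
def IsSimpleEigenvalue (T : H →ₗ.[ℂ] H) (z : ℂ) : Prop :=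
  Module.finrank ℂ (eigenspace T z) = 1

end Operators

/-- The complex Hilbert space `L₂(a, b)`. -/
abbrev L2 (a b : ℝ) : Type := Lp ℂ 2 (volume.restrict (Ioo a b))

/-! ### The operator `d⁴/dx⁴ + q` on `(a, b)` with clamped ends -/

/-- The graph of the operator `f ↦ f⁗ + q f` in `L₂(a, b)` with domain
`{f ∈ W₂⁴(a, b) : f(a) = f'(a) = f(b) = f'(b) = 0}`. -/
def clampedGraph (a b : ℝ) (q : ℝ → ℝ) : Submodule ℂ (L2 a b × L2 a b) where
  carrier := {p | ∃ D : ℕ → ℝ → ℂ, IsSobolevFour a b D ∧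
    (∀ᵐ x ∂(volume.restrict (Ioo a b)), p.1 x = D 0 x) ∧
    (∀ᵐ x ∂(volume.restrict (Ioo a b)), p.2 x = D 4 x + (q x : ℂ) * D 0 x) ∧
    D 0 a = 0 ∧ D 1 a = 0 ∧ D 0 b = 0 ∧ D 1 b = 0}
  zero_mem' := by
    refine ⟨0, IsSobolevFour.zero, ?_, ?_, rfl, rfl, rfl, rfl⟩
    · filter_upwards [Lp.coeFn_zero ℂ 2 (volume.restrict (Ioo a b))] with x hx
      simpa using hx
    · filter_upwards [Lp.coeFn_zero ℂ 2 (volume.restrict (Ioo a b))] with x hx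
      simpa using hx
  add_mem' := by
    rintro p p' ⟨D, hD, h1, h2, e1, e2, e3, e4⟩ ⟨D', hD', h1', h2', e1', e2', e3', e4'⟩
    refine ⟨D + D', hD.add hD', ?_, ?_, ?_, ?_, ?_, ?_⟩
    · filter_upwards [h1, h1', Lp.coeFn_add p.1 p'.1] with x hx hx' hs
      simp only [Prod.fst_add, hs, Pi.add_apply, hx, hx']
    · filter_upwards [h2, h2', Lp.coeFn_add p.2 p'.2] with x hx hx' hs
      simp only [Prod.snd_add, hs, Pi.add_apply, hx, hx']
      ring
    all_goals simp [*]
  smul_mem' := by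
    rintro r p ⟨D, hD, h1, h2, e1, e2, e3, e4⟩
    refine ⟨r • D, hD.smul r, ?_, ?_, ?_, ?_, ?_, ?_⟩
    · filter_upwards [h1, Lp.coeFn_smul r p.1] with x hx hs
      simp [hs, hx]
    · filter_upwards [h2, Lp.coeFn_smul r p.2] with x hx hs
      simp only [Prod.smul_snd, hs, Pi.smul_apply, hx, smul_eq_mul]
      ring
    all_goals simp [*]

/-- The operator `f ↦ f⁗ + q f` in `L₂(a, b)` with domain
`{f ∈ W₂⁴(a, b) : f(a) = f'(a) = f(b) = f'(b) = 0}`. -/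
noncomputable def clampedOp (a b : ℝ) (q : ℝ → ℝ) : L2 a b →ₗ.[ℂ] L2 a b :=
  (clampedGraph a b q).toLinearPMap

theorem clampedOp_graph (a b : ℝ) (q : ℝ → ℝ) : (clampedOp a b q).graph = clampedGraph a b q := by
  refine Submodule.toLinearPMap_graph_eq _ ?_
  rintro ⟨f, g⟩ ⟨D, hD, h1, h2, -⟩ hf
  obtain rfl : f = 0 := hf
  have h0 : ∀ᵐ x ∂(volume.restrict (Ioo a b)), D 0 x = 0 := by
    filter_upwards [h1, Lp.coeFn_zero ℂ 2 (volume.restrict (Ioo a b))] with x hx hz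
    rw [← hx, hz, Pi.zero_apply]
  refine (Lp.eq_zero_iff_ae_eq_zero).2 ?_
  filter_upwards [h2, h0, hD.four_ae_eq_zero h0] with x hx hx0 hx4
  simp [hx, hx0, hx4]

/-! ### The operator `d⁴/dx⁴ + U` on `(a, 0) ∪ (0, b)` with coupling conditions at the origin -/

/-- The graph of the operator `f ↦ f⁗ + U f` in `L₂(a, b)`, where `f` is of class `W₂⁴` on `(a, 0)`
(with derivatives `D j`) and on `(0, b)` (with derivatives `E j`), satisfies
`f(a) = f'(a) = f(b) = f'(b) = 0` and is such that the one-sided values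
`f⁽ʲ⁾(-0) = D j 0` and `f⁽ʲ⁾(+0) = E j 0`, `j ≤ 3`, satisfy the linear conditions `C`. -/
def coupledGraph (a b : ℝ) (U : ℝ → ℝ) (C : Submodule ℂ ((Fin 4 → ℂ) × (Fin 4 → ℂ))) :
    Submodule ℂ (L2 a b × L2 a b) where
  carrier := {p | ∃ D E : ℕ → ℝ → ℂ, IsSobolevFour a 0 D ∧ IsSobolevFour 0 b E ∧
    (∀ᵐ x ∂(volume.restrict (Ioo a b)), p.1 x = if x < 0 then D 0 x else E 0 x) ∧
    (∀ᵐ x ∂(volume.restrict (Ioo a b)),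
      p.2 x = (if x < 0 then D 4 x else E 4 x) + (U x : ℂ) * p.1 x) ∧
    D 0 a = 0 ∧ D 1 a = 0 ∧ E 0 b = 0 ∧ E 1 b = 0 ∧
    ((fun j : Fin 4 => D j 0), (fun j : Fin 4 => E j 0)) ∈ C}
  zero_mem' := by
    refine ⟨0, 0, IsSobolevFour.zero, IsSobolevFour.zero, ?_, ?_, rfl, rfl, rfl, rfl, C.zero_mem⟩
    · filter_upwards [Lp.coeFn_zero ℂ 2 (volume.restrict (Ioo a b))] with x hx
      simpa using hx
    · filter_upwards [Lp.coeFn_zero ℂ 2 (volume.restrict (Ioo a b))] with x hx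
      simp only [Prod.fst_zero, Prod.snd_zero, hx, Pi.zero_apply]
      simp
  add_mem' := by
    rintro p p' ⟨D, E, hD, hE, h1, h2, e1, e2, e3, e4, hC⟩
      ⟨D', E', hD', hE', h1', h2', e1', e2', e3', e4', hC'⟩
    refine ⟨D + D', E + E', hD.add hD', hE.add hE', ?_, ?_, ?_, ?_, ?_, ?_, C.add_mem hC hC'⟩
    · filter_upwards [h1, h1', Lp.coeFn_add p.1 p'.1] with x hx hx' hs
      simp only [Prod.fst_add, hs, Pi.add_apply, hx, hx']
      split_ifs <;> rfl
    · filter_upwards [h2, h2', Lp.coeFn_add p.1 p'.1, Lp.coeFn_add p.2 p'.2] with x hx hx' ht hs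
      simp only [Prod.fst_add, Prod.snd_add, hs, ht, Pi.add_apply, hx, hx']
      split_ifs <;> ring
    all_goals simp [*]
  smul_mem' := by
    rintro r p ⟨D, E, hD, hE, h1, h2, e1, e2, e3, e4, hC⟩
    refine ⟨r • D, r • E, hD.smul r, hE.smul r, ?_, ?_, ?_, ?_, ?_, ?_, C.smul_mem r hC⟩
    · filter_upwards [h1, Lp.coeFn_smul r p.1] with x hx hs
      simp only [Prod.smul_fst, hs, Pi.smul_apply, hx, smul_eq_mul]
      split_ifs <;> rfl
    · filter_upwards [h2, Lp.coeFn_smul r p.1, Lp.coeFn_smul r p.2] with x hx ht hs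
      simp only [Prod.smul_fst, Prod.smul_snd, hs, ht, Pi.smul_apply, hx, smul_eq_mul]
      split_ifs <;> ring
    all_goals simp [*]

/-- The operator `f ↦ f⁗ + U f` in `L₂(a, b)` on functions of class `W₂⁴((a, 0) ∪ (0, b))` with
`f(a) = f'(a) = f(b) = f'(b) = 0` and the linear coupling conditions `C` at the origin. -/
noncomputable def coupledOp (a b : ℝ) (U : ℝ → ℝ)
    (C : Submodule ℂ ((Fin 4 → ℂ) × (Fin 4 → ℂ))) : L2 a b →ₗ.[ℂ] L2 a b :=
  (coupledGraph a b U C).toLinearPMap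

theorem coupledOp_graph {a b : ℝ} (ha : a < 0) (hb : 0 < b) (U : ℝ → ℝ)
    (C : Submodule ℂ ((Fin 4 → ℂ) × (Fin 4 → ℂ))) :
    (coupledOp a b U C).graph = coupledGraph a b U C := by
  refine Submodule.toLinearPMap_graph_eq _ ?_
  rintro ⟨f, g⟩ ⟨D, E, hD, hE, h1, h2, -⟩ hf
  obtain rfl : f = 0 := hf
  have hz : ∀ᵐ x ∂(volume.restrict (Ioo a b)), ((0 : L2 a b) : ℝ → ℂ) x = 0 :=
    Lp.coeFn_zero ℂ 2 (volume.restrict (Ioo a b))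
  have h0 : ∀ᵐ x ∂(volume.restrict (Ioo a b)), (if x < 0 then D 0 x else E 0 x) = 0 := by
    filter_upwards [h1, hz] with x hx hz
    rw [← hx, hz]
  have hD4 := hD.four_ae_eq_zero (by
    rw [ae_restrict_iff' measurableSet_Ioo] at h0 ⊢
    filter_upwards [h0] with x hx hxI
    simpa [hxI.2] using hx ⟨hxI.1, hxI.2.trans hb⟩)
  have hE4 := hE.four_ae_eq_zero (by
    rw [ae_restrict_iff' measurableSet_Ioo] at h0 ⊢
    filter_upwards [h0] with x hx hxI
    simpa [not_lt.2 hxI.1.le] using hx ⟨ha.trans hxI.1, hxI.2⟩)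
  refine (Lp.eq_zero_iff_ae_eq_zero).2 ?_
  rw [ae_restrict_iff' measurableSet_Ioo] at hD4 hE4
  have hne : ∀ᵐ x ∂(volume.restrict (Ioo a b)), x ≠ 0 :=
    ae_restrict_of_ae (Measure.ae_ne volume 0)
  filter_upwards [h2, hz, ae_restrict_of_ae hD4, ae_restrict_of_ae hE4, hne,
    ae_restrict_mem measurableSet_Ioo] with x hx hx0 hxD hxE hn hxI
  simp only [hx, hx0, mul_zero, add_zero, Pi.zero_apply]
  split_ifs with hlt
  · exact hxD ⟨hxI.1, hlt⟩
  · exact hxE ⟨lt_of_le_of_ne (not_lt.1 hlt) (Ne.symm hn), hxI.2⟩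

/-- The conditions `f(-0) = f'(-0) = f(+0) = f'(+0) = 0`. -/
def clampedCoupling : Submodule ℂ ((Fin 4 → ℂ) × (Fin 4 → ℂ)) where
  carrier := {v | v.1 0 = 0 ∧ v.1 1 = 0 ∧ v.2 0 = 0 ∧ v.2 1 = 0}
  zero_mem' := by simp
  add_mem' := by
    rintro v v' ⟨h1, h2, h3, h4⟩ ⟨h1', h2', h3', h4'⟩
    simp [*]
  smul_mem' := by
    rintro r v ⟨h1, h2, h3, h4⟩
    simp [*]

/-- The conditions `f(-0) = f(+0) = 0`, `f'(+0) - θ f'(-0) = 0`,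
`θ f''(+0) - f''(-0) - κ f'(-0) = 0`. -/
def resonantCoupling (θ κ : ℝ) : Submodule ℂ ((Fin 4 → ℂ) × (Fin 4 → ℂ)) where
  carrier := {v | v.1 0 = 0 ∧ v.2 0 = 0 ∧ v.2 1 - (θ : ℂ) * v.1 1 = 0 ∧
    (θ : ℂ) * v.2 2 - v.1 2 - (κ : ℂ) * v.1 1 = 0}
  zero_mem' := by simp
  add_mem' := by
    rintro v v' ⟨h1, h2, h3, h4⟩ ⟨h1', h2', h3', h4'⟩
    refine ⟨by simp [*], by simp [*], ?_, ?_⟩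
    · simp only [Prod.fst_add, Prod.snd_add, Pi.add_apply]
      linear_combination h3 + h3'
    · simp only [Prod.fst_add, Prod.snd_add, Pi.add_apply]
      linear_combination h4 + h4'
  smul_mem' := by
    rintro r v ⟨h1, h2, h3, h4⟩
    refine ⟨by simp [*], by simp [*], ?_, ?_⟩
    · simp only [Prod.smul_fst, Prod.smul_snd, Pi.smul_apply, smul_eq_mul]
      linear_combination r * h3
    · simp only [Prod.smul_fst, Prod.smul_snd, Pi.smul_apply, smul_eq_mul]
      linear_combination r * h4

/-! ### The resonant set -/

/-- `W 0` solves `w⁗ + α Ψ w = 0` on `(-1, 1)`, `w''(±1) = w'''(±1) = 0`, with derivatives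
`W 1, …, W 4`. -/
structure IsResonantSolution (Ψ : ℝ → ℝ) (α : ℝ) (W : ℕ → ℝ → ℝ) : Prop where
  sobolev : IsSobolevFour (-1) 1 W
  equation : ∀ᵐ ξ ∂(volume.restrict (Ioo (-1 : ℝ) 1)), W 4 ξ + α * Ψ ξ * W 0 ξ = 0
  left : W 2 (-1) = 0 ∧ W 3 (-1) = 0
  right : W 2 1 = 0 ∧ W 3 1 = 0

/-- `W 0` is an eigenfunction for the eigenvalue `α` of the problem `w⁗ + α Ψ w = 0` on `(-1, 1)`,
`w''(±1) = w'''(±1) = 0`. -/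
def IsResonantEigenfunction (Ψ : ℝ → ℝ) (α : ℝ) (W : ℕ → ℝ → ℝ) : Prop :=
  IsResonantSolution Ψ α W ∧ ∃ ξ ∈ Icc (-1 : ℝ) 1, W 0 ξ ≠ 0

/-- The resonant set of the shape `Ψ`: all eigenvalues `α` of the above problem. -/
def resonantSet (Ψ : ℝ → ℝ) : Set ℝ := {α | ∃ W, IsResonantEigenfunction Ψ α W}

/-- Nondegenerate resonance: the eigenvalue `α` is simple and the derivative of its eigenfunction
vanishes at neither end point. -/
def IsNondegenerate (Ψ : ℝ → ℝ) (α : ℝ) : Prop :=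
  ∀ W, IsResonantEigenfunction Ψ α W →
    (∀ V, IsResonantSolution Ψ α V → ∃ c : ℝ, ∀ ξ ∈ Icc (-1 : ℝ) 1, V 0 ξ = c * W 0 ξ) ∧
    W 1 (-1) * W 1 1 ≠ 0

open Classical in
/-- An eigenfunction `w_α` (with its derivatives) for `α` in the resonant set. -/
noncomputable def resonantEigenfunction (Ψ : ℝ → ℝ) (α : ℝ) : ℕ → ℝ → ℝ :=
  if h : α ∈ resonantSet Ψ then h.choose else 0

/-- `θ_Ψ(α) = w_α'(1) / w_α'(-1)`. -/
noncomputable def theta (Ψ : ℝ → ℝ) (α : ℝ) : ℝ :=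
  resonantEigenfunction Ψ α 1 1 / resonantEigenfunction Ψ α 1 (-1)

/-- `ϑ_Φ[w_α / w_α'(-1)]`, where `ϑ_Φ[f] = ∫_{-1}^1 Φ f² dξ`. -/
noncomputable def vartheta (Ψ Φ : ℝ → ℝ) (α : ℝ) : ℝ :=
  ∫ ξ in (-1 : ℝ)..1,
    Φ ξ * (resonantEigenfunction Ψ α 0 ξ / resonantEigenfunction Ψ α 1 (-1)) ^ 2

/-! ### The perturbed operators and the limit operator -/

/-- The singularly scaled potential `Ψ_ε`. -/
noncomputable def scaledPotential (α β γ₁ γ₂ : ℝ) (Ψ Φ Υ₁ Υ₂ : ℝ → ℝ) (ε x : ℝ) : ℝ :=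
  α * (ε ^ 4)⁻¹ * Ψ (ε⁻¹ * x) + β * (ε ^ 3)⁻¹ * Φ (ε⁻¹ * x) +
    γ₁ * (ε ^ 2)⁻¹ * Υ₁ (ε⁻¹ * x) + γ₂ * ε⁻¹ * Υ₂ (ε⁻¹ * x)

/-- The operator `S_ε = d⁴/dx⁴ + U + Ψ_ε`. -/
noncomputable def perturbedOp (a b : ℝ) (U : ℝ → ℝ) (α β γ₁ γ₂ : ℝ) (Ψ Φ Υ₁ Υ₂ : ℝ → ℝ) (ε : ℝ) :
    L2 a b →ₗ.[ℂ] L2 a b :=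
  clampedOp a b fun x => U x + scaledPotential α β γ₁ γ₂ Ψ Φ Υ₁ Υ₂ ε x

open Classical in
/-- The limit operator `S_{α,β}(Ψ, Φ)`; in the nonresonant case it is `S₋ ⊕ S₊`. -/
noncomputable def limitOp (a b : ℝ) (U : ℝ → ℝ) (α β : ℝ) (Ψ Φ : ℝ → ℝ) :
    L2 a b →ₗ.[ℂ] L2 a b :=
  if α ∈ resonantSet Ψ then
    coupledOp a b U (resonantCoupling (theta Ψ α) (β * vartheta Ψ Φ α))
  else
    coupledOp a b U clampedCoupling

end SingularFourthOrder

namespace SingularFourthOrder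

/-! ### Integration by parts for primitives of integrable functions -/

/-! Write S_ε for the perturbed operators and S for the limit operator. The heart is a compactness
statement for graphs, `exists_subseq_mem_limitOp_graph`: if S_ε u_ε = h_ε with u_ε and h_ε bounded
in L₂ and ε → 0, then u_ε converges in norm along a subsequence, and if h_ε converges along it too,
the pair of limits lies in the graph of S.

Outside [-ε, ε] the potential is U, so the clamped ends bound u_ε there together with its
derivatives up to order three (`exists_outer_bound`). In the stretched variable ξ = x/ε the function
V(ξ) = u_ε(εξ) therefore has V'(±1) = O(ε), V''(±1) = O(ε²), V'''(±1) = O(ε³), and it solves V⁗ +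
αΨV = 0 up to small terms. Off resonance this problem has only the zero solution, so V = O(ε²) and
the values and slopes of u_ε at ±ε tend to zero. At resonance V is V'(-1)w up to O(ε²), where w is
the resonance function with w'(-1) = 1; hence u_ε(±ε) → 0 and u_ε'(ε) ≈ θ u_ε'(-ε). Green's formula
for V and w yields θ u_ε''(ε) - u_ε''(-ε) ≈ κ u_ε'(-ε), with κ produced by the term εβΦ
(`exists_inner_estimate`). Both cases run through one pair: σ = 1, W = w at resonance and σ = 0, W =
0 otherwise.

The rest is abstract (`SpectralApproximation`). Limits of eigenvalues along sequences ε → 0 are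
eigenvalues of S, because unit eigenvectors are precompact. S is symmetric in a separable space, so
its eigenvalues are countable. A branch ε ↦ λ_k^ε is continuous and hence cannot meet a
non-eigenvalue c of S for arbitrarily small ε (`eventually_lt_or_gt`); being bounded above, it
either converges or tends to -∞, which is the first claim.

For the second claim, suppose that no branch tends to an eigenvalue μ of S. Only boundedly many
branches stay below a given level (`exists_eigenvalue_lower_bound`), so the resolvents of S_ε at μ
are uniformly bounded. Solving (S_ε - μ)u = f for an eigenvector f of S and passing to the limit
puts f into the range of S - μ, whence f is orthogonal to itself. Two branches with the same limit
would produce two orthonormal eigenvectors, so a simple eigenvalue attracts only one. -/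

theorem integral_deriv_mul_of_primitive_real {f f' g g' : ℝ → ℝ} {c d : ℝ} (hcd : c ≤ d)
    (hf' : IntervalIntegrable f' volume c d) (hg' : IntervalIntegrable g' volume c d)
    (hf : ∀ x ∈ Icc c d, f x = f c + ∫ t in c..x, f' t)
    (hg : ∀ x ∈ Icc c d, g x = g c + ∫ t in c..x, g' t) :
    ∫ x in c..d, (f' x * g x + f x * g' x) = f d * g d - f c * g c := by
  have key : ∀ {k k' : ℝ → ℝ}, IntervalIntegrable k' volume c d →
      AbsolutelyContinuousOnInterval (fun x => k c + ∫ t in c..x, k' t) c d ∧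
      ∀ᵐ x, x ∈ uIcc c d → deriv (fun x => k c + ∫ t in c..x, k' t) x = k' x := by
    intro k k' hk
    constructor
    · have h1 : AbsolutelyContinuousOnInterval (fun _ : ℝ => k c) c d :=
        (LipschitzWith.const (k c)).lipschitzOnWith.absolutelyContinuousOnInterval
      exact h1.add (hk.absolutelyContinuousOnInterval_intervalIntegral left_mem_uIcc)
    · filter_upwards [hk.ae_hasDerivAt_integral] with x hx hxI
      exact ((hx hxI c left_mem_uIcc).const_add (k c)).deriv
  obtain ⟨hF, hF'⟩ := key (k := f) hf'
  obtain ⟨hG, hG'⟩ := key (k := g) hg'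
  have h := hF.integral_deriv_mul_eq_sub hG
  simp only [intervalIntegral.integral_same, add_zero] at h
  rw [hf d (right_mem_Icc.2 hcd), hg d (right_mem_Icc.2 hcd), ← h]
  refine intervalIntegral.integral_congr_ae ?_
  filter_upwards [hF', hG'] with x h1 h2 hx
  have hx' : x ∈ uIcc c d := uIoc_subset_uIcc hx
  rw [h1 hx', h2 hx']
  rw [uIcc_of_le hcd] at hx'
  rw [← hf x hx', ← hg x hx']

/-- Both sides are real bilinear in the two functions, so the real formula for all pairs of real and
imaginary parts recombines to the complex one. -/
theorem integral_deriv_mul_of_primitive {f f' g g' : ℝ → ℂ} {c d : ℝ} (hcd : c ≤ d)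
    (hf' : IntervalIntegrable f' volume c d) (hg' : IntervalIntegrable g' volume c d)
    (hf : ∀ x ∈ Icc c d, f x = f c + ∫ t in c..x, f' t)
    (hg : ∀ x ∈ Icc c d, g x = g c + ∫ t in c..x, g' t) :
    ∫ x in c..d, (f' x * g x + f x * g' x) = f d * g d - f c * g c := by
  have hsub : ∀ {k : ℝ → ℂ}, IntervalIntegrable k volume c d → ∀ x ∈ Icc c d,
      IntervalIntegrable k volume c x := fun hk x hx =>
    hk.mono_set (by rw [uIcc_of_le hcd, uIcc_of_le hx.1]; exact Icc_subset_Icc_right hx.2)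
  have hL : ∀ (l : ℂ →L[ℝ] ℝ) {k k' : ℝ → ℂ}, IntervalIntegrable k' volume c d →
      (∀ x ∈ Icc c d, k x = k c + ∫ t in c..x, k' t) →
      ∀ x ∈ Icc c d, l (k x) = l (k c) + ∫ t in c..x, l (k' t) := by
    intro l k k' hk' hk x hx
    rw [l.intervalIntegral_comp_comm (hsub hk' x hx), ← map_add, ← hk x hx]
  have hI : ∀ (l : ℂ →L[ℝ] ℝ) {k : ℝ → ℂ}, IntervalIntegrable k volume c d →
      IntervalIntegrable (fun x => l (k x)) volume c d := fun l k hk =>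
    ⟨l.integrable_comp hk.1, l.integrable_comp hk.2⟩
  have hR : ∀ l m : ℂ →L[ℝ] ℝ, ∫ x in c..d, (l (f' x) * m (g x) + l (f x) * m (g' x)) =
      l (f d) * m (g d) - l (f c) * m (g c) := fun l m =>
    integral_deriv_mul_of_primitive_real hcd (hI l hf') (hI m hg') (hL l hf' hf) (hL m hg' hg)
  have hcont : ∀ {k k' : ℝ → ℂ}, IntervalIntegrable k' volume c d →
      (∀ x ∈ Icc c d, k x = k c + ∫ t in c..x, k' t) → ContinuousOn k (uIcc c d) := by
    intro k k' hk' hk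
    rw [uIcc_of_le hcd]
    have := (intervalIntegral.continuousOn_primitive_interval (μ := volume) (f := k') (a := c)
      (b := d) (by rwa [uIcc_of_le hcd, ← intervalIntegrable_iff_integrableOn_Icc_of_le hcd]))
    rw [uIcc_of_le hcd] at this
    exact (continuousOn_const.add this).congr hk
  have hfc := hcont hf' hf
  have hgc := hcont hg' hg
  have hint : IntervalIntegrable (fun x => f' x * g x + f x * g' x) volume c d :=
    (hf'.mul_continuousOn hgc).add (hg'.continuousOn_mul hfc)
  have hint' : ∀ l m : ℂ →L[ℝ] ℝ,
      IntervalIntegrable (fun x => l (f' x) * m (g x) + l (f x) * m (g' x)) volume c d :=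
    fun l m => ((hI l hf').mul_continuousOn (m.continuous.comp_continuousOn hgc)).add
      ((hI m hg').continuousOn_mul (l.continuous.comp_continuousOn hfc))
  apply Complex.ext
  · have h1 := Complex.reCLM.intervalIntegral_comp_comm hint
    simp only [Complex.reCLM_apply] at h1
    rw [← h1]
    have h2 := hR Complex.reCLM Complex.reCLM
    have h3 := hR Complex.imCLM Complex.imCLM
    have h4 := intervalIntegral.integral_sub (hint' Complex.reCLM Complex.reCLM)
      (hint' Complex.imCLM Complex.imCLM)
    rw [h2, h3] at h4
    simp only [Complex.reCLM_apply, Complex.imCLM_apply] at h4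
    simp only [Complex.sub_re, Complex.mul_re]
    rw [show (f d).re * (g d).re - (f d).im * (g d).im - ((f c).re * (g c).re - (f c).im * (g c).im)
      = (f d).re * (g d).re - (f c).re * (g c).re - ((f d).im * (g d).im - (f c).im * (g c).im)
        by ring,
      ← h4]
    congr 1
    ext x
    simp only [Complex.add_re, Complex.mul_re]
    ring
  · have h1 := Complex.imCLM.intervalIntegral_comp_comm hint
    simp only [Complex.imCLM_apply] at h1
    rw [← h1]
    have h2 := hR Complex.reCLM Complex.imCLM
    have h3 := hR Complex.imCLM Complex.reCLM
    have h4 := intervalIntegral.integral_add (hint' Complex.reCLM Complex.imCLM)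
      (hint' Complex.imCLM Complex.reCLM)
    rw [h2, h3] at h4
    simp only [Complex.reCLM_apply, Complex.imCLM_apply] at h4
    simp only [Complex.sub_im, Complex.mul_im]
    rw [show (f d).re * (g d).im + (f d).im * (g d).re - ((f c).re * (g c).im + (f c).im * (g c).re)
      = (f d).re * (g d).im - (f c).re * (g c).im + ((f d).im * (g d).re - (f c).im * (g c).re)
        by ring,
      ← h4]
    congr 1
    ext x
    simp only [Complex.add_im, Complex.mul_im]
    ring

/-! ### Calculus of Sobolev functions of order four -/

section Calculus

variable {𝕜 : Type*} [RCLike 𝕜] {c d : ℝ} {D E : ℕ → ℝ → 𝕜}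

theorem IsSobolevFour.integral_eq_sub (h : IsSobolevFour c d D) {j : ℕ} (hj : j < 4)
    {x y : ℝ} (hx : x ∈ Icc c d) (hy : y ∈ Icc c d) :
    ∫ t in x..y, D (j + 1) t = D j y - D j x := by
  rw [h.primitive j hj x hx, h.primitive j hj y hy, add_sub_add_left_eq_sub,
    intervalIntegral.integral_interval_sub_left (h.intervalIntegrable hj hy)
      (h.intervalIntegrable hj hx)]

theorem IsSobolevFour.mono (h : IsSobolevFour c d D) {c' d' : ℝ} (hc : c ≤ c') (hd : d' ≤ d) :
    IsSobolevFour c' d' D := by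
  refine ⟨h.memLp.mono_measure (Measure.restrict_mono (Ioo_subset_Ioo hc hd) le_rfl),
    fun j hj x hx => ?_⟩
  have h1 : c' ∈ Icc c d := ⟨hc, hx.1.trans (hx.2.trans hd)⟩
  have h2 : x ∈ Icc c d := ⟨hc.trans hx.1, hx.2.trans hd⟩
  rw [h.integral_eq_sub hj h1 h2]
  ring

theorem IsSobolevFour.sub (h : IsSobolevFour c d D) (h' : IsSobolevFour c d E) :
    IsSobolevFour c d (D - E) := by
  have := h.add (h'.smul (-1))
  rwa [neg_one_smul, ← sub_eq_add_neg] at this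

/-- The function with fourth derivative `F` and derivatives `e 0, …, e 3` at `p`. -/
noncomputable def primitiveFour (p : ℝ) (F : ℝ → 𝕜) (e : ℕ → 𝕜) : ℕ → ℝ → 𝕜
  | 0 => fun x => e 0 + ∫ t in p..x, primitiveFour p F e 1 t
  | 1 => fun x => e 1 + ∫ t in p..x, primitiveFour p F e 2 t
  | 2 => fun x => e 2 + ∫ t in p..x, primitiveFour p F e 3 t
  | 3 => fun x => e 3 + ∫ t in p..x, F t
  | _ + 4 => F
termination_by j => 4 - j

theorem primitiveFour_base (p : ℝ) (F : ℝ → 𝕜) (e : ℕ → 𝕜) {j : ℕ} (hj : j < 4) :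
    primitiveFour p F e j p = e j := by
  interval_cases j <;> simp [primitiveFour]

theorem primitiveFour_four (p : ℝ) (F : ℝ → 𝕜) (e : ℕ → 𝕜) : primitiveFour p F e 4 = F := by
  simp [primitiveFour]

theorem primitiveFour_eq (p : ℝ) (F : ℝ → 𝕜) (e : ℕ → 𝕜) {j : ℕ} (hj : j < 4) (x : ℝ) :
    primitiveFour p F e j x = e j + ∫ t in p..x, primitiveFour p F e (j + 1) t := by
  interval_cases j <;> simp [primitiveFour]

theorem isSobolevFour_primitiveFour {p : ℝ} {F : ℝ → 𝕜} (e : ℕ → 𝕜) (hp : p ∈ Icc c d)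
    (hF : MemLp F 2 (volume.restrict (Ioo c d))) : IsSobolevFour c d (primitiveFour p F e) := by
  have hcd : c ≤ d := hp.1.trans hp.2
  have h4 : IntegrableOn F (Icc c d) := by
    rw [integrableOn_Icc_iff_integrableOn_Ioo]
    exact hF.integrable (by norm_num)
  have step : ∀ j < 4, IntegrableOn (primitiveFour p F e (j + 1)) (Icc c d) →
      IntegrableOn (primitiveFour p F e j) (Icc c d) := by
    intro j hj hi
    have h1 : ContinuousOn (fun x => e j + ∫ t in p..x, primitiveFour p F e (j + 1) t)
        (Icc c d) := by
      have := intervalIntegral.continuousOn_primitive_interval' (μ := volume)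
        (f := primitiveFour p F e (j + 1)) (a := p) (b₁ := c) (b₂ := d)
        ((intervalIntegrable_iff_integrableOn_Icc_of_le hcd).2 hi) (by rwa [uIcc_of_le hcd])
      rw [uIcc_of_le hcd] at this
      exact continuousOn_const.add this
    exact (h1.congr fun x _ => primitiveFour_eq p F e hj x).integrableOn_Icc
  have hi4 : IntegrableOn (primitiveFour p F e 4) (Icc c d) := by rwa [primitiveFour_four]
  have hi3 := step 3 (by norm_num) hi4
  have hi2 := step 2 (by norm_num) hi3
  have hi1 := step 1 (by norm_num) hi2
  have hi : ∀ j < 4, IntegrableOn (primitiveFour p F e (j + 1)) (Icc c d) := by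
    intro j hj
    interval_cases j
    exacts [hi1, hi2, hi3, hi4]
  refine ⟨by rwa [primitiveFour_four], fun j hj x hx => ?_⟩
  have hii : ∀ y ∈ Icc c d, ∀ z ∈ Icc c d,
      IntervalIntegrable (primitiveFour p F e (j + 1)) volume y z := fun y hy z hz =>
    ((intervalIntegrable_iff_integrableOn_Icc_of_le hcd).2 (hi j hj)).mono_set
      (by rw [uIcc_of_le hcd]; exact OrdConnected.uIcc_subset ordConnected_Icc hy hz)
  rw [primitiveFour_eq p F e hj x, primitiveFour_eq p F e hj c, add_assoc,
    intervalIntegral.integral_add_adjacent_intervals (hii p hp c (left_mem_Icc.2 hcd))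
      (hii c (left_mem_Icc.2 hcd) x hx)]

theorem IsSobolevFour.norm_integral_le (h : IsSobolevFour c d D) {j : ℕ} (hj : j ≤ 4)
    {x y : ℝ} (hx : x ∈ Icc c d) (hy : y ∈ Icc c d) :
    ‖∫ t in x..y, D j t‖ ≤ ∫ t in c..d, ‖D j t‖ := by
  have hcd : c ≤ d := hx.1.trans hx.2
  refine (intervalIntegral.norm_integral_le_integral_norm_uIoc).trans ?_
  rw [intervalIntegral.integral_of_le hcd]
  refine setIntegral_mono_set ((h.integrableOn hj).mono_set Ioc_subset_Icc_self).norm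
    (Eventually.of_forall fun _ => norm_nonneg _) (LE.le.eventuallyLE ?_)
  exact Ioc_subset_Ioc (le_min hx.1 hy.1) (max_le hx.2 hy.2)

/-- The derivatives of a Sobolev function are controlled by their values at one point and by the
`L₁`-norm of the fourth derivative. -/
theorem IsSobolevFour.norm_le (h : IsSobolevFour c d D) {p : ℝ} (hp : p ∈ Icc c d) {A : ℝ}
    (hA : ∀ j < 4, ‖D j p‖ ≤ A) (hA4 : ∫ t in c..d, ‖D 4 t‖ ≤ A) {j : ℕ} (hj : j < 4) {x : ℝ}
    (hx : x ∈ Icc c d) : ‖D j x‖ ≤ 2 * (1 + (d - c)) ^ 3 * A := by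
  have hcd : c ≤ d := hx.1.trans hx.2
  have hA0 : 0 ≤ A := (norm_nonneg _).trans (hA 0 (by norm_num))
  have hL : 0 ≤ d - c := sub_nonneg.2 hcd
  have h1 : ∀ i < 4, ∀ y ∈ Icc c d, ‖D i y‖ ≤ A + ‖∫ t in p..y, D (i + 1) t‖ := by
    intro i hi y hy
    have : D i y = D i p + ∫ t in p..y, D (i + 1) t := by
      rw [h.integral_eq_sub hi hp hy]; ring
    rw [this]
    exact (norm_add_le _ _).trans (by gcongr; exact hA i hi)
  -- Downward from the third derivative, which is at most 2 A: each further integration costs a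
  -- factor 1 + (d - c).
  have key : ∀ k < 4, ∀ y ∈ Icc c d, ‖D (3 - k) y‖ ≤ 2 * (1 + (d - c)) ^ k * A := by
    intro k
    induction k with
    | zero =>
      intro _ y hy
      have := h1 3 (by norm_num) y hy
      have h2 := h.norm_integral_le (j := 4) le_rfl hp hy
      simp only [Nat.sub_zero, pow_zero]
      norm_num at this
      linarith
    | succ k ih =>
      intro hk y hy
      have h2 := h1 (3 - (k + 1)) (by omega) y hy
      rw [show 3 - (k + 1) + 1 = 3 - k by omega] at h2
      have h3 : ‖∫ t in p..y, D (3 - k) t‖ ≤ 2 * (1 + (d - c)) ^ k * A * |y - p| := by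
        refine intervalIntegral.norm_integral_le_of_norm_le_const fun t ht => ih (by omega) t ?_
        exact OrdConnected.uIcc_subset ordConnected_Icc hp hy (uIoc_subset_uIcc ht)
      have h4 : |y - p| ≤ d - c := abs_sub_le_of_le_of_le hy.1 hy.2 hp.1 hp.2
      have h5 : 2 * (1 + (d - c)) ^ k * A * |y - p| ≤ 2 * (1 + (d - c)) ^ k * A * (d - c) := by
        gcongr
      have h6 : A ≤ 2 * (1 + (d - c)) ^ k * A := by
        have : (1 : ℝ) ≤ (1 + (d - c)) ^ k := one_le_pow₀ (by linarith)
        nlinarith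
      calc _ ≤ A + 2 * (1 + (d - c)) ^ k * A * (d - c) := h2.trans (by linarith)
        _ ≤ 2 * (1 + (d - c)) ^ k * A + 2 * (1 + (d - c)) ^ k * A * (d - c) := by linarith
        _ = _ := by ring
  have h2 := key (3 - j) (by omega) x hx
  rw [show 3 - (3 - j) = j by omega] at h2
  refine h2.trans ?_
  gcongr
  · linarith
  · omega

/-- Continuity upgrades an almost everywhere zero to an everywhere zero; then the primitive of the
next derivative is constant, and Lebesgue differentiation makes that derivative vanish almost
everywhere. -/
theorem IsSobolevFour.eqOn_zero (h : IsSobolevFour c d D) (hcd : c < d)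
    (h0 : ∀ᵐ x ∂(volume.restrict (Ioo c d)), D 0 x = 0) {j : ℕ} (hj : j < 4) {x : ℝ}
    (hx : x ∈ Icc c d) : D j x = 0 := by
  have cont : ∀ i < 4, (∀ᵐ x ∂(volume.restrict (Ioo c d)), D i x = 0) →
      ∀ y ∈ Icc c d, D i y = 0 := by
    intro i hi hz
    refine Measure.eqOn_Icc_of_ae_eq volume hcd.ne ?_ (h.continuousOn hi)
      (continuousOn_const (c := (0 : 𝕜)))
    rw [← Measure.restrict_congr_set Ioo_ae_eq_Icc]
    exact hz
  have key : ∀ i < 3, (∀ y ∈ Icc c d, D i y = 0) → ∀ y ∈ Icc c d, D (i + 1) y = 0 := by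
    intro i hi hz
    refine cont (i + 1) (by omega) ?_
    have hint := h.intervalIntegrable (j := i + 1) (by omega) (right_mem_Icc.2 hcd.le)
    rw [ae_restrict_iff' measurableSet_Ioo]
    filter_upwards [hint.ae_hasDerivAt_integral] with y hy hyI
    have hd := hy (by rw [uIcc_of_le hcd.le]; exact Ioo_subset_Icc_self hyI) c
      (by rw [uIcc_of_le hcd.le]; exact left_mem_Icc.2 hcd.le)
    have hev : (fun y => ∫ t in c..y, D (i + 1) t) =ᶠ[𝓝 y] fun _ => (0 : 𝕜) := by
      filter_upwards [Ioo_mem_nhds hyI.1 hyI.2] with z hz'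
      rw [h.integral_eq_sub (by omega) (left_mem_Icc.2 hcd.le) (Ioo_subset_Icc_self hz'),
        hz _ (Ioo_subset_Icc_self hz'), hz _ (left_mem_Icc.2 hcd.le), sub_zero]
    exact hd.unique ((hasDerivAt_const y (0 : 𝕜)).congr_of_eventuallyEq hev)
  have k0 := cont 0 (by norm_num) h0
  have k1 := key 0 (by norm_num) k0
  have k2 := key 1 (by norm_num) k1
  have k3 := key 2 (by norm_num) k2
  interval_cases j
  exacts [k0 x hx, k1 x hx, k2 x hx, k3 x hx]

/-- Makes the traces of an L₂ class independent of the family that represents it. -/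
theorem IsSobolevFour.eqOn_of_ae_eq (h : IsSobolevFour c d D) (h' : IsSobolevFour c d E)
    (hcd : c < d) (h0 : ∀ᵐ x ∂(volume.restrict (Ioo c d)), D 0 x = E 0 x) {j : ℕ} (hj : j < 4)
    {x : ℝ} (hx : x ∈ Icc c d) : D j x = E j x := by
  have := (h.sub h').eqOn_zero hcd (by filter_upwards [h0] with y hy; simp [hy]) hj hx
  simpa [sub_eq_zero] using this

theorem isSobolevFour_of_hasDerivAt (hD : ∀ j < 4, ∀ x, HasDerivAt (D j) (D (j + 1) x) x)
    (h4 : Continuous (D 4)) : IsSobolevFour c d D := by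
  constructor
  · have : MemLp (D 4) 2 (volume.restrict (Icc c d)) := by
      obtain ⟨C, hC⟩ := isCompact_Icc.exists_bound_of_continuousOn (h4.continuousOn (s := Icc c d))
      refine MemLp.of_bound h4.aestronglyMeasurable C ?_
      rw [ae_restrict_iff' measurableSet_Icc]
      exact Eventually.of_forall hC
    exact this.mono_measure (Measure.restrict_mono Ioo_subset_Icc_self le_rfl)
  · intro j hj x hx
    have hcont : Continuous (D (j + 1)) := by
      rcases Nat.lt_or_ge (j + 1) 4 with h | h
      · exact continuous_iff_continuousAt.2 fun y => (hD (j + 1) h y).continuousAt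
      · rwa [show j + 1 = 4 by omega]
    rw [intervalIntegral.integral_eq_sub_of_hasDerivAt (fun y _ => hD j hj y)
      (hcont.intervalIntegrable _ _)]
    ring

theorem IsSobolevFour.ofReal {D : ℕ → ℝ → ℝ} (h : IsSobolevFour c d D) :
    IsSobolevFour c d (fun j x => (D j x : ℂ)) := by
  refine ⟨h.memLp.ofReal, fun j hj x hx => ?_⟩
  rw [intervalIntegral.integral_ofReal, h.primitive j hj x hx]
  push_cast
  rfl

theorem IsSobolevFour.comp_clm {D : ℕ → ℝ → ℂ} (h : IsSobolevFour c d D) (l : ℂ →L[ℝ] 𝕜) :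
    IsSobolevFour c d (fun j x => l (D j x)) := by
  refine ⟨l.comp_memLp' h.memLp, fun j hj x hx => ?_⟩
  rw [l.intervalIntegral_comp_comm (h.intervalIntegrable hj hx), ← map_add,
    ← h.primitive j hj x hx]

theorem measurePreserving_neg_Ioo (c d : ℝ) :
    MeasurePreserving (fun x : ℝ => -x) (volume.restrict (Ioo (-d) (-c)))
      (volume.restrict (Ioo c d)) := by
  have h1 := (Measure.measurePreserving_neg (volume : Measure ℝ)).restrict_preimage
    (measurableSet_Ioo (a := c) (b := d))
  have h2 : (fun x : ℝ => -x) ⁻¹' Ioo c d = Ioo (-d) (-c) := by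
    ext x
    simp only [mem_preimage, mem_Ioo]
    constructor <;> rintro ⟨h1, h2⟩ <;> constructor <;> linarith
  have h3 : (Neg.neg : ℝ → ℝ) = fun x => -x := rfl
  rwa [h3, h2] at h1

/-- Transfers the estimates and limits obtained to the right of the origin to the left. -/
theorem IsSobolevFour.reflect (h : IsSobolevFour c d D) :
    IsSobolevFour (-d) (-c) (fun j x => (-1) ^ j * D j (-x)) := by
  constructor
  · have h1 := measurePreserving_neg_Ioo c d
    have := h.memLp.comp_measurePreserving h1
    simpa using this.const_mul ((-1) ^ 4)
  · intro j hj x hx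
    have hx' : -x ∈ Icc c d := ⟨by linarith [hx.2], by linarith [hx.1]⟩
    have hd : d ∈ Icc c d := right_mem_Icc.2 (hx'.1.trans hx'.2)
    rw [intervalIntegral.integral_const_mul,
      intervalIntegral.integral_comp_neg (fun t => D (j+1) t),
      neg_neg, h.integral_eq_sub hj hx' hd, pow_succ]
    ring

/-- With s = ε this is the passage to the stretched variable, which carries the inner region [-ε, ε]
to [-1, 1]. -/
theorem IsSobolevFour.rescale {s : ℝ} (hs : 0 < s) (h : IsSobolevFour (s * c) (s * d) D) :
    IsSobolevFour c d (fun j x => (s : 𝕜) ^ j * D j (s * x)) := by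
  constructor
  · have h0 : (fun x : ℝ => s * x) ⁻¹' Ioo (s * c) (s * d) = Ioo c d := by
      ext x; simp only [mem_preimage, mem_Ioo, mul_lt_mul_iff_right₀ hs]
    have hmap : (volume.restrict (Ioo c d)).map (fun x : ℝ => s * x) =
        ENNReal.ofReal |s⁻¹| • volume.restrict (Ioo (s * c) (s * d)) := by
      have h1 := Real.map_volume_mul_left hs.ne'
      have h2 := Measure.restrict_map (μ := volume) (measurable_const_mul s)
        (measurableSet_Ioo (a := s * c) (b := s * d))
      rw [h0] at h2
      rw [← Measure.restrict_smul, ← h1, h2]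
    have h1 : MemLp (D 4) 2 ((volume.restrict (Ioo c d)).map (fun x : ℝ => s * x)) := by
      rw [hmap]
      exact h.memLp.smul_measure (by simp)
    exact (h1.comp_of_map (measurable_const_mul s).aemeasurable).const_mul _
  · intro j hj x hx
    have hc : s * c ∈ Icc (s * c) (s * d) := left_mem_Icc.2 (by gcongr; exact hx.1.trans hx.2)
    have hx' : s * x ∈ Icc (s * c) (s * d) := ⟨by gcongr; exact hx.1, by gcongr; exact hx.2⟩
    have h1 := intervalIntegral.integral_comp_mul_left (a := c) (b := x) (fun t => D (j+1) t) hs.ne'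
    rw [intervalIntegral.integral_const_mul, h1, h.integral_eq_sub hj hc hx',
      RCLike.real_smul_eq_coe_mul,
      pow_succ]
    have hs' : (s : 𝕜) ≠ 0 := by exact_mod_cast hs.ne'
    push_cast
    field_simp
    ring

end Calculus

/-! ### Green's formula, energy and the Poincaré inequality -/

section Green

variable {c d : ℝ} {D E : ℕ → ℝ → ℂ}

theorem IsSobolevFour.mul_intervalIntegrable (hD : IsSobolevFour c d D) (hE : IsSobolevFour c d E)
    {j k : ℕ} (hj : j ≤ 4) (hk : k < 4) (hcd : c ≤ d) :
    IntervalIntegrable (fun x => D j x * E k x) volume c d :=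
  (hD.intervalIntegrable hj (right_mem_Icc.2 hcd)).mul_continuousOn
    (by rw [uIcc_of_le hcd]; exact hE.continuousOn hk)

theorem IsSobolevFour.integral_mul (hD : IsSobolevFour c d D) (hE : IsSobolevFour c d E)
    {j k : ℕ} (hj : j < 4) (hk : k < 4) (hcd : c ≤ d) :
    ∫ x in c..d, D (j + 1) x * E k x =
      D j d * E k d - D j c * E k c - ∫ x in c..d, D j x * E (k + 1) x := by
  rw [← integral_deriv_mul_of_primitive hcd (hD.intervalIntegrable hj (right_mem_Icc.2 hcd))
    (hE.intervalIntegrable hk (right_mem_Icc.2 hcd)) (hD.primitive j hj) (hE.primitive k hk),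
    intervalIntegral.integral_add (hD.mul_intervalIntegrable hE hj hk hcd)]
  · ring
  · simp_rw [mul_comm (D j _)]
    exact hE.mul_intervalIntegrable hD hk hj hcd

theorem IsSobolevFour.integral_four_mul (hD : IsSobolevFour c d D) (hE : IsSobolevFour c d E)
    (hcd : c ≤ d) :
    ∫ x in c..d, D 4 x * E 0 x = (D 3 d * E 0 d - D 2 d * E 1 d) - (D 3 c * E 0 c - D 2 c * E 1 c)
      + ∫ x in c..d, D 2 x * E 2 x := by
  rw [hD.integral_mul hE (j := 3) (k := 0) (by norm_num) (by norm_num) hcd,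
    hD.integral_mul hE (j := 2) (k := 1) (by norm_num) (by norm_num) hcd]
  ring

/-- Green's formula. -/
theorem IsSobolevFour.green (hD : IsSobolevFour c d D) (hE : IsSobolevFour c d E) (hcd : c ≤ d) :
    (∫ x in c..d, D 4 x * E 0 x) - ∫ x in c..d, D 0 x * E 4 x =
      (D 3 d * E 0 d - D 2 d * E 1 d + D 1 d * E 2 d - D 0 d * E 3 d) -
      (D 3 c * E 0 c - D 2 c * E 1 c + D 1 c * E 2 c - D 0 c * E 3 c) := by
  have h := hE.integral_four_mul hD hcd
  simp_rw [mul_comm (D 0 _)]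
  rw [h, hD.integral_four_mul hE hcd]
  simp_rw [mul_comm (E 2 _)]
  ring

end Green

/-! ### Symmetric operators with compact resolvent -/

section CompactResolvent

variable {H : Type*} [NormedAddCommGroup H] [InnerProductSpace ℂ H] {T : H →ₗ.[ℂ] H}

/-- The operator `T` is symmetric (its domain is not required to be dense). -/
def IsSymmetricOp (T : H →ₗ.[ℂ] H) : Prop :=
  ∀ p ∈ T.graph, ∀ p' ∈ T.graph, inner ℂ p.2 p'.1 = inner ℂ p.1 p'.2

/-- Each real `z` that is not an eigenvalue is a point of the resolvent set and the resolvent at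
`z` is compact. -/
def HasCompactResolvent (T : H →ₗ.[ℂ] H) : Prop :=
  ∀ z : ℝ, eigenspace T z = ⊥ →
    ∃ R : H →L[ℂ] H, IsCompactOperator R ∧ ∀ h, (R h, h + (z : ℂ) • R h) ∈ T.graph

theorem mem_eigenspace_iff {z : ℂ} {u : H} : u ∈ eigenspace T z ↔ (u, z • u) ∈ T.graph := by
  rw [LinearPMap.mem_graph_iff]
  simp only [eigenspace, Submodule.mem_map, LinearMap.mem_ker, LinearMap.sub_apply,
    LinearMap.smul_apply, Submodule.subtype_apply, sub_eq_zero]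
  constructor
  · rintro ⟨y, hy, rfl⟩
    exact ⟨y, rfl, hy⟩
  · rintro ⟨y, rfl, hy⟩
    exact ⟨y, hy, rfl⟩

theorem mem_opSpectrum_of_eigenvector {z : ℂ} {u : H} (hu : (u, z • u) ∈ T.graph) (h0 : u ≠ 0) :
    z ∈ opSpectrum T := by
  rintro ⟨R, -, hR⟩
  obtain ⟨y, hy, hy'⟩ := (LinearPMap.mem_graph_iff T).1 hu
  simp only at hy hy'
  have := hR y
  rw [hy', hy, sub_self, map_zero] at this
  exact h0 this.symm

theorem IsSymmetricOp.inner_eq_zero (hT : IsSymmetricOp T) {r s : ℝ} (hrs : r ≠ s) {u v : H}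
    (hu : (u, (r : ℂ) • u) ∈ T.graph) (hv : (v, (s : ℂ) • v) ∈ T.graph) : inner ℂ u v = 0 := by
  have h := hT _ hu _ hv
  simp only [inner_smul_left, inner_smul_right, Complex.conj_ofReal] at h
  have h2 : ((r : ℂ) - s) * inner ℂ u v = 0 := by rw [sub_mul, h, sub_self]
  rcases mul_eq_zero.1 h2 with h3 | h3
  · exact absurd (by exact_mod_cast sub_eq_zero.1 h3) hrs
  · exact h3

theorem IsEigenvalueEnumeration.eigenspace_eq_bot {lam : ℕ → ℝ}
    (hlam : IsEigenvalueEnumeration T lam) {z : ℂ} (hz : ∀ k, (lam k : ℂ) ≠ z) :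
    eigenspace T z = ⊥ := by
  have := hlam.finiteDimensional z
  rw [← Submodule.finrank_eq_zero (R := ℂ), hlam.multiplicity z, Set.ncard_eq_zero (hlam.finite z)]
  exact Set.eq_empty_iff_forall_notMem.2 hz

/-- A resolvent at a real point is compact and symmetric and its eigenvectors are those of `T`, so
the spectral theorem for compact operators gives completeness. The multiplicity condition matches
the indices with given `lam k` to an orthonormal basis of the eigenspace. -/
theorem exists_eigenbasis [CompleteSpace H] (hT : IsSymmetricOp T) (hR : HasCompactResolvent T)
    {lam : ℕ → ℝ}
    (hlam : IsEigenvalueEnumeration T lam) :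
    ∃ e : HilbertBasis ℕ ℂ H, ∀ k, (e k, (lam k : ℂ) • e k) ∈ T.graph := by
  -- A countable set is null, so some real point is not an eigenvalue.
  obtain ⟨z, hz⟩ : ∃ z : ℝ, z ∉ range lam := ((countable_range lam).ae_notMem volume).exists
  obtain ⟨R, hRc, hRg⟩ := hR z (hlam.eigenspace_eq_bot fun k hk =>
    hz ⟨k, by exact_mod_cast hk⟩)
  have hfin := hlam.finiteDimensional
  have heq : ∀ r : ℂ, Nonempty ({k : ℕ | (lam k : ℂ) = r} ≃
      Fin (Module.finrank ℂ (eigenspace T r))) := fun r => by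
    have := (hlam.finite r).to_subtype
    exact ⟨Finite.equivFinOfCardEq (by rw [hlam.multiplicity r, Nat.card_coe_set_eq])⟩
  have eqv := fun r => (heq r).some
  let b : ∀ r : ℂ, {k : ℕ | (lam k : ℂ) = r} → H := fun r k =>
    (stdOrthonormalBasis ℂ (eigenspace T r) (eqv r k) : H)
  let e : ℕ → H := fun k => b (lam k) ⟨k, rfl⟩
  have heb : ∀ (r : ℂ) (k : ℕ) (hk : (lam k : ℂ) = r), e k = b r ⟨k, hk⟩ := by
    rintro r k rfl
    rfl
  have hmem : ∀ k, (e k, (lam k : ℂ) • e k) ∈ T.graph := fun k =>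
    mem_eigenspace_iff.1 (Submodule.coe_mem _)
  have hon : ∀ r : ℂ, Orthonormal ℂ (b r) := fun r =>
    ((stdOrthonormalBasis ℂ (eigenspace T r)).orthonormal.comp (eqv r)
      (eqv r).injective).comp_linearIsometry (eigenspace T r).subtypeₗᵢ
  have hone : Orthonormal ℂ e := by
    refine ⟨fun k => (hon (lam k)).1 _, fun k l hkl => ?_⟩
    by_cases h : lam k = lam l
    · change inner ℂ (e k) (e l) = 0
      rw [heb (lam l) k (by rw [h]), heb (lam l) l rfl]
      exact (hon (lam l)).2 fun h' => hkl (congrArg Subtype.val h')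
    · exact hT.inner_eq_zero h (hmem k) (hmem l)
  have hspan : ∀ (r : ℂ), eigenspace T r ≤ Submodule.span ℂ (range e) := by
    intro r v hv
    have h1 := (stdOrthonormalBasis ℂ (eigenspace T r)).sum_repr ⟨v, hv⟩
    have h2 := congrArg (Subtype.val) h1
    simp only [Submodule.coe_sum, Submodule.coe_smul] at h2
    rw [← h2]
    refine Submodule.sum_mem _ fun i _ => Submodule.smul_mem _ _ (Submodule.subset_span ?_)
    refine ⟨((eqv r).symm i : {k : ℕ | (lam k : ℂ) = r}), ?_⟩
    rw [heb r _ ((eqv r).symm i).2]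
    simp [b]
  have hRs : (R : H →ₗ[ℂ] H).IsSymmetric := by
    intro x y
    have h := hT _ (hRg x) _ (hRg y)
    simp only [inner_add_left, inner_add_right, inner_smul_left, inner_smul_right,
      Complex.conj_ofReal] at h
    exact (add_right_cancel h).symm
  -- If R v = ρ v with ρ ≠ 0, then T v = (z + ρ⁻¹) v; and ρ = 0 forces v = 0, since v is then the
  -- value of `T` at zero.
  have hRe : ∀ ρ : ℂ, Module.End.eigenspace (R : Module.End ℂ H) ρ ≤
      Submodule.span ℂ (range e) := by
    intro ρ v hv
    have hv' : R v = ρ • v := Module.End.mem_eigenspace_iff.1 hv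
    have hg := hRg v
    rw [hv'] at hg
    by_cases hρ : ρ = 0
    · subst hρ
      simp only [zero_smul, smul_zero, add_zero] at hg
      rw [LinearPMap.graph_fst_eq_zero_snd T hg rfl]
      exact Submodule.zero_mem _
    · refine hspan (z + ρ⁻¹) (mem_eigenspace_iff.2 ?_)
      have := T.graph.smul_mem ρ⁻¹ hg
      rw [Prod.smul_mk, smul_smul, inv_mul_cancel₀ hρ, one_smul, smul_add, smul_smul, smul_smul]
        at this
      convert this using 2
      rw [add_smul, add_comm]
      congr 2
      field_simp
  have hbot : (Submodule.span ℂ (range e))ᗮ = ⊥ := by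
    rw [eq_bot_iff, ← ContinuousLinearMap.orthogonalComplement_iSup_eigenspaces_eq_bot hRc hRs]
    exact Submodule.orthogonal_le (iSup_le hRe)
  refine ⟨HilbertBasis.mkOfOrthogonalEqBot hone hbot, fun k => ?_⟩
  rw [HilbertBasis.coe_mkOfOrthogonalEqBot]
  exact hmem k

theorem hasSum_norm_inner_sq (e : HilbertBasis ℕ ℂ H) (x : H) :
    HasSum (fun k => ‖inner ℂ (e k) x‖ ^ 2) (‖x‖ ^ 2) := by
  have h := (e.hasSum_inner_mul_inner x x).mapL Complex.reCLM
  simp only [Complex.reCLM_apply] at h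
  convert! h using 1
  · ext k
    rw [← inner_conj_symm x (e k), Complex.conj_mul', ← Complex.ofReal_pow, Complex.ofReal_re]
  · exact (inner_self_eq_norm_sq (𝕜 := ℂ) x).symm

/-- The variational upper bound for the eigenvalues. -/
theorem eigenvalue_le (hT : IsSymmetricOp T) {lam : ℕ → ℝ} (hmono : Monotone lam)
    (e : HilbertBasis ℕ ℂ H) (he : ∀ k, (e k, (lam k : ℂ) • e k) ∈ T.graph) {k : ℕ} {Λ : ℝ}
    (W : Submodule ℂ H) [FiniteDimensional ℂ W] (hW : k < Module.finrank ℂ W)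
    (hWΛ : ∀ u ∈ W, ∃ h, (u, h) ∈ T.graph ∧ (inner ℂ h u).re ≤ Λ * ‖u‖ ^ 2) : lam k ≤ Λ := by
  let φ : W →ₗ[ℂ] (Fin k → ℂ) :=
    LinearMap.pi fun i => (innerSL ℂ (e i) : H →ₗ[ℂ] ℂ) ∘ₗ W.subtype
  -- By dimension, some nonzero vector of `W` is orthogonal to the first `k` eigenvectors; its
  -- expansion involves only eigenvalues at least `lam k`.
  have hker : LinearMap.ker φ ≠ ⊥ := LinearMap.ker_ne_bot_of_finrank_lt (by simpa using hW)
  obtain ⟨u, huk, hu0⟩ := (Submodule.ne_bot_iff _).1 hker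
  have hu : ∀ i < k, inner ℂ (e i) (u : H) = 0 := fun i hi => by
    have := congrFun (LinearMap.mem_ker.1 huk) ⟨i, hi⟩
    simpa [φ] using this
  obtain ⟨h, hg, hle⟩ := hWΛ u u.2
  have h1 : HasSum (fun j => lam j * ‖inner ℂ (e j) (u : H)‖ ^ 2) (inner ℂ h (u : H)).re := by
    have h2 := (e.hasSum_inner_mul_inner h (u : H)).mapL Complex.reCLM
    simp only [Complex.reCLM_apply] at h2
    convert! h2 using 1
    ext j
    have h3 := hT _ hg _ (he j)
    simp only [inner_smul_right] at h3
    rw [h3, mul_assoc, ← inner_conj_symm (u : H) (e j), Complex.conj_mul', ← Complex.ofReal_pow,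
      ← Complex.ofReal_mul, Complex.ofReal_re]
  have h4 : lam k * ‖(u : H)‖ ^ 2 ≤ (inner ℂ h (u : H)).re := by
    refine hasSum_le (fun j => ?_) ((hasSum_norm_inner_sq e (u : H)).mul_left (lam k)) h1
    rcases lt_or_ge j k with hj | hj
    · simp [hu j hj]
    · exact mul_le_mul_of_nonneg_right (hmono hj) (by positivity)
  have h5 : 0 < ‖(u : H)‖ ^ 2 := by
    have : (u : H) ≠ 0 := fun h => hu0 (Subtype.ext h)
    positivity
  exact le_of_mul_le_mul_right (h4.trans hle) h5

/-- The span of the first eigenvectors serves as trial space twice: it compares the eigenvalues of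
two potentials, and its dimension leaves room for functions with prescribed zeros. -/
theorem exists_spectral_subspace {lam : ℕ → ℝ} (hmono : Monotone lam)
    (e : HilbertBasis ℕ ℂ H) (he : ∀ k, (e k, (lam k : ℂ) • e k) ∈ T.graph) (k : ℕ) :
    ∃ W : Submodule ℂ H, FiniteDimensional ℂ W ∧ Module.finrank ℂ W = k + 1 ∧
      ∀ u ∈ W, ∃ h, (u, h) ∈ T.graph ∧ (inner ℂ h u).re ≤ lam k * ‖u‖ ^ 2 := by
  have hon : Orthonormal ℂ (fun i : Fin (k + 1) => e i) :=
    e.orthonormal.comp _ Fin.val_injective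
  refine ⟨Submodule.span ℂ (range fun i : Fin (k + 1) => e i),
    FiniteDimensional.span_of_finite ℂ (finite_range _), ?_, fun u hu => ?_⟩
  · rw [finrank_span_eq_card hon.linearIndependent, Fintype.card_fin]
  · obtain ⟨c, rfl⟩ := (Submodule.mem_span_range_iff_exists_fun ℂ).1 hu
    refine ⟨∑ i, (c i * lam i) • e i, ?_, ?_⟩
    · have : ∑ i : Fin (k + 1), c i • (e i, (lam i : ℂ) • e i) ∈ T.graph :=
        Submodule.sum_mem _ fun i _ => Submodule.smul_mem _ _ (he i)
      convert this using 1
      simp only [Prod.smul_mk, smul_smul]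
      ext <;> simp [Prod.fst_sum, Prod.snd_sum]
    · have h1 := hon.inner_sum (fun i => c i * lam i) c Finset.univ
      have h2 := hon.inner_sum c c Finset.univ
      have h3 : ‖∑ i : Fin (k + 1), c i • e i‖ ^ 2 =
          (inner ℂ (∑ i : Fin (k + 1), c i • e i) (∑ i : Fin (k + 1), c i • e i)).re :=
        (inner_self_eq_norm_sq (𝕜 := ℂ) _).symm
      rw [h3, h1, h2]
      simp only [map_mul, Complex.conj_ofReal, Complex.re_sum, Finset.mul_sum]
      refine Finset.sum_le_sum fun i _ => ?_
      rw [show (starRingEnd ℂ) (c i) * lam i * c i = lam i * ((starRingEnd ℂ) (c i) * c i) by ring,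
        Complex.conj_mul', ← Complex.ofReal_pow, ← Complex.ofReal_mul, Complex.ofReal_re,
        Complex.ofReal_re]
      exact mul_le_mul_of_nonneg_right (hmono (Nat.lt_succ_iff.1 i.2)) (by positivity)

/-- If no eigenvalue is `δ`-close to `μ`, the resolvent at `μ` is bounded by `δ⁻¹`. -/
theorem exists_resolvent_solution [CompleteSpace H] (hT : IsSymmetricOp T)
    (hR : HasCompactResolvent T)
    {lam : ℕ → ℝ} (hlam : IsEigenvalueEnumeration T lam) {μ δ : ℝ} (hδ : 0 < δ)
    (h : ∀ k, δ ≤ |lam k - μ|) (f : H) :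
    ∃ u, (u, f + (μ : ℂ) • u) ∈ T.graph ∧ δ * ‖u‖ ≤ ‖f‖ := by
  obtain ⟨e, he⟩ := exists_eigenbasis hT hR hlam
  obtain ⟨R, -, hRg⟩ := hR μ (hlam.eigenspace_eq_bot fun k hk => by
    have h1 : lam k = μ := by exact_mod_cast hk
    have := h k
    rw [h1, sub_self, abs_zero] at this
    linarith)
  refine ⟨R f, hRg f, ?_⟩
  -- Pairing with an eigenvector diagonalises the equation: the coefficient of `f` is `lam k - μ`
  -- times that of `R f`. Parseval's identity then sums the bounds.
  have h1 : ∀ k, (δ * ‖inner ℂ (e k) (R f)‖) ^ 2 ≤ ‖inner ℂ (e k) f‖ ^ 2 := by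
    intro k
    have h2 := hT _ (he k) _ (hRg f)
    simp only [inner_add_right, inner_smul_left, inner_smul_right, Complex.conj_ofReal] at h2
    have h3 : inner ℂ (e k) f = ((lam k - μ : ℝ) : ℂ) * inner ℂ (e k) (R f) := by
      push_cast
      rw [sub_mul, h2]
      ring
    rw [h3, norm_mul, Complex.norm_real, Real.norm_eq_abs]
    gcongr
    exact h k
  have h4 : δ ^ 2 * ‖R f‖ ^ 2 ≤ ‖f‖ ^ 2 := by
    refine hasSum_le (fun k => ?_) ((hasSum_norm_inner_sq e (R f)).mul_left (δ ^ 2))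
      (hasSum_norm_inner_sq e f)
    rw [← mul_pow]
    exact h1 k
  rw [← mul_pow] at h4
  exact le_of_sq_le_sq h4 (norm_nonneg _)

/-- The real eigenvalues of a symmetric operator in a separable space form a countable set. -/
theorem IsSymmetricOp.countable_eigenvalues [SecondCountableTopology H] (hT : IsSymmetricOp T) :
    {r : ℝ | ∃ u : H, u ≠ 0 ∧ (u, (r : ℂ) • u) ∈ T.graph}.Countable := by
  have key : ∀ r : {r : ℝ | ∃ u : H, u ≠ 0 ∧ (u, (r : ℂ) • u) ∈ T.graph},
      ∃ u : H, ‖u‖ = 1 ∧ (u, ((r : ℝ) : ℂ) • u) ∈ T.graph := by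
    rintro ⟨r, u, hu, hg⟩
    refine ⟨((‖u‖ : ℂ)⁻¹) • u, norm_smul_inv_norm hu, ?_⟩
    have := T.graph.smul_mem ((‖u‖ : ℂ)⁻¹) hg
    rwa [Prod.smul_mk, smul_comm] at this
  choose v hv hvg using key
  -- Orthonormal vectors are at distance √2; the weaker bound 1 already makes the balls of radius
  -- 1/2 disjoint, and a separable space has only countably many disjoint open balls.
  have hdist : ∀ r s, r ≠ s → 1 ≤ ‖v r - v s‖ := by
    intro r s hrs
    have h0 := hT.inner_eq_zero (fun h => hrs (Subtype.ext h)) (hvg r) (hvg s)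
    have := norm_sub_sq (𝕜 := ℂ) (v r) (v s)
    rw [h0, hv, hv] at this
    simp only [map_zero, mul_zero, sub_zero] at this
    nlinarith [norm_nonneg (v r - v s)]
  have hopen : ∀ r, IsOpen (Metric.ball (v r) (1 / 2)) := fun _ => Metric.isOpen_ball
  have hne : ∀ r, (Metric.ball (v r) (1 / 2)).Nonempty := fun r =>
    Metric.nonempty_ball.2 (by norm_num)
  have hdisj : Pairwise (Function.onFun Disjoint fun r => Metric.ball (v r) (1 / 2)) := by
    intro r s hrs
    refine Metric.ball_disjoint_ball ?_
    rw [dist_eq_norm]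
    linarith [hdist r s hrs]
  rw [← Set.countable_coe_iff]
  exact hdisj.countable_of_isOpen_disjoint hopen hne

end CompactResolvent

/-! ### Integrals and norms in `L₂(a, b)` -/

section IntegralNorm

variable {a b : ℝ}

/-- Cauchy–Schwarz, as nonnegativity of the variance of `g` about its mean `m`. -/
theorem sq_integral_le {g : ℝ → ℝ} (hab : a ≤ b) (hg : IntervalIntegrable g volume a b)
    (hg2 : IntervalIntegrable (fun x => g x ^ 2) volume a b) :
    (∫ x in a..b, g x) ^ 2 ≤ (b - a) * ∫ x in a..b, g x ^ 2 := by
  rcases hab.eq_or_lt with rfl | hlt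
  · simp
  have hL : 0 < b - a := sub_pos.2 hlt
  set m := (∫ x in a..b, g x) / (b - a) with hm
  have h0 : 0 ≤ ∫ x in a..b, (g x - m) ^ 2 :=
    intervalIntegral.integral_nonneg hab fun x _ => sq_nonneg _
  have h1 : ∫ x in a..b, (g x - m) ^ 2 =
      (∫ x in a..b, g x ^ 2) - 2 * m * (∫ x in a..b, g x) + (b - a) * m ^ 2 := by
    have : ∀ x, (g x - m) ^ 2 = g x ^ 2 - 2 * m * g x + m ^ 2 := fun x => by ring
    simp_rw [this]
    rw [intervalIntegral.integral_add (hg2.sub (hg.const_mul _)) (by simp),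
      intervalIntegral.integral_sub hg2 (hg.const_mul _), intervalIntegral.integral_const_mul,
      intervalIntegral.integral_const, smul_eq_mul]
  have h2 : (∫ x in a..b, g x) = m * (b - a) := by rw [hm]; field_simp
  rw [h1, h2] at h0
  rw [h2]
  nlinarith

theorem L2.inner_sub_inner (hab : a ≤ b) (u v h k : L2 a b) {f : ℝ → ℂ}
    (hf : ∀ᵐ x ∂(volume.restrict (Ioo a b)),
      v x * (starRingEnd ℂ) (h x) - k x * (starRingEnd ℂ) (u x) = f x) :
    inner ℂ h v - inner ℂ u k = ∫ x in a..b, f x := by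
  rw [MeasureTheory.L2.inner_def, MeasureTheory.L2.inner_def,
    ← integral_sub (L2.integrable_inner h v) (L2.integrable_inner u k),
    intervalIntegral.integral_of_le hab, integral_Ioc_eq_integral_Ioo]
  refine integral_congr_ae ?_
  filter_upwards [hf] with x hx
  simp only [RCLike.inner_apply]
  exact hx

theorem L2.inner_eq_integral (hab : a ≤ b) (h v : L2 a b) {f : ℝ → ℂ}
    (hf : ∀ᵐ x ∂(volume.restrict (Ioo a b)), v x * (starRingEnd ℂ) (h x) = f x) :
    inner ℂ h v = ∫ x in a..b, f x := by
  have := L2.inner_sub_inner hab 0 v h 0 (f := f) (by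
    filter_upwards [hf, Lp.coeFn_zero ℂ 2 (volume.restrict (Ioo a b))] with x hx h0
    rw [h0, hx]; simp)
  simpa using this

theorem L2.norm_sq_eq (hab : a ≤ b) (u : L2 a b) {f : ℝ → ℂ}
    (hf : ∀ᵐ x ∂(volume.restrict (Ioo a b)), u x = f x) :
    ‖u‖ ^ 2 = ∫ x in a..b, ‖f x‖ ^ 2 := by
  have h1 : inner ℂ u u = ∫ x in a..b, ((‖f x‖ ^ 2 : ℝ) : ℂ) := by
    refine L2.inner_eq_integral hab u u ?_
    filter_upwards [hf] with x hx
    rw [hx, Complex.mul_conj']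
    push_cast
    rfl
  rw [intervalIntegral.integral_ofReal] at h1
  rw [← inner_self_eq_norm_sq (𝕜 := ℂ), h1]
  exact Complex.ofReal_re _

theorem L2.integrable_norm_sq (u : L2 a b) (hab : a ≤ b) :
    IntervalIntegrable (fun x => ‖u x‖ ^ 2) volume a b := by
  rw [intervalIntegrable_iff_integrableOn_Ioo_of_le hab]
  exact (Lp.memLp u).integrable_norm_pow (by norm_num)

theorem L2.intervalIntegrable (u : L2 a b) (hab : a ≤ b) : IntervalIntegrable u volume a b := by
  rw [intervalIntegrable_iff_integrableOn_Ioo_of_le hab]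
  exact (Lp.memLp u).integrable (by norm_num)

theorem L2.integral_norm_le (hab : a ≤ b) (u : L2 a b) :
    ∫ x in a..b, ‖u x‖ ≤ √(b - a) * ‖u‖ := by
  have h1 := sq_integral_le hab (L2.intervalIntegrable u hab).norm (L2.integrable_norm_sq u hab)
  rw [← L2.norm_sq_eq hab u (f := u) (Eventually.of_forall fun _ => rfl)] at h1
  have h2 : (∫ x in a..b, ‖u x‖) ^ 2 ≤ (√(b - a) * ‖u‖) ^ 2 := by
    rwa [mul_pow, Real.sq_sqrt (sub_nonneg.2 hab)]
  exact le_of_sq_le_sq h2 (by positivity)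

theorem ae_restrict_Ioo_of_forall {p : ℝ → Prop} (h : ∀ x ∈ Ioo a b, p x) :
    ∀ᵐ x ∂(volume.restrict (Ioo a b)), p x :=
  (ae_restrict_iff' measurableSet_Ioo).2 (Eventually.of_forall h)

theorem memLp_of_continuousOn {E : Type*} [NormedAddCommGroup E] {f : ℝ → E}
    (hf : ContinuousOn f (Icc a b)) : MemLp f 2 (volume.restrict (Ioo a b)) := by
  obtain ⟨C, hC⟩ := isCompact_Icc.exists_bound_of_continuousOn hf
  refine MemLp.of_bound ((hf.mono Ioo_subset_Icc_self).aestronglyMeasurable measurableSet_Ioo) C ?_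
  exact ae_restrict_Ioo_of_forall fun x hx => hC x (Ioo_subset_Icc_self hx)

/-- The operator of multiplication by a continuous real function. -/
theorem exists_mulOp {q : ℝ → ℝ} (hq : ContinuousOn q (Icc a b)) :
    ∃ M : L2 a b →L[ℂ] L2 a b,
      (∀ f, ∀ᵐ x ∂(volume.restrict (Ioo a b)), M f x = q x * f x) ∧
      ∀ Q, (∀ x ∈ Icc a b, |q x| ≤ Q) → ∀ f, ‖M f‖ ≤ Q * ‖f‖ := by
  obtain ⟨C, hC⟩ := isCompact_Icc.exists_bound_of_continuousOn hq
  have hbd : ∀ {Q}, (∀ x ∈ Icc a b, |q x| ≤ Q) → ∀ f : L2 a b,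
      ∀ᵐ x ∂(volume.restrict (Ioo a b)), ‖(q x : ℂ) * f x‖ ≤ Q * ‖f x‖ := fun hQ f =>
    ae_restrict_Ioo_of_forall fun x hx => by
      rw [norm_mul, Complex.norm_real]
      gcongr
      exact hQ x (Ioo_subset_Icc_self hx)
  have hmem : ∀ f : L2 a b, MemLp (fun x => (q x : ℂ) * f x) 2 (volume.restrict (Ioo a b)) := by
    intro f
    refine (Lp.memLp f).of_le_mul (c := C) ?_ (hbd hC f)
    exact (Complex.continuous_ofReal.comp_continuousOn
      (hq.mono Ioo_subset_Icc_self)).aestronglyMeasurable measurableSet_Ioo |>.mul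
        (Lp.aestronglyMeasurable f)
  let M₀ : L2 a b →ₗ[ℂ] L2 a b :=
    { toFun := fun f => (hmem f).toLp
      map_add' := fun f g => by
        apply Lp.ext
        filter_upwards [(hmem (f + g)).coeFn_toLp, (hmem f).coeFn_toLp, (hmem g).coeFn_toLp,
          Lp.coeFn_add f g, Lp.coeFn_add (hmem f).toLp (hmem g).toLp] with x h1 h2 h3 h4 h5
        rw [h1, h5, Pi.add_apply, h2, h3, h4, Pi.add_apply, mul_add]
      map_smul' := fun r f => by
        apply Lp.ext
        filter_upwards [(hmem (r • f)).coeFn_toLp, (hmem f).coeFn_toLp,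
          Lp.coeFn_smul r f, Lp.coeFn_smul r (hmem f).toLp] with x h1 h2 h4 h5
        simp only [RingHom.id_apply]
        rw [h1, h5, Pi.smul_apply, h2, h4, Pi.smul_apply, smul_eq_mul, smul_eq_mul]
        ring }
  have hM : ∀ f, ∀ᵐ x ∂(volume.restrict (Ioo a b)), M₀ f x = q x * f x := fun f =>
    (hmem f).coeFn_toLp
  have hle : ∀ Q, (∀ x ∈ Icc a b, |q x| ≤ Q) → ∀ f, ‖M₀ f‖ ≤ Q * ‖f‖ := fun Q hQ f =>
    Lp.norm_le_mul_norm_of_ae_le_mul (by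
      filter_upwards [hM f, hbd hQ f] with x h1 h2
      rwa [h1])
  exact ⟨M₀.mkContinuous C (hle C hC), hM, hle⟩

end IntegralNorm

/-! ### Compactness -/

section Compactness

variable {a b : ℝ}

/-- Arzelà–Ascoli: the common Lipschitz constant gives equicontinuity. -/
theorem exists_subseq_tendstoUniformlyOn (hab : a ≤ b) {f : ℕ → ℝ → ℂ} {K : ℝ}
    (hb : ∀ n, ∀ x ∈ Icc a b, ‖f n x‖ ≤ K)
    (hl : ∀ n, ∀ x ∈ Icc a b, ∀ y ∈ Icc a b, ‖f n x - f n y‖ ≤ K * |x - y|) :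
    ∃ φ : ℕ → ℕ, StrictMono φ ∧ ∃ g : ℝ → ℂ, ContinuousOn g (Icc a b) ∧
      TendstoUniformlyOn (fun n => f (φ n)) g atTop (Icc a b) := by
  have hK : 0 ≤ K := (norm_nonneg _).trans (hb 0 a (left_mem_Icc.2 hab))
  have hlip : ∀ n, LipschitzWith K.toNNReal (fun x : Icc a b => f n x) := fun n =>
    LipschitzWith.of_dist_le_mul fun x y => by
      rw [dist_eq_norm, Real.coe_toNNReal _ hK, Subtype.dist_eq, Real.dist_eq]
      exact hl n x x.2 y y.2
  let F : ℕ → BoundedContinuousFunction (Icc a b) ℂ := fun n =>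
    BoundedContinuousFunction.mkOfCompact ⟨fun x : Icc a b => f n x, (hlip n).continuous⟩
  have hF : ∀ n x, F n x = f n x := fun _ _ => rfl
  have hcomp : IsCompact (closure (range F)) := by
    refine BoundedContinuousFunction.arzela_ascoli (Metric.closedBall 0 K)
      (isCompact_closedBall _ _) _ ?_ ?_
    · rintro _ x ⟨n, rfl⟩
      rw [mem_closedBall_zero_iff, hF]
      exact hb n x x.2
    · refine (LipschitzWith.uniformEquicontinuous _ K.toNNReal ?_).equicontinuous
      rintro ⟨_, n, rfl⟩
      exact hlip n
  obtain ⟨g, -, φ, hφ, hg⟩ := hcomp.tendsto_subseq fun n => subset_closure (mem_range_self n)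
  rw [BoundedContinuousFunction.tendsto_iff_tendstoUniformly] at hg
  refine ⟨φ, hφ, Set.IccExtend hab g, (g.continuous.Icc_extend').continuousOn, ?_⟩
  rw [Metric.tendstoUniformlyOn_iff]
  rw [Metric.tendstoUniformly_iff] at hg
  intro ε hε
  filter_upwards [hg ε hε] with n hn x hx
  have := hn ⟨x, hx⟩
  rwa [Set.IccExtend_of_mem hab g hx]

theorem L2.tendsto_of_tendstoUniformlyOn {u : ℕ → L2 a b} {f : ℕ → ℝ → ℂ} {g : ℝ → ℂ}
    (hu : ∀ n, ∀ᵐ x ∂(volume.restrict (Ioo a b)), u n x = f n x) (hg : ContinuousOn g (Icc a b))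
    (hfg : TendstoUniformlyOn f g atTop (Icc a b)) :
    ∃ v : L2 a b, (∀ᵐ x ∂(volume.restrict (Ioo a b)), v x = g x) ∧ Tendsto u atTop (𝓝 v) := by
  have hmem := memLp_of_continuousOn hg
  refine ⟨hmem.toLp, hmem.coeFn_toLp, ?_⟩
  rw [Metric.tendstoUniformlyOn_iff] at hfg
  rw [Metric.tendsto_atTop']
  intro ε hε
  -- The square root of the length: it bounds the L₂ norm by the supremum. Dividing by m + 1 instead
  -- of m avoids a case distinction when m = 0.
  set m : ℝ := (volume.restrict (Ioo a b)).real univ ^ (ENNReal.toReal 2)⁻¹ with hm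
  have hm0 : 0 ≤ m := by positivity
  obtain ⟨N, hN⟩ := eventually_atTop.1 (hfg (ε / (m + 1)) (by positivity))
  refine ⟨N, fun n hn => ?_⟩
  rw [dist_eq_norm]
  have h1 : ‖u n - hmem.toLp‖ ≤ m * (ε / (m + 1)) := by
    refine Lp.norm_le_of_ae_bound (by positivity) ?_
    filter_upwards [hu n, hmem.coeFn_toLp, Lp.coeFn_sub (u n) hmem.toLp,
      ae_restrict_mem measurableSet_Ioo] with x h1 h2 h3 hx
    rw [h3, Pi.sub_apply, h1, h2, ← dist_eq_norm, dist_comm]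
    exact (hN n hn.le x (Ioo_subset_Icc_self hx)).le
  refine h1.trans_lt ?_
  rw [mul_div_assoc', div_lt_iff₀ (by positivity)]
  nlinarith

/-- The zero at `a` and a bound on the slope control both the size and the Lipschitz constant. A
bound on higher derivatives would be too much to ask: near the origin the second derivative may grow
like 1/ε. -/
theorem exists_subseq_of_deriv_bound (hab : a ≤ b) {u : ℕ → L2 a b} {D : ℕ → ℕ → ℝ → ℂ}
    (hD : ∀ n, IsSobolevFour a b (D n))
      (hu : ∀ n, ∀ᵐ x ∂(volume.restrict (Ioo a b)), u n x = D n 0 x)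
    (h0 : ∀ n, D n 0 a = 0) {K : ℝ} (hK : ∀ n, ∀ x ∈ Icc a b, ‖D n 1 x‖ ≤ K) :
    ∃ φ : ℕ → ℕ, StrictMono φ ∧ ∃ v : L2 a b, ∃ g : ℝ → ℂ, ContinuousOn g (Icc a b) ∧
      (∀ᵐ x ∂(volume.restrict (Ioo a b)), v x = g x) ∧
      TendstoUniformlyOn (fun n => D (φ n) 0) g atTop (Icc a b) ∧
      Tendsto (fun n => u (φ n)) atTop (𝓝 v) := by
  have hK0 : 0 ≤ K := (norm_nonneg _).trans (hK 0 a (left_mem_Icc.2 hab))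
  have hl : ∀ n, ∀ x ∈ Icc a b, ∀ y ∈ Icc a b, ‖D n 0 x - D n 0 y‖ ≤ K * |x - y| := by
    intro n x hx y hy
    rw [← (hD n).integral_eq_sub (j := 0) (by norm_num) hy hx]
    refine intervalIntegral.norm_integral_le_of_norm_le_const fun t ht => hK n t ?_
    exact OrdConnected.uIcc_subset ordConnected_Icc hy hx (uIoc_subset_uIcc ht)
  have hb : ∀ n, ∀ x ∈ Icc a b, ‖D n 0 x‖ ≤ K * (b - a) := by
    intro n x hx
    have := hl n x hx a (left_mem_Icc.2 hab)
    rw [h0, sub_zero, abs_of_nonneg (sub_nonneg.2 hx.1)] at this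
    exact this.trans (by gcongr; exact hx.2)
  obtain ⟨φ, hφ, g, hg, hfg⟩ := exists_subseq_tendstoUniformlyOn (f := fun n => D n 0) hab
    (K := max K (K * (b - a)))
    (fun n x hx => (hb n x hx).trans (le_max_right _ _))
    (fun n x hx y hy => (hl n x hx y hy).trans (by gcongr; exact le_max_left _ _))
  obtain ⟨v, hv, hlim⟩ := L2.tendsto_of_tendstoUniformlyOn (u := fun n => u (φ n))
    (fun n => hu (φ n)) hg hfg
  exact ⟨φ, hφ, v, g, hg, hv, hfg, hlim⟩

theorem isCompactOperator_of_subseq {E F : Type*} [NormedAddCommGroup E] [NormedSpace ℂ E]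
    [NormedAddCommGroup F] [NormedSpace ℂ F] (G : E →L[ℂ] F)
    (hG : ∀ x : ℕ → E, (∀ n, ‖x n‖ ≤ 1) → ∃ φ : ℕ → ℕ, StrictMono φ ∧ ∃ y,
      Tendsto (fun n => G (x (φ n))) atTop (𝓝 y)) : IsCompactOperator G := by
  refine (isCompactOperator_iff_isCompact_closure_image_closedBall (G : E →ₗ[ℂ] F)
    one_pos).2 ?_
  rw [isCompact_iff_isSeqCompact]
  intro y hy
  have hx : ∀ n : ℕ, ∃ x : E, ‖x‖ ≤ 1 ∧ dist (y n) (G x) < 1 / ((n : ℝ) + 1) := by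
    intro n
    obtain ⟨_, ⟨x, hx, rfl⟩, hd⟩ := Metric.mem_closure_iff.1 (hy n) (1 / ((n : ℝ) + 1))
      (by positivity)
    exact ⟨x, by simpa using hx, hd⟩
  choose x hx1 hx2 using hx
  obtain ⟨φ, hφ, z, hz⟩ := hG x hx1
  refine ⟨z, ?_, φ, hφ, ?_⟩
  · exact mem_closure_of_tendsto hz (Eventually.of_forall fun n =>
      ⟨x (φ n), by simpa using hx1 (φ n), rfl⟩)
  · have h1 : Tendsto (fun n => dist (G (x (φ n))) (y (φ n))) atTop (𝓝 0) := by
      refine squeeze_zero (fun _ => dist_nonneg) (fun n => ?_)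
        (tendsto_one_div_add_atTop_nhds_zero_nat.comp hφ.tendsto_atTop)
      rw [dist_comm]
      exact (hx2 (φ n)).le
    exact (tendsto_iff_of_dist h1).1 hz

end Compactness

/-! ### Energy and the Poincaré inequality -/

section Energy

variable {c d : ℝ} {D : ℕ → ℝ → ℂ}

theorem IsSobolevFour.conj (h : IsSobolevFour c d D) :
    IsSobolevFour c d (fun j x => (starRingEnd ℂ) (D j x)) :=
  h.comp_clm Complex.conjCLE.toContinuousLinearMap

theorem IsSobolevFour.intervalIntegrable_norm_sq (h : IsSobolevFour c d D) {j : ℕ} (hj : j < 4)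
    (hcd : c ≤ d) : IntervalIntegrable (fun x => ‖D j x‖ ^ 2) volume c d :=
  ContinuousOn.intervalIntegrable (by rw [uIcc_of_le hcd]; exact (h.continuousOn hj).norm.pow 2)

theorem IsSobolevFour.norm_sq_le (h : IsSobolevFour c d D) {j : ℕ} (hj : j < 3) (hcd : c ≤ d)
    (h0 : D j c = 0) {x : ℝ} (hx : x ∈ Icc c d) :
    ‖D j x‖ ^ 2 ≤ (d - c) * ∫ t in c..d, ‖D (j + 1) t‖ ^ 2 := by
  have h1 : ‖D j x‖ ≤ ∫ t in c..d, ‖D (j + 1) t‖ := by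
    rw [h.primitive j (by omega) x hx, h0, zero_add]
    exact h.norm_integral_le (by omega) (left_mem_Icc.2 hcd) hx
  refine (pow_le_pow_left₀ (norm_nonneg _) h1 2).trans ?_
  exact sq_integral_le hcd (h.intervalIntegrable (by omega) (right_mem_Icc.2 hcd)).norm
    (h.intervalIntegrable_norm_sq (by omega) hcd)

theorem IsSobolevFour.integral_norm_sq_le (h : IsSobolevFour c d D) {j : ℕ} (hj : j < 3)
    (hcd : c ≤ d) (h0 : D j c = 0) :
    ∫ t in c..d, ‖D j t‖ ^ 2 ≤ (d - c) ^ 2 * ∫ t in c..d, ‖D (j + 1) t‖ ^ 2 := by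
  have := intervalIntegral.integral_mono_on hcd (h.intervalIntegrable_norm_sq (by omega) hcd)
    (intervalIntegrable_const (c := (d - c) * ∫ t in c..d, ‖D (j + 1) t‖ ^ 2))
    (fun x hx => h.norm_sq_le hj hcd h0 hx)
  rw [intervalIntegral.integral_const, smul_eq_mul] at this
  linarith

/-- Conditions at the left end alone suffice, which is why the inequality can later be summed over
the cells of a partition. -/
theorem IsSobolevFour.poincare (h : IsSobolevFour c d D) (hcd : c ≤ d) (h0 : D 0 c = 0)
    (h1 : D 1 c = 0) :
    ∫ t in c..d, ‖D 0 t‖ ^ 2 ≤ (d - c) ^ 4 * ∫ t in c..d, ‖D 2 t‖ ^ 2 := by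
  have h2 := h.integral_norm_sq_le (j := 0) (by norm_num) hcd h0
  have h3 := h.integral_norm_sq_le (j := 1) (by norm_num) hcd h1
  calc _ ≤ _ := h2
    _ ≤ (d - c) ^ 2 * ((d - c) ^ 2 * ∫ t in c..d, ‖D 2 t‖ ^ 2) := by gcongr
    _ = _ := by ring

end Energy

/-! ### The clamped operator -/

section Clamped

variable {a b : ℝ} {q : ℝ → ℝ}

theorem mem_clampedOp_graph {p : L2 a b × L2 a b} : p ∈ (clampedOp a b q).graph ↔
    ∃ D : ℕ → ℝ → ℂ, IsSobolevFour a b D ∧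
    (∀ᵐ x ∂(volume.restrict (Ioo a b)), p.1 x = D 0 x) ∧
    (∀ᵐ x ∂(volume.restrict (Ioo a b)), p.2 x = D 4 x + (q x : ℂ) * D 0 x) ∧
    D 0 a = 0 ∧ D 1 a = 0 ∧ D 0 b = 0 ∧ D 1 b = 0 := by
  rw [clampedOp_graph]
  rfl

theorem isSymmetricOp_clampedOp (hab : a ≤ b) : IsSymmetricOp (clampedOp a b q) := by
  intro p hp p' hp'
  obtain ⟨D, hD, h1, h2, e1, e2, e3, e4⟩ := mem_clampedOp_graph.1 hp
  obtain ⟨E, hE, h1', h2', e1', e2', e3', e4'⟩ := mem_clampedOp_graph.1 hp'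
  rw [← sub_eq_zero, L2.inner_sub_inner hab p.1 p'.1 p.2 p'.2
    (f := fun x => (starRingEnd ℂ) (D 4 x) * E 0 x - (starRingEnd ℂ) (D 0 x) * E 4 x)]
  · rw [intervalIntegral.integral_sub
      (hD.conj.mul_intervalIntegrable hE le_rfl (by norm_num) hab)
      (by simp_rw [mul_comm _ (E 4 _)]
          exact hE.mul_intervalIntegrable hD.conj le_rfl (by norm_num) hab), hD.conj.green hE hab]
    simp [e1, e2, e3, e4, e1', e2', e3', e4']
  · filter_upwards [h1, h2, h1', h2'] with x k1 k2 k3 k4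
    rw [k1, k2, k3, k4]
    simp only [map_add, map_mul, Complex.conj_ofReal]
    ring

/-- Two integrations by parts move two derivatives across; the clamped ends kill the boundary terms.
-/
theorem clampedOp_energy (hab : a ≤ b) (hq : ContinuousOn q (Icc a b)) {D : ℕ → ℝ → ℂ}
    (hD : IsSobolevFour a b D) {u h : L2 a b}
    (hu : ∀ᵐ x ∂(volume.restrict (Ioo a b)), u x = D 0 x)
    (hh : ∀ᵐ x ∂(volume.restrict (Ioo a b)), h x = D 4 x + (q x : ℂ) * D 0 x)
    (e1 : D 0 a = 0) (e2 : D 1 a = 0) (e3 : D 0 b = 0) (e4 : D 1 b = 0) :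
    (inner ℂ h u).re = (∫ x in a..b, ‖D 2 x‖ ^ 2) + ∫ x in a..b, q x * ‖D 0 x‖ ^ 2 := by
  have hqi : IntervalIntegrable (fun x => ((q x * ‖D 0 x‖ ^ 2 : ℝ) : ℂ)) volume a b := by
    refine ContinuousOn.intervalIntegrable ?_
    rw [uIcc_of_le hab]
    exact Complex.continuous_ofReal.comp_continuousOn
      (hq.mul ((hD.continuousOn (by norm_num)).norm.pow 2))
  have h1 : inner ℂ h u = ∫ x in a..b, ((starRingEnd ℂ) (D 4 x) * D 0 x +
      ((q x * ‖D 0 x‖ ^ 2 : ℝ) : ℂ)) := by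
    refine L2.inner_eq_integral hab h u ?_
    filter_upwards [hu, hh] with x k1 k2
    rw [k1, k2]
    push_cast
    rw [← Complex.mul_conj']
    simp only [map_add, map_mul, Complex.conj_ofReal]
    ring
  rw [intervalIntegral.integral_add (hD.conj.mul_intervalIntegrable hD le_rfl (by norm_num) hab)
    hqi, hD.conj.integral_four_mul hD hab, e1, e2, e3, e4, intervalIntegral.integral_ofReal] at h1
  have h2 : ∫ x in a..b, (starRingEnd ℂ) (D 2 x) * D 2 x =
      ((∫ x in a..b, ‖D 2 x‖ ^ 2 : ℝ) : ℂ) := by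
    rw [← intervalIntegral.integral_ofReal]
    congr 1
    ext x
    rw [Complex.conj_mul']
    push_cast
    rfl
  rw [h1, h2]
  simp

/-- Adding a bounded potential to the clamped operator. -/
theorem clampedOp_graph_add {q q' r : ℝ → ℝ} (hqr : ∀ x ∈ Ioo a b, q' x = q x + r x)
    {u h k : L2 a b} (hk : ∀ᵐ x ∂(volume.restrict (Ioo a b)), k x = r x * u x)
    (hg : (u, h) ∈ (clampedOp a b q).graph) : (u, h + k) ∈ (clampedOp a b q').graph := by
  obtain ⟨D, hD, h1, h2, h3⟩ := mem_clampedOp_graph.1 hg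
  refine mem_clampedOp_graph.2 ⟨D, hD, h1, ?_, h3⟩
  filter_upwards [h1, h2, hk, Lp.coeFn_add h k, ae_restrict_mem measurableSet_Ioo]
    with x k1 k2 k3 k4 hx
  simp only [k4, Pi.add_apply, k1, k2, k3, hqr x hx]
  push_cast
  ring

/-- The monomial `(x - c)ⁿ` with its derivatives. -/
noncomputable def monomialFamily (c : ℝ) (n j : ℕ) (x : ℝ) : ℂ :=
  (n.descFactorial j : ℂ) * ((x - c : ℝ) : ℂ) ^ (n - j)

theorem isSobolevFour_monomialFamily (c : ℝ) (n : ℕ) (a b : ℝ) :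
    IsSobolevFour a b (monomialFamily c n) := by
  refine isSobolevFour_of_hasDerivAt (fun j _ x => ?_) ?_
  · have h1 : HasDerivAt (fun x : ℝ => ((x - c : ℝ) : ℂ)) 1 x := by
      simpa using ((hasDerivAt_id x).sub_const c).ofReal_comp
    have h2 := (h1.pow (n - j)).const_mul (n.descFactorial j : ℂ)
    refine HasDerivAt.congr_deriv (f := monomialFamily c n j) h2 ?_
    rw [monomialFamily, Nat.descFactorial_succ, Nat.cast_mul, Nat.sub_sub]
    ring
  · unfold monomialFamily
    fun_prop

theorem exists_clamped_solution (hab : a < b) (h : L2 a b) :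
    ∃ u, (u, h) ∈ (clampedOp a b fun _ => 0).graph := by
  have hP := isSobolevFour_primitiveFour (fun _ => (0 : ℂ)) (left_mem_Icc.2 hab.le) (Lp.memLp h)
  set P := primitiveFour a h (fun _ => (0 : ℂ)) with hPdef
  have hL : ((b : ℂ) - a) ≠ 0 := by
    rw [sub_ne_zero]; exact_mod_cast hab.ne'
  -- The polynomial s(x - a)² + t(x - a)³ keeps the zero data at `a`; `s` and `t` solve the 2 × 2
  -- system that makes the sum with `P` vanish to first order at `b`.
  set t : ℂ := (2 * P 0 b / (b - a) - P 1 b) / (b - a) ^ 2 with ht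
  set s : ℂ := -(P 0 b + t * (b - a) ^ 3) / (b - a) ^ 2 with hs
  set D := P + s • monomialFamily a 2 + t • monomialFamily a 3 with hDdef
  have hD : IsSobolevFour a b D := (hP.add ((isSobolevFour_monomialFamily a 2 a b).smul s)).add
    ((isSobolevFour_monomialFamily a 3 a b).smul t)
  have hu := memLp_of_continuousOn (hD.continuousOn (j := 0) (by norm_num))
  have hP0 : P 0 a = 0 := primitiveFour_base _ _ _ (by norm_num)
  have hP1 : P 1 a = 0 := primitiveFour_base _ _ _ (by norm_num)
  refine ⟨hu.toLp, mem_clampedOp_graph.2 ⟨D, hD, hu.coeFn_toLp, ?_, ?_, ?_, ?_, ?_⟩⟩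
  · refine Eventually.of_forall fun x => ?_
    have : P 4 = h := primitiveFour_four _ _ _
    simp [hDdef, this, monomialFamily]
  · simp [hDdef, hP0, monomialFamily]
  · simp [hDdef, hP1, monomialFamily]
  · simp only [hDdef, Pi.add_apply, Pi.smul_apply, smul_eq_mul, monomialFamily,
      Nat.descFactorial_zero, Complex.ofReal_sub, hs]
    field_simp
    norm_num
    ring
  · simp only [hDdef, Pi.add_apply, Pi.smul_apply, smul_eq_mul, monomialFamily,
      Nat.descFactorial_one, Complex.ofReal_sub, hs, ht]
    field_simp
    norm_num
    field_simp
    ring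

/-- The energy identity gives ∫|u''|² ≤ ‖h‖‖u‖, and Poincaré's inequality cancels one factor ‖u‖.
The slope bound supplies the equicontinuity behind the compactness of the inverse. -/
theorem clampedOp_zero_bounds (hab : a ≤ b) {D : ℕ → ℝ → ℂ} (hD : IsSobolevFour a b D)
    {u h : L2 a b} (hu : ∀ᵐ x ∂(volume.restrict (Ioo a b)), u x = D 0 x)
    (hh : ∀ᵐ x ∂(volume.restrict (Ioo a b)), h x = D 4 x)
    (e1 : D 0 a = 0) (e2 : D 1 a = 0) (e3 : D 0 b = 0) (e4 : D 1 b = 0) :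
    ‖u‖ ≤ (b - a) ^ 4 * ‖h‖ ∧ ∀ x ∈ Icc a b, ‖D 1 x‖ ^ 2 ≤ (b - a) ^ 5 * ‖h‖ ^ 2 := by
  have h1 := clampedOp_energy (q := fun _ => 0) hab continuousOn_const hD hu
    (by filter_upwards [hh] with x hx; simpa using hx) e1 e2 e3 e4
  simp only [zero_mul, intervalIntegral.integral_zero, add_zero] at h1
  have h2 : (∫ x in a..b, ‖D 2 x‖ ^ 2) ≤ ‖h‖ * ‖u‖ := by
    rw [← h1]
    exact (Complex.re_le_norm _).trans (norm_inner_le_norm _ _)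
  have hL : 0 ≤ b - a := sub_nonneg.2 hab
  have h3 : ‖u‖ ≤ (b - a) ^ 4 * ‖h‖ := by
    have h4 := hD.poincare hab e1 e2
    rw [← L2.norm_sq_eq hab u hu] at h4
    rcases (norm_nonneg u).eq_or_lt with h0 | h0
    · rw [← h0]; positivity
    · have : ‖u‖ * ‖u‖ ≤ ((b - a) ^ 4 * ‖h‖) * ‖u‖ := by
        calc ‖u‖ * ‖u‖ = ‖u‖ ^ 2 := by ring
          _ ≤ _ := h4
          _ ≤ (b - a) ^ 4 * (‖h‖ * ‖u‖) := by gcongr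
          _ = _ := by ring
      exact le_of_mul_le_mul_right this h0
  refine ⟨h3, fun x hx => ?_⟩
  refine (hD.norm_sq_le (j := 1) (by norm_num) hab e2 hx).trans ?_
  calc _ ≤ (b - a) * (‖h‖ * ((b - a) ^ 4 * ‖h‖)) := by
        gcongr; exact h2.trans (by gcongr)
    _ = _ := by ring

/-- The inverse of `d⁴/dx⁴` with clamped ends is compact. -/
theorem exists_clamped_inverse (hab : a < b) :
    ∃ G : L2 a b →L[ℂ] L2 a b, IsCompactOperator G ∧
      ∀ h, (G h, h) ∈ (clampedOp a b fun _ => 0).graph := by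
  set T := clampedOp a b fun _ => 0
  have key : ∀ p ∈ T.graph, ‖p.1‖ ≤ (b - a) ^ 4 * ‖p.2‖ := by
    intro p hp
    obtain ⟨D, hD, h1, h2, e1, e2, e3, e4⟩ := mem_clampedOp_graph.1 hp
    exact (clampedOp_zero_bounds hab.le hD h1 (by filter_upwards [h2] with x hx; simpa using hx)
      e1 e2 e3 e4).1
  choose G hG using exists_clamped_solution hab
  have huniq : ∀ {u v h : L2 a b}, (u, h) ∈ T.graph → (v, h) ∈ T.graph → u = v := by
    intro u v h hu hv
    have := key _ (T.graph.sub_mem hu hv)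
    simp only [Prod.mk_sub_mk, sub_self, norm_zero, mul_zero] at this
    exact sub_eq_zero.1 (norm_le_zero_iff.1 this)
  have hadd : ∀ f g, G (f + g) = G f + G g := fun f g => by
    have h1 : (G f + G g, f + g) ∈ T.graph := T.graph.add_mem (hG f) (hG g)
    exact huniq (hG _) h1
  have hsmul : ∀ (r : ℂ) f, G (r • f) = r • G f := fun r f => by
    have h1 : (r • G f, r • f) ∈ T.graph := T.graph.smul_mem r (hG f)
    exact huniq (hG _) h1
  let G₀ : L2 a b →ₗ[ℂ] L2 a b :=
    { toFun := G
      map_add' := hadd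
      map_smul' := hsmul }
  have hbd : ∀ h, ‖G₀ h‖ ≤ (b - a) ^ 4 * ‖h‖ := fun h => key (G h, h) (hG h)
  refine ⟨G₀.mkContinuous ((b - a) ^ 4) hbd, ?_, hG⟩
  refine isCompactOperator_of_subseq _ fun h hh => ?_
  have hD := fun n => mem_clampedOp_graph.1 (hG (h n))
  choose D hD h1 h2 e1 e2 e3 e4 using hD
  obtain ⟨φ, hφ, v, -, -, -, -, hv⟩ := exists_subseq_of_deriv_bound hab.le hD h1 e1
    (K := √((b - a) ^ 5)) (fun n x hx => by
      have h3 := (clampedOp_zero_bounds hab.le (hD n) (h1 n)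
        (by filter_upwards [h2 n] with x hx; simpa using hx) (e1 n) (e2 n) (e3 n) (e4 n)).2 x hx
      refine Real.le_sqrt_of_sq_le (h3.trans ?_)
      have hL : 0 ≤ (b - a) ^ 5 := by have := sub_nonneg.2 hab.le; positivity
      have : ‖h n‖ ^ 2 ≤ 1 := pow_le_one₀ (norm_nonneg _) (hh n)
      nlinarith)
  exact ⟨φ, hφ, v, hv⟩

/-- With G the inverse of d⁴/dx⁴, the equation u⁗ + qu = h + zu follows from u + Ku = Gh, where K =
G(q - z) is compact. The Fredholm alternative applies: an eigenvector of K for -1 would be an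
eigenfunction of the operator for z. -/
theorem hasCompactResolvent_clampedOp (hab : a < b) (hq : ContinuousOn q (Icc a b)) :
    HasCompactResolvent (clampedOp a b q) := by
  intro z hz
  obtain ⟨G, hGc, hG⟩ := exists_clamped_inverse hab
  obtain ⟨M, hM, -⟩ := exists_mulOp hq
  let K : L2 a b →L[ℂ] L2 a b := G ∘L (M - (z : ℂ) • ContinuousLinearMap.id ℂ _)
  have hK : IsCompactOperator K := hGc.comp_clm _
  have hsolve : ∀ u h : L2 a b, u + K u = G h → (u, h + (z : ℂ) • u) ∈ (clampedOp a b q).graph := by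
    intro u h huh
    have h1 : u = G (h - (M u - (z : ℂ) • u)) := by
      have h2 : K u = G (M u - (z : ℂ) • u) := rfl
      rw [map_sub, ← huh, ← h2, add_sub_cancel_right]
    have h2 := hG (h - (M u - (z : ℂ) • u))
    rw [← h1] at h2
    have h3 := clampedOp_graph_add (q' := q) (r := q) (k := M u) (fun x _ => by ring) (hM u) h2
    convert h3 using 2
    abel
  rcases hK.hasEigenvalue_or_mem_resolventSet (μ := -1) (by norm_num) with h | h
  · exfalso
    obtain ⟨v, hv, hv0⟩ := h.exists_hasEigenvector
    have hv' : K v = (-1 : ℂ) • v := Module.End.mem_eigenspace_iff.1 hv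
    have := hsolve v 0 (by rw [hv', map_zero]; simp)
    rw [zero_add, ← mem_eigenspace_iff, hz] at this
    exact hv0 ((Submodule.mem_bot ℂ).1 this)
  -- The unit `S` is -1 - K, so u = -S⁻¹ G h solves u + Ku = Gh.
  · obtain ⟨S, hS⟩ := h
    have hS1 : ∀ x, (S : L2 a b →L[ℂ] L2 a b) x = -(x + K x) := fun x => by
      rw [hS]
      simp [Algebra.algebraMap_eq_smul_one]
      abel
    have hS2 : ∀ x, (S : L2 a b →L[ℂ] L2 a b) ((↑S⁻¹ : L2 a b →L[ℂ] L2 a b) x) = x := fun x => by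
      rw [← mul_apply_eq_comp, Units.mul_inv, one_apply_eq_self]
    refine ⟨-((↑S⁻¹ : L2 a b →L[ℂ] L2 a b) ∘L G), (hGc.clm_comp _).neg, fun h => hsolve _ _ ?_⟩
    have := hS2 (G h)
    rw [hS1] at this
    simp only [neg_apply, ContinuousLinearMap.comp_apply, map_neg]
    rw [← neg_add, this]

end Clamped

/-! ### A priori estimates near a resonance -/

section APriori

theorem integral_norm_le_of_forall {E : Type*} [NormedAddCommGroup E] {f : ℝ → E} {c d K : ℝ}
    (hcd : c ≤ d) (h : ∀ x ∈ Icc c d, ‖f x‖ ≤ K) : ∫ x in c..d, ‖f x‖ ≤ K * (d - c) := by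
  have h1 := intervalIntegral.norm_integral_le_of_norm_le_const (f := fun x => ‖f x‖) (a := c)
    (b := d) (C := K) fun x hx => by
      rw [norm_norm]
      rw [uIoc_of_le hcd] at hx
      exact h x (Ioc_subset_Icc_self hx)
  rw [abs_of_nonneg (sub_nonneg.2 hcd)] at h1
  exact (le_abs_self _).trans h1

/-- Convergence of the data at one point and of the fourth derivatives in `L₁` implies uniform
convergence of the lower derivatives. -/
theorem exists_uniform_bound_of_tendsto {c d p : ℝ} {c' : ℕ → ℝ} {D : ℕ → ℕ → ℝ → ℂ}
    {E : ℕ → ℝ → ℂ} (hc' : ∀ n, c ≤ c' n) (hp : ∀ n, p ∈ Icc (c' n) d)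
    (hD : ∀ n, IsSobolevFour (c' n) d (D n)) (hE : IsSobolevFour c d E)
    (h : ∀ j < 4, Tendsto (fun n => D n j p) atTop (𝓝 (E j p)))
    (h4 : Tendsto (fun n => ∫ x in (c' n)..d, ‖D n 4 x - E 4 x‖) atTop (𝓝 0)) :
    ∃ δ : ℕ → ℝ, Tendsto δ atTop (𝓝 0) ∧
      ∀ n, ∀ j < 4, ∀ x ∈ Icc (c' n) d, ‖D n j x - E j x‖ ≤ δ n := by
  let η : ℕ → ℝ := fun n => ∑ j ∈ Finset.range 4, ‖D n j p - E j p‖ +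
    ∫ x in (c' n)..d, ‖D n 4 x - E 4 x‖
  have hη : Tendsto η atTop (𝓝 0) := by
    have h1 : Tendsto (fun n => ∑ j ∈ Finset.range 4, ‖D n j p - E j p‖) atTop
        (𝓝 (∑ j ∈ Finset.range 4, (0 : ℝ))) := tendsto_finsetSum _ fun j hj =>
      tendsto_iff_norm_sub_tendsto_zero.1 (h j (Finset.mem_range.1 hj))
    simpa using h1.add h4
  refine ⟨fun n => 2 * (1 + (d - c)) ^ 3 * η n, by simpa using hη.const_mul _,
    fun n j hj x hx => ?_⟩
  have hcd : c' n ≤ d := hx.1.trans hx.2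
  have hint : 0 ≤ ∫ x in (c' n)..d, ‖D n 4 x - E 4 x‖ :=
    intervalIntegral.integral_nonneg hcd fun _ _ => norm_nonneg _
  have hsum : 0 ≤ ∑ j ∈ Finset.range 4, ‖D n j p - E j p‖ :=
    Finset.sum_nonneg fun _ _ => norm_nonneg _
  have hDE := (hD n).sub (hE.mono (hc' n) le_rfl)
  have := hDE.norm_le (hp n) (A := η n) (fun i hi => by
      refine (Finset.single_le_sum (f := fun j => ‖D n j p - E j p‖)
        (fun _ _ => norm_nonneg _) (Finset.mem_range.2 hi)).trans ?_
      exact le_add_of_nonneg_right hint)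
    (le_add_of_nonneg_left hsum) hj hx
  simp only [Pi.sub_apply] at this
  refine this.trans ?_
  have hη0 : 0 ≤ η n := add_nonneg hsum hint
  change _ ≤ 2 * (1 + (d - c)) ^ 3 * η n
  gcongr
  exact hc' n

theorem resonant_intervalIntegrable {Ψ : ℝ → ℝ} (hΨ : ContinuousOn Ψ (Icc (-1) 1))
    {V : ℕ → ℝ → ℂ} (hV : IsSobolevFour (-1) 1 V) :
    IntervalIntegrable (fun ξ => V 4 ξ + (Ψ ξ : ℂ) * V 0 ξ) volume (-1) 1 := by
  refine (hV.intervalIntegrable le_rfl (by norm_num)).add (ContinuousOn.intervalIntegrable ?_)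
  rw [uIcc_of_le (by norm_num)]
  exact (Complex.continuous_ofReal.comp_continuousOn hΨ).mul (hV.continuousOn (by norm_num))

/-- The right-hand side and the boundary data of the resonance problem are bounded by `A`. -/
structure ResonantDataLE (Ψ : ℝ → ℝ) (α σ : ℝ) (V : ℕ → ℝ → ℂ) (A : ℝ) : Prop where
  sobolev : IsSobolevFour (-1) 1 V
  rhs : ∫ ξ in (-1 : ℝ)..1, ‖V 4 ξ + ((α * Ψ ξ : ℝ) : ℂ) * V 0 ξ‖ ≤ A
  two_left : ‖V 2 (-1)‖ ≤ A
  three_left : ‖V 3 (-1)‖ ≤ A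
  two_right : ‖V 2 1‖ ≤ A
  three_right : ‖V 3 1‖ ≤ A
  slope : ‖(σ : ℂ) * V 1 (-1)‖ ≤ A

theorem ResonantDataLE.smul {Ψ : ℝ → ℝ} {α σ : ℝ} {V : ℕ → ℝ → ℂ} {A : ℝ}
    (h : ResonantDataLE Ψ α σ V A) {r : ℝ} (hr : 0 ≤ r) :
    ResonantDataLE Ψ α σ ((r : ℂ) • V) (r * A) := by
  have key : ∀ z : ℂ, ‖z‖ ≤ A → ‖(r : ℂ) * z‖ ≤ r * A := fun z hz => by
    rw [norm_mul, Complex.norm_real, Real.norm_of_nonneg hr]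
    gcongr
  refine ⟨h.sobolev.smul _, ?_, key _ h.two_left, key _ h.three_left, key _ h.two_right,
    key _ h.three_right, ?_⟩
  · have : ∀ ξ, ‖((r : ℂ) • V) 4 ξ + ((α * Ψ ξ : ℝ) : ℂ) * ((r : ℂ) • V) 0 ξ‖ =
        r * ‖V 4 ξ + ((α * Ψ ξ : ℝ) : ℂ) * V 0 ξ‖ := fun ξ => by
      simp only [Pi.smul_apply, smul_eq_mul]
      rw [show (r : ℂ) * V 4 ξ + ((α * Ψ ξ : ℝ) : ℂ) * ((r : ℂ) * V 0 ξ) =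
        (r : ℂ) * (V 4 ξ + ((α * Ψ ξ : ℝ) : ℂ) * V 0 ξ) by ring, norm_mul, Complex.norm_real,
        Real.norm_of_nonneg hr]
    simp_rw [this]
    rw [intervalIntegral.integral_const_mul]
    gcongr
    exact h.rhs
  · have := key _ h.slope
    simp only [Pi.smul_apply, smul_eq_mul]
    rwa [mul_left_comm]

/-- The uniqueness hypothesis concerns real functions; the coefficients are real, so it applies to
real and imaginary parts separately. -/
theorem ResonantDataLE.eq_zero {Ψ : ℝ → ℝ} {α σ : ℝ}
    (hinj : ∀ W : ℕ → ℝ → ℝ, IsResonantSolution Ψ α W → σ * W 1 (-1) = 0 →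
      ∀ ξ ∈ Icc (-1 : ℝ) 1, W 0 ξ = 0) {V : ℕ → ℝ → ℂ} (hV : IsSobolevFour (-1) 1 V)
    (h4 : ∀ ξ ∈ Icc (-1 : ℝ) 1, V 4 ξ + ((α * Ψ ξ : ℝ) : ℂ) * V 0 ξ = 0)
    (h2l : V 2 (-1) = 0) (h3l : V 3 (-1) = 0) (h2r : V 2 1 = 0) (h3r : V 3 1 = 0)
    (hσ : (σ : ℂ) * V 1 (-1) = 0) : ∀ ξ ∈ Icc (-1 : ℝ) 1, V 0 ξ = 0 := by
  have key : ∀ l : ℂ →L[ℝ] ℝ, ∀ ξ ∈ Icc (-1 : ℝ) 1, l (V 0 ξ) = 0 := by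
    intro l
    have hl : ∀ (r : ℝ) (z : ℂ), l ((r : ℂ) * z) = r * l z := fun r z => by
      rw [← Complex.real_smul, map_smul, smul_eq_mul]
    refine hinj (fun j ξ => l (V j ξ))
      ⟨hV.comp_clm l, ?_, by simp [h2l, h3l], by simp [h2r, h3r]⟩ ?_
    · refine ae_restrict_Ioo_of_forall fun ξ hξ => ?_
      rw [← hl, ← map_add, h4 ξ (Ioo_subset_Icc_self hξ), map_zero]
    · rw [← hl, hσ, map_zero]
  intro ξ hξ
  exact Complex.ext (key Complex.reCLM ξ hξ) (key Complex.imCLM ξ hξ)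

/-- The equation bounds the fourth derivative in L₁ by the data and by `V 0`; integration from -1
bounds the rest. On an interval of length 2 the constant 2(1 + (d - c))³ equals 54. -/
theorem ResonantDataLE.norm_le {Ψ : ℝ → ℝ} (hΨ : Continuous Ψ) {α P : ℝ}
    (hP : ∀ ξ ∈ Icc (-1 : ℝ) 1, |α * Ψ ξ| ≤ P) {σ : ℝ} {V : ℕ → ℝ → ℂ} {A B : ℝ}
    (h : ResonantDataLE Ψ α σ V A) (hB : ∀ j < 4, ‖V j (-1)‖ ≤ B)
    (hB0 : ∫ ξ in (-1 : ℝ)..1, ‖V 0 ξ‖ ≤ B) {j : ℕ} (hj : j < 4) {ξ : ℝ}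
    (hξ : ξ ∈ Icc (-1 : ℝ) 1) : ‖V j ξ‖ ≤ 54 * (A + (1 + P) * B) := by
  have hA : 0 ≤ A := (norm_nonneg _).trans h.two_left
  have hB' : 0 ≤ B := (norm_nonneg _).trans (hB 0 (by norm_num))
  have hP0 : 0 ≤ P := (abs_nonneg _).trans (hP 0 (by norm_num))
  have hi1 := (resonant_intervalIntegrable (Ψ := fun ξ => α * Ψ ξ) (by fun_prop) h.sobolev).norm
  have hi2 : IntervalIntegrable (fun ξ => P * ‖V 0 ξ‖) volume (-1) 1 :=
    (h.sobolev.intervalIntegrable (by norm_num) (by norm_num)).norm.const_mul P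
  have h4 : ∫ ξ in (-1 : ℝ)..1, ‖V 4 ξ‖ ≤ A + P * B := by
    calc ∫ ξ in (-1 : ℝ)..1, ‖V 4 ξ‖ ≤
        ∫ ξ in (-1 : ℝ)..1, (‖V 4 ξ + ((α * Ψ ξ : ℝ) : ℂ) * V 0 ξ‖ + P * ‖V 0 ξ‖) := by
          refine intervalIntegral.integral_mono_on (by norm_num)
            (h.sobolev.intervalIntegrable le_rfl (by norm_num)).norm (hi1.add hi2) fun ξ hξ => ?_
          have h1 : V 4 ξ = (V 4 ξ + ((α * Ψ ξ : ℝ) : ℂ) * V 0 ξ) -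
            ((α * Ψ ξ : ℝ) : ℂ) * V 0 ξ := by ring
          calc ‖V 4 ξ‖ ≤ ‖V 4 ξ + ((α * Ψ ξ : ℝ) : ℂ) * V 0 ξ‖ +
              ‖((α * Ψ ξ : ℝ) : ℂ) * V 0 ξ‖ := by
                conv_lhs => rw [h1]
                exact norm_sub_le _ _
            _ ≤ _ := by
                rw [norm_mul ((α * Ψ ξ : ℝ) : ℂ), Complex.norm_real]
                gcongr
                exact hP ξ hξ
      _ = (∫ ξ in (-1 : ℝ)..1, ‖V 4 ξ + ((α * Ψ ξ : ℝ) : ℂ) * V 0 ξ‖) +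
          P * ∫ ξ in (-1 : ℝ)..1, ‖V 0 ξ‖ := by
          rw [intervalIntegral.integral_add hi1 hi2, intervalIntegral.integral_const_mul]
      _ ≤ _ := by
          gcongr
          exact h.rhs
  have := h.sobolev.norm_le (p := -1) (by norm_num) (A := A + (1 + P) * B)
    (fun j hj => (hB j hj).trans (by nlinarith)) (h4.trans (by nlinarith)) hj hξ
  norm_num at this
  exact this

/-- Uniqueness implies stability by compactness. Otherwise there are functions normalised by N V = 1
whose data tend to zero; a subsequence converges to a solution of the homogeneous problem with σ
w'(-1) = 0, which must vanish, although N passes to the limit. -/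
theorem exists_apriori_bound {Ψ : ℝ → ℝ} (hΨ : Continuous Ψ) {α σ : ℝ}
    (hinj : ∀ W : ℕ → ℝ → ℝ, IsResonantSolution Ψ α W → σ * W 1 (-1) = 0 →
      ∀ ξ ∈ Icc (-1 : ℝ) 1, W 0 ξ = 0) :
    ∃ C : ℝ, 0 ≤ C ∧ ∀ V A, ResonantDataLE Ψ α σ V A →
      ∀ j < 4, ∀ ξ ∈ Icc (-1 : ℝ) 1, ‖V j ξ‖ ≤ C * A := by
  obtain ⟨P, hP⟩ := isCompact_Icc.exists_bound_of_continuousOn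
    (s := Icc (-1 : ℝ) 1) (f := fun ξ => α * Ψ ξ) (by fun_prop)
  simp only [Real.norm_eq_abs] at hP
  have hP0 : 0 ≤ P := (abs_nonneg _).trans (hP 0 (by norm_num))
  -- A quantity that controls all derivatives through the previous estimate and is continuous under
  -- the convergence available below.
  let N : (ℕ → ℝ → ℂ) → ℝ := fun V =>
    ∑ j ∈ Finset.range 4, ‖V j (-1)‖ + ∫ ξ in (-1 : ℝ)..1, ‖V 0 ξ‖
  have hNi : ∀ V : ℕ → ℝ → ℂ, 0 ≤ ∫ ξ in (-1 : ℝ)..1, ‖V 0 ξ‖ := fun V =>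
    intervalIntegral.integral_nonneg (by norm_num) fun _ _ => norm_nonneg _
  have hNs : ∀ V : ℕ → ℝ → ℂ, 0 ≤ ∑ j ∈ Finset.range 4, ‖V j (-1)‖ := fun V =>
    Finset.sum_nonneg fun _ _ => norm_nonneg _
  have hN1 : ∀ V : ℕ → ℝ → ℂ, ∀ j < 4, ‖V j (-1)‖ ≤ N V := fun V j hj =>
    (Finset.single_le_sum (f := fun j => ‖V j (-1)‖) (fun _ _ => norm_nonneg _)
      (Finset.mem_range.2 hj)).trans (le_add_of_nonneg_right (hNi V))
  have hN2 : ∀ V : ℕ → ℝ → ℂ, ∫ ξ in (-1 : ℝ)..1, ‖V 0 ξ‖ ≤ N V := fun V =>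
    le_add_of_nonneg_left (hNs V)
  have hNsmul : ∀ (V : ℕ → ℝ → ℂ) (r : ℝ), 0 ≤ r → N ((r : ℂ) • V) = r * N V := by
    intro V r hr
    simp only [N, Pi.smul_apply, smul_eq_mul, norm_mul, Complex.norm_real,
      Real.norm_of_nonneg hr, intervalIntegral.integral_const_mul, mul_add, Finset.mul_sum]
  suffices hmain : ∃ C₀ : ℝ, 0 ≤ C₀ ∧ ∀ V A, ResonantDataLE Ψ α σ V A → N V ≤ C₀ * A by
    obtain ⟨C₀, hC₀, h⟩ := hmain
    refine ⟨54 * (1 + (1 + P) * C₀), by positivity, fun V A hV j hj ξ hξ => ?_⟩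
    have hNV := h V A hV
    have := hV.norm_le hΨ hP (B := C₀ * A) (fun j hj => (hN1 V j hj).trans hNV)
      ((hN2 V).trans hNV) hj hξ
    linarith
  by_contra! hcon
  -- Violating the bound with constant n + 1 and dividing by N V leaves data below 1/(n + 1).
  have hseq : ∀ n : ℕ, ∃ V, ResonantDataLE Ψ α σ V (1 / ((n : ℝ) + 1)) ∧ N V = 1 := by
    intro n
    obtain ⟨V, A, hV, hlt⟩ := hcon ((n : ℝ) + 1) (by positivity)
    have hA : 0 ≤ A := (norm_nonneg _).trans hV.two_left
    have hpos : 0 < N V := lt_of_le_of_lt (by positivity) hlt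
    refine ⟨(((N V)⁻¹ : ℝ) : ℂ) • V, ?_, ?_⟩
    · have h1 := hV.smul (r := (N V)⁻¹) (by positivity)
      have h2 : (N V)⁻¹ * A ≤ 1 / ((n : ℝ) + 1) := by
        rw [inv_mul_le_iff₀ hpos, mul_one_div, le_div_iff₀ (by positivity)]
        linarith
      exact ⟨h1.1, h1.2.trans h2, h1.3.trans h2, h1.4.trans h2, h1.5.trans h2, h1.6.trans h2,
        h1.7.trans h2⟩
    · rw [hNsmul _ _ (by positivity), inv_mul_cancel₀ hpos.ne']
  choose V hV hVN using hseq
  set K := 54 * (1 + (1 + P) * 1) with hK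
  have hVK : ∀ n, ∀ j < 4, ∀ ξ ∈ Icc (-1 : ℝ) 1, ‖V n j ξ‖ ≤ K := by
    intro n j hj ξ hξ
    refine ((hV n).norm_le hΨ hP (B := 1) (fun j hj => (hN1 _ j hj).trans (hVN n).le)
      ((hN2 _).trans (hVN n).le) hj hξ).trans ?_
    rw [hK]
    have : 1 / ((n : ℝ) + 1) ≤ 1 := by
      rw [div_le_one (by positivity)]; linarith [(Nat.cast_nonneg n : (0 : ℝ) ≤ n)]
    gcongr
  obtain ⟨φ, hφ, g, hg, hφg⟩ := exists_subseq_tendstoUniformlyOn (a := -1) (b := 1)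
    (f := fun n => V n 0) (K := K) (by norm_num) (fun n x hx => hVK n 0 (by norm_num) x hx)
    (fun n x hx y hy => by
      rw [← (hV n).sobolev.integral_eq_sub (j := 0) (by norm_num) hy hx]
      refine intervalIntegral.norm_integral_le_of_norm_le_const fun t ht =>
        hVK n 1 (by norm_num) t ?_
      exact OrdConnected.uIcc_subset ordConnected_Icc hy hx (uIoc_subset_uIcc ht))
  obtain ⟨e, -, ψ, hψ, he⟩ := (isCompact_closedBall (0 : Fin 4 → ℂ) K).tendsto_subseq
    (x := fun n (j : Fin 4) => V (φ n) j (-1)) (fun n => by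
      rw [mem_closedBall_zero_iff, pi_norm_le_iff_of_nonneg (by positivity)]
      exact fun j => hVK _ j j.2 _ (by norm_num))
  set v : ℕ → ℕ → ℝ → ℂ := fun n => V (φ (ψ n)) with hv
  have hvd : ∀ n, ResonantDataLE Ψ α σ (v n) (1 / ((n : ℝ) + 1)) := by
    intro n
    have h1 := hV (φ (ψ n))
    have h2 : 1 / (((φ (ψ n) : ℕ) : ℝ) + 1) ≤ 1 / ((n : ℝ) + 1) := by
      gcongr
      exact (hφ.comp hψ).le_apply
    exact ⟨h1.1, h1.2.trans h2, h1.3.trans h2, h1.4.trans h2, h1.5.trans h2, h1.6.trans h2,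
      h1.7.trans h2⟩
  have hlim0 := tendsto_one_div_add_atTop_nhds_zero_nat (𝕜 := ℝ)
  have hvg : TendstoUniformlyOn (fun n => v n 0) g atTop (Icc (-1) 1) :=
    fun s hs => hψ.tendsto_atTop.eventually (hφg s hs)
  have hΨC : ContinuousOn (fun ξ => ((α * Ψ ξ : ℝ) : ℂ)) (Icc (-1 : ℝ) 1) := by fun_prop
  -- The limit `E` is built from the limits of the initial data and from the fourth derivative that
  -- the equation dictates; that `E 0` is the uniform limit `g` follows afterwards.
  set F : ℝ → ℂ := fun ξ => -(((α * Ψ ξ : ℝ) : ℂ) * g ξ) with hF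
  have hFc : ContinuousOn F (Icc (-1) 1) := (hΨC.mul hg).neg
  set E : ℕ → ℝ → ℂ := primitiveFour (-1) F (fun j => if h : j < 4 then e ⟨j, h⟩ else 0) with hE
  have hES : IsSobolevFour (-1) 1 E :=
    isSobolevFour_primitiveFour _ (by norm_num) (memLp_of_continuousOn hFc)
  have hE4 : E 4 = F := primitiveFour_four _ _ _
  have hdata : ∀ j < 4, Tendsto (fun n => v n j (-1)) atTop (𝓝 (E j (-1))) := by
    intro j hj
    rw [hE, primitiveFour_base _ _ _ hj, dif_pos hj]
    exact (tendsto_pi_nhds.1 he) ⟨j, hj⟩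
  have h4 : Tendsto (fun n => ∫ x in (-1 : ℝ)..1, ‖v n 4 x - E 4 x‖) atTop (𝓝 0) := by
    rw [Metric.tendsto_atTop]
    intro ε hε
    obtain ⟨N1, hN1⟩ := eventually_atTop.1 (Metric.tendstoUniformlyOn_iff.1 hvg
      (ε / (4 * (P + 1))) (by positivity))
    obtain ⟨N2, hN2⟩ := eventually_atTop.1 (hlim0.eventually (gt_mem_nhds (half_pos hε)))
    refine ⟨max N1 N2, fun n hn => ?_⟩
    rw [Real.dist_0_eq_abs, abs_of_nonneg (intervalIntegral.integral_nonneg (by norm_num)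
      fun _ _ => norm_nonneg _)]
    have hi := (resonant_intervalIntegrable (Ψ := fun ξ => α * Ψ ξ) (by fun_prop)
      (hvd n).sobolev).norm
    calc ∫ x in (-1 : ℝ)..1, ‖v n 4 x - E 4 x‖ ≤
        ∫ x in (-1 : ℝ)..1, (‖v n 4 x + ((α * Ψ x : ℝ) : ℂ) * v n 0 x‖ +
          P * (ε / (4 * (P + 1)))) := by
          refine intervalIntegral.integral_mono_on (by norm_num)
            (((hvd n).sobolev.sub hES).intervalIntegrable le_rfl (by norm_num)).norm
            (hi.add intervalIntegrable_const) fun x hx => ?_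
          have h1 : v n 4 x - E 4 x = (v n 4 x + ((α * Ψ x : ℝ) : ℂ) * v n 0 x) +
              ((α * Ψ x : ℝ) : ℂ) * (g x - v n 0 x) := by
            rw [hE4, hF]; ring
          rw [h1]
          refine (norm_add_le _ _).trans ?_
          gcongr
          rw [norm_mul, Complex.norm_real, Real.norm_eq_abs, ← dist_eq_norm]
          exact mul_le_mul (hP x hx) (hN1 n (le_of_max_le_left hn) x hx).le dist_nonneg hP0
      _ = (∫ x in (-1 : ℝ)..1, ‖v n 4 x + ((α * Ψ x : ℝ) : ℂ) * v n 0 x‖) +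
          2 * (P * (ε / (4 * (P + 1)))) := by
          rw [intervalIntegral.integral_add hi intervalIntegrable_const,
            intervalIntegral.integral_const, smul_eq_mul]
          norm_num
      _ < ε := by
          have h1 := ((hvd n).rhs).trans_lt (hN2 n (le_of_max_le_right hn))
          have h2 : 2 * (P * (ε / (4 * (P + 1)))) ≤ ε / 2 := by
            rw [mul_div_assoc', mul_div_assoc', div_le_iff₀ (by positivity)]
            nlinarith
          linarith
  obtain ⟨δ, hδ, hδE⟩ := exists_uniform_bound_of_tendsto (c := -1) (d := 1) (p := -1)
    (c' := fun _ => -1) (fun _ => le_rfl) (fun _ => by norm_num) (fun n => (hvd n).sobolev) hES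
    hdata h4
  have hptw : ∀ j < 4, ∀ ξ ∈ Icc (-1 : ℝ) 1, Tendsto (fun n => v n j ξ) atTop (𝓝 (E j ξ)) :=
    fun j hj ξ hξ => tendsto_iff_norm_sub_tendsto_zero.2
      (squeeze_zero (fun _ => norm_nonneg _) (fun n => hδE n j hj ξ hξ) hδ)
  have hE0 : ∀ ξ ∈ Icc (-1 : ℝ) 1, E 0 ξ = g ξ := fun ξ hξ =>
    tendsto_nhds_unique (hptw 0 (by norm_num) ξ hξ) (hvg.tendsto_at hξ)
  have hz : ∀ {w : ℕ → ℂ} {l : ℂ}, Tendsto w atTop (𝓝 l) →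
      (∀ n : ℕ, ‖w n‖ ≤ 1 / ((n : ℝ) + 1)) → l = 0 := fun hw hb =>
    tendsto_nhds_unique hw (squeeze_zero_norm hb hlim0)
  have hEz : ∀ ξ ∈ Icc (-1 : ℝ) 1, E 0 ξ = 0 := by
    refine ResonantDataLE.eq_zero hinj hES (fun ξ hξ => ?_)
      (hz (hptw 2 (by norm_num) _ (by norm_num)) fun n => (hvd n).two_left)
      (hz (hptw 3 (by norm_num) _ (by norm_num)) fun n => (hvd n).three_left)
      (hz (hptw 2 (by norm_num) _ (by norm_num)) fun n => (hvd n).two_right)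
      (hz (hptw 3 (by norm_num) _ (by norm_num)) fun n => (hvd n).three_right)
      (hz ((hptw 1 (by norm_num) _ (by norm_num)).const_mul _) fun n => (hvd n).slope)
    rw [hE4, hF, hE0 ξ hξ]
    ring
  have hEj : ∀ j < 4, E j (-1) = 0 := fun j hj => hES.eqOn_zero (by norm_num)
    (ae_restrict_Ioo_of_forall fun ξ hξ => hEz ξ (Ioo_subset_Icc_self hξ)) hj (by norm_num)
  have hN0 : Tendsto (fun n => N (v n)) atTop (𝓝 0) := by
    have h1 : Tendsto (fun n => ∑ j ∈ Finset.range 4, ‖v n j (-1)‖) atTop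
        (𝓝 (∑ j ∈ Finset.range 4, (0 : ℝ))) := tendsto_finsetSum _ fun j hj => by
      have := (hdata j (Finset.mem_range.1 hj)).norm
      rwa [hEj j (Finset.mem_range.1 hj), norm_zero] at this
    have h2 : Tendsto (fun n => ∫ ξ in (-1 : ℝ)..1, ‖v n 0 ξ‖) atTop (𝓝 0) := by
      refine squeeze_zero (fun n => hNi (v n)) (fun n => ?_) (by simpa using hδ.mul_const 2)
      refine (integral_norm_le_of_forall (K := δ n) (by norm_num) fun ξ hξ => ?_).trans
        (by norm_num)
      have := hδE n 0 (by norm_num) ξ hξ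
      rwa [hEz ξ hξ, sub_zero] at this
    simpa using h1.add h2
  have : (1 : ℝ) = 0 := tendsto_nhds_unique (tendsto_const_nhds.congr fun n => (hVN _).symm) hN0
  norm_num at this

end APriori

/-! ### The inner region -/

section Inner

/-- Data of the solution in the stretched variable `ξ = x / ε`: the equation
`V⁗ + (α Ψ + ε (β Φ + ε r)) V = k` with small `k` and with bounded outer derivatives. -/
structure InnerDataLE (p : ℝ → ℝ) (ε : ℝ) (V : ℕ → ℝ → ℂ) (A : ℝ) : Prop where
  sobolev : IsSobolevFour (-1) 1 V
  rhs : ∫ ξ in (-1 : ℝ)..1, ‖V 4 ξ + (p ξ : ℂ) * V 0 ξ‖ ≤ ε ^ 3 * A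
  one_left : ‖V 1 (-1)‖ ≤ ε * A
  two_left : ‖V 2 (-1)‖ ≤ ε ^ 2 * A
  three_left : ‖V 3 (-1)‖ ≤ ε ^ 3 * A
  two_right : ‖V 2 1‖ ≤ ε ^ 2 * A
  three_right : ‖V 3 1‖ ≤ ε ^ 3 * A

variable {Ψ Φ : ℝ → ℝ} {α β σ : ℝ} {W : ℕ → ℝ → ℝ}

/-- In the inner region the solution is close to a multiple of the resonance function. -/
theorem exists_inner_approximation (hΨ : Continuous Ψ) (hΦ : Continuous Φ)
    (hinj : ∀ W : ℕ → ℝ → ℝ, IsResonantSolution Ψ α W → σ * W 1 (-1) = 0 →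
      ∀ ξ ∈ Icc (-1 : ℝ) 1, W 0 ξ = 0)
    (hW : IsResonantSolution Ψ α W) (hWσ : σ * (1 - W 1 (-1)) = 0) {P : ℝ} (hP : 0 ≤ P) :
    ∃ C ε₀ : ℝ, 0 ≤ C ∧ 0 < ε₀ ∧ ε₀ ≤ 1 ∧ ∀ ε ∈ Ioo 0 ε₀, ∀ r : ℝ → ℝ,
      ContinuousOn r (Icc (-1) 1) → (∀ ξ ∈ Icc (-1 : ℝ) 1, |r ξ| ≤ P) → ∀ V A,
      InnerDataLE (fun ξ => α * Ψ ξ + ε * (β * Φ ξ + ε * r ξ)) ε V A →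
      (∀ ξ ∈ Icc (-1 : ℝ) 1, ‖V 0 ξ‖ ≤ C * (ε * A)) ∧
      ∀ j < 4, ∀ ξ ∈ Icc (-1 : ℝ) 1, ‖V j ξ - V 1 (-1) * W j ξ‖ ≤ C * (ε ^ 2 * A) := by
  obtain ⟨C₀, hC₀, hap⟩ := exists_apriori_bound hΨ hinj
  obtain ⟨Q, hQ⟩ := isCompact_Icc.exists_bound_of_continuousOn
    (s := Icc (-1 : ℝ) 1) (f := fun ξ => β * Φ ξ) (by fun_prop)
  simp only [Real.norm_eq_abs] at hQ
  have hQ0 : 0 ≤ Q := (abs_nonneg _).trans (hQ 0 (by norm_num))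
  obtain ⟨w, hw⟩ := isCompact_Icc.exists_bound_of_continuousOn
    (hW.sobolev.continuousOn (j := 0) (by norm_num))
  have hw0 : 0 ≤ w := (norm_nonneg _).trans (hw 0 (by norm_num))
  set C₂ := 2 * (w + C₀) with hC₂
  set C₃ := C₀ * (1 + 2 * (Q + P) * C₂) with hC₃
  have hC₂0 : 0 ≤ C₂ := by positivity
  have hC₃0 : 0 ≤ C₃ := by positivity
  -- Below this threshold 2εC₀(Q + P) ≤ 1/2, which allows the maximum of |V| to be absorbed on the
  -- left.
  refine ⟨C₂ + C₃, 1 / (1 + 4 * C₀ * (Q + P)), by positivity, by positivity, ?_, ?_⟩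
  · rw [div_le_one (by positivity)]
    have : 0 ≤ 4 * C₀ * (Q + P) := by positivity
    linarith
  intro ε hε r hr hrP V A hV
  have hε0 : 0 < ε := hε.1
  have hεC : ε * (1 + 4 * C₀ * (Q + P)) ≤ 1 := by
    have := hε.2.le
    rwa [le_div_iff₀ (by positivity)] at this
  have hε1 : ε ≤ 1 := by
    have : 0 ≤ ε * (4 * C₀ * (Q + P)) := by positivity
    linarith
  have hA : 0 ≤ A := by
    have := (norm_nonneg _).trans hV.one_left
    exact nonneg_of_mul_nonneg_right this hε0
  have hVS := hV.sobolev
  obtain ⟨ξ₀, hξ₀, hmax⟩ := isCompact_Icc.exists_isMaxOn (nonempty_Icc.2 (by norm_num))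
    (hVS.continuousOn (j := 0) (by norm_num)).norm
  set s := ‖V 0 ξ₀‖ with hs
  have hVs : ∀ ξ ∈ Icc (-1 : ℝ) 1, ‖V 0 ξ‖ ≤ s := fun ξ hξ => hmax hξ
  have hs0 : 0 ≤ s := norm_nonneg _
  set m := V 1 (-1) with hm
  have hWc := hW.sobolev.ofReal
  -- The deviation from the multiple of `W` with slope factor V'(-1). Since `W` solves the
  -- homogeneous problem, `R` inherits the data of `V` at order two and three.
  set R : ℕ → ℝ → ℂ := V - m • fun j ξ => (W j ξ : ℂ) with hR
  have hRj : ∀ j ξ, R j ξ = V j ξ - m * W j ξ := fun j ξ => rfl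
  have hRS : IsSobolevFour (-1) 1 R := hVS.sub (hWc.smul m)
  have hε32 : ε ^ 3 * A ≤ ε ^ 2 * A := by
    gcongr ?_ * A
    exact pow_le_pow_of_le_one hε0.le hε1 (by norm_num)
  set B := ε ^ 2 * A + 2 * ε * (Q + P) * s with hB
  have hB0 : ε ^ 2 * A ≤ B := by
    have : 0 ≤ 2 * ε * (Q + P) * s := by positivity
    linarith
  have hpot : ContinuousOn (fun ξ => α * Ψ ξ + ε * (β * Φ ξ + ε * r ξ)) (Icc (-1) 1) := by
    fun_prop
  have hRrhs : ∫ ξ in (-1 : ℝ)..1, ‖R 4 ξ + ((α * Ψ ξ : ℝ) : ℂ) * R 0 ξ‖ ≤ B := by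
    have h1 : ∫ ξ in (-1 : ℝ)..1, ‖R 4 ξ + ((α * Ψ ξ : ℝ) : ℂ) * R 0 ξ‖ =
        ∫ ξ in (-1 : ℝ)..1, ‖V 4 ξ + ((α * Ψ ξ : ℝ) : ℂ) * V 0 ξ‖ := by
      rw [intervalIntegral.integral_of_le (by norm_num),
        intervalIntegral.integral_of_le (by norm_num), integral_Ioc_eq_integral_Ioo,
        integral_Ioc_eq_integral_Ioo]
      refine integral_congr_ae ?_
      filter_upwards [hW.equation] with ξ hξ
      congr 1
      have h2 : (W 4 ξ : ℂ) + ((α * Ψ ξ : ℝ) : ℂ) * W 0 ξ = 0 := by exact_mod_cast hξ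
      rw [hRj, hRj]
      linear_combination (-m) * h2
    have hi1 := (resonant_intervalIntegrable hpot hVS).norm
    rw [h1]
    calc ∫ ξ in (-1 : ℝ)..1, ‖V 4 ξ + ((α * Ψ ξ : ℝ) : ℂ) * V 0 ξ‖ ≤
        ∫ ξ in (-1 : ℝ)..1, (‖V 4 ξ + ((α * Ψ ξ + ε * (β * Φ ξ + ε * r ξ) : ℝ) : ℂ) * V 0 ξ‖ +
          ε * (Q + P) * s) := by
          refine intervalIntegral.integral_mono_on (by norm_num)
            (resonant_intervalIntegrable (Ψ := fun ξ => α * Ψ ξ) (by fun_prop) hVS).norm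
            (hi1.add intervalIntegrable_const) fun ξ hξ => ?_
          have h2 : V 4 ξ + ((α * Ψ ξ : ℝ) : ℂ) * V 0 ξ =
              (V 4 ξ + ((α * Ψ ξ + ε * (β * Φ ξ + ε * r ξ) : ℝ) : ℂ) * V 0 ξ) -
              ((ε * (β * Φ ξ + ε * r ξ) : ℝ) : ℂ) * V 0 ξ := by
            push_cast; ring
          rw [h2]
          refine (norm_sub_le _ _).trans ?_
          gcongr
          rw [norm_mul, Complex.norm_real, Real.norm_eq_abs, abs_mul, abs_of_pos hε0]
          gcongr
          · refine (abs_add_le _ _).trans (add_le_add (hQ ξ hξ) ?_)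
            rw [abs_mul, abs_of_pos hε0]
            calc ε * |r ξ| ≤ 1 * P := by gcongr; exact hrP ξ hξ
              _ = P := one_mul P
          · exact hVs ξ hξ
      _ = (∫ ξ in (-1 : ℝ)..1,
            ‖V 4 ξ + ((α * Ψ ξ + ε * (β * Φ ξ + ε * r ξ) : ℝ) : ℂ) * V 0 ξ‖) +
          2 * (ε * (Q + P) * s) := by
          rw [intervalIntegral.integral_add hi1 intervalIntegrable_const,
            intervalIntegral.integral_const, smul_eq_mul]
          norm_num
      _ ≤ B := by
          have := hV.rhs
          rw [hB]
          linarith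
  have hRd : ResonantDataLE Ψ α σ R B := by
    refine ⟨hRS, hRrhs, ?_, ?_, ?_, ?_, ?_⟩
    · rw [hRj, hW.left.1]; simpa using hV.two_left.trans hB0
    · rw [hRj, hW.left.2]; simpa using hV.three_left.trans (hε32.trans hB0)
    · rw [hRj, hW.right.1]; simpa using hV.two_right.trans hB0
    · rw [hRj, hW.right.2]; simpa using hV.three_right.trans (hε32.trans hB0)
    -- R'(-1) = m(1 - W'(-1)), so the normalisation of `W` is exactly the slope condition missing
    -- from the a priori estimate.
    · have h2 : (σ : ℂ) * (1 - W 1 (-1)) = 0 := by exact_mod_cast hWσ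
      have h3 : (σ : ℂ) * R 1 (-1) = 0 := by
        rw [hRj, ← hm]
        linear_combination m * h2
      rw [h3, norm_zero]
      exact le_trans (by positivity) hB0
  have hRB := hap R B hRd
  have hmw : ∀ ξ ∈ Icc (-1 : ℝ) 1, ‖m * W 0 ξ‖ ≤ ε * A * w := fun ξ hξ => by
    rw [norm_mul, Complex.norm_real]
    exact mul_le_mul hV.one_left (hw ξ hξ) (norm_nonneg _) (by positivity)
  -- At the maximum point s ≤ εAw + C₀(ε²A + 2ε(Q + P)s), and the term with s on the right is at
  -- most s/2.
  have hs2 : s ≤ C₂ * (ε * A) := by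
    have h1 : s ≤ ε * A * w + C₀ * B := by
      have h2 : V 0 ξ₀ = m * W 0 ξ₀ + R 0 ξ₀ := by rw [hRj]; ring
      rw [hs, h2]
      exact (norm_add_le _ _).trans (add_le_add (hmw ξ₀ hξ₀) (hRB 0 (by norm_num) ξ₀ hξ₀))
    have h3 : ε * (4 * C₀ * (Q + P)) * s ≤ 1 * s := by
      gcongr
      linarith
    have h4 : C₀ * (ε ^ 2 * A) ≤ C₀ * (ε * A) := by
      gcongr
      exact pow_le_of_le_one hε0.le hε1 (by norm_num)
    rw [hB] at h1
    rw [hC₂]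
    linarith
  have hBle : B ≤ (1 + 2 * (Q + P) * C₂) * (ε ^ 2 * A) := by
    have : 2 * ε * (Q + P) * s ≤ 2 * ε * (Q + P) * (C₂ * (ε * A)) := by gcongr
    rw [hB]
    linarith
  constructor
  · intro ξ hξ
    refine (hVs ξ hξ).trans (hs2.trans ?_)
    gcongr
    linarith
  · intro j hj ξ hξ
    refine (hRB j hj ξ hξ).trans ?_
    calc C₀ * B ≤ C₀ * ((1 + 2 * (Q + P) * C₂) * (ε ^ 2 * A)) := by gcongr
      _ = C₃ * (ε ^ 2 * A) := by rw [hC₃]; ring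
      _ ≤ _ := by gcongr; linarith

/-- The transition conditions across the inner region, up to small errors. -/
theorem exists_inner_estimate (hΨ : Continuous Ψ) (hΦ : Continuous Φ)
    (hinj : ∀ W : ℕ → ℝ → ℝ, IsResonantSolution Ψ α W → σ * W 1 (-1) = 0 →
      ∀ ξ ∈ Icc (-1 : ℝ) 1, W 0 ξ = 0)
    (hW : IsResonantSolution Ψ α W) (hWσ : σ * (1 - W 1 (-1)) = 0) {P : ℝ} (hP : 0 ≤ P) :
    ∃ C ε₀ : ℝ, 0 ≤ C ∧ 0 < ε₀ ∧ ε₀ ≤ 1 ∧ ∀ ε ∈ Ioo 0 ε₀, ∀ r : ℝ → ℝ,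
      ContinuousOn r (Icc (-1) 1) → (∀ ξ ∈ Icc (-1 : ℝ) 1, |r ξ| ≤ P) → ∀ V A,
      InnerDataLE (fun ξ => α * Ψ ξ + ε * (β * Φ ξ + ε * r ξ)) ε V A →
      (∀ ξ ∈ Icc (-1 : ℝ) 1, ‖V 0 ξ‖ ≤ C * (ε * A)) ∧
      (∀ ξ ∈ Icc (-1 : ℝ) 1, ‖V 1 ξ‖ ≤ C * (ε * A)) ∧
      (∀ ξ ∈ Icc (-1 : ℝ) 1, ‖V 1 ξ - V 1 (-1) * W 1 ξ‖ ≤ C * (ε ^ 2 * A)) ∧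
      ‖V 2 1 * W 1 1 - V 2 (-1) * W 1 (-1) -
        ε * ((β * ∫ ξ in (-1 : ℝ)..1, Φ ξ * W 0 ξ ^ 2 : ℝ) : ℂ) * V 1 (-1)‖ ≤
          C * (ε ^ 3 * A) := by
  obtain ⟨C, ε₀, hC, hε₀, hε₀1, H⟩ := exists_inner_approximation (β := β) hΨ hΦ hinj hW hWσ hP
  obtain ⟨Q, hQ⟩ := isCompact_Icc.exists_bound_of_continuousOn
    (s := Icc (-1 : ℝ) 1) (f := fun ξ => β * Φ ξ) (by fun_prop)
  simp only [Real.norm_eq_abs] at hQ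
  have hQ0 : 0 ≤ Q := (abs_nonneg _).trans (hQ 0 (by norm_num))
  obtain ⟨w, hw⟩ := isCompact_Icc.exists_bound_of_continuousOn
    (hW.sobolev.continuousOn (j := 0) (by norm_num))
  have hw0 : 0 ≤ w := (norm_nonneg _).trans (hw 0 (by norm_num))
  obtain ⟨w₁, hw₁⟩ := isCompact_Icc.exists_bound_of_continuousOn
    (hW.sobolev.continuousOn (j := 1) (by norm_num))
  have hw₁0 : 0 ≤ w₁ := (norm_nonneg _).trans (hw₁ 0 (by norm_num))
  set C' := C + (w₁ + C) + w * (3 + 2 * (Q * C) + 2 * (P * C)) with hC'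
  have hw3 : 0 ≤ w * (3 + 2 * (Q * C) + 2 * (P * C)) := by positivity
  refine ⟨C', ε₀, by positivity, hε₀, hε₀1, fun ε hε r hr hrP V A hV => ?_⟩
  obtain ⟨h0, hR⟩ := H ε hε r hr hrP V A hV
  have hε0 : 0 < ε := hε.1
  have hε1 : ε ≤ 1 := hε.2.le.trans hε₀1
  have hA : 0 ≤ A := by
    have := (norm_nonneg _).trans hV.one_left
    exact nonneg_of_mul_nonneg_right this hε0
  have hVS := hV.sobolev
  have hWc := hW.sobolev.ofReal
  refine ⟨fun ξ hξ => (h0 ξ hξ).trans ?_, fun ξ hξ => ?_, fun ξ hξ =>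
    (hR 1 (by norm_num) ξ hξ).trans ?_, ?_⟩
  · gcongr; linarith
  · have h1 : V 1 ξ = V 1 (-1) * W 1 ξ + (V 1 ξ - V 1 (-1) * W 1 ξ) := by ring
    have h2 : ‖V 1 (-1) * W 1 ξ‖ ≤ ε * A * w₁ := by
      rw [norm_mul, Complex.norm_real]
      exact mul_le_mul hV.one_left (hw₁ ξ hξ) (norm_nonneg _) (by positivity)
    have h3 : C * (ε ^ 2 * A) ≤ C * (ε * A) := by
      gcongr
      exact pow_le_of_le_one hε0.le hε1 (by norm_num)
    rw [h1]
    refine (norm_add_le _ _).trans ((add_le_add h2 ((hR 1 (by norm_num) ξ hξ).trans h3)).trans ?_)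
    calc ε * A * w₁ + C * (ε * A) = (w₁ + C) * (ε * A) := by ring
      _ ≤ _ := by gcongr; linarith
  · gcongr; linarith
  · set m := V 1 (-1) with hm
    have hpot : ContinuousOn (fun ξ => α * Ψ ξ + ε * (β * Φ ξ + ε * r ξ)) (Icc (-1) 1) := by
      fun_prop
    set k : ℝ → ℂ := fun ξ => V 4 ξ + ((α * Ψ ξ + ε * (β * Φ ξ + ε * r ξ) : ℝ) : ℂ) * V 0 ξ with hk
    have hki : IntervalIntegrable k volume (-1) 1 := resonant_intervalIntegrable hpot hVS
    have hW0c : ContinuousOn (fun ξ => (W 0 ξ : ℂ)) (Icc (-1) 1) :=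
      hWc.continuousOn (j := 0) (by norm_num)
    have hΦi : IntervalIntegrable (fun ξ => ε * m * ((β * (Φ ξ * W 0 ξ ^ 2) : ℝ) : ℂ))
        volume (-1) 1 := by
      refine ContinuousOn.intervalIntegrable ?_
      rw [uIcc_of_le (by norm_num)]
      have : ContinuousOn (W 0) (Icc (-1) 1) := hW.sobolev.continuousOn (by norm_num)
      fun_prop
    -- Testing with `W`: its second and third derivatives vanish at ±1, so the boundary terms are
    -- V'''W - V''W' only, and the first of these is O(ε³).
    have hg := hVS.green hWc (by norm_num)
    simp only [hW.left.1, hW.left.2, hW.right.1, hW.right.2, Complex.ofReal_zero, mul_zero,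
      sub_zero, add_zero] at hg
    rw [← intervalIntegral.integral_sub
      (hVS.mul_intervalIntegrable hWc le_rfl (by norm_num) (by norm_num))
      (by simp_rw [mul_comm (V 0 _)]
          exact hWc.mul_intervalIntegrable hVS le_rfl (by norm_num) (by norm_num))] at hg
    have hI : ∫ ξ in (-1 : ℝ)..1, ε * m * ((β * (Φ ξ * W 0 ξ ^ 2) : ℝ) : ℂ) =
        ε * ((β * ∫ ξ in (-1 : ℝ)..1, Φ ξ * W 0 ξ ^ 2 : ℝ) : ℂ) * m := by
      rw [intervalIntegral.integral_const_mul, intervalIntegral.integral_ofReal,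
        intervalIntegral.integral_const_mul]
      ring
    -- The terms αΨVW cancel. Replacing V by mW in the term εβΦVW isolates the integral that becomes
    -- κ; everything left over is of order ε³.
    have hsum : (∫ ξ in (-1 : ℝ)..1, (V 4 ξ * W 0 ξ - V 0 ξ * W 4 ξ)) +
        ∫ ξ in (-1 : ℝ)..1, ε * m * ((β * (Φ ξ * W 0 ξ ^ 2) : ℝ) : ℂ) =
        ∫ ξ in (-1 : ℝ)..1, (k ξ * W 0 ξ - (ε * ((β * Φ ξ : ℝ) : ℂ) * (V 0 ξ - m * W 0 ξ) * W 0 ξ +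
          ε ^ 2 * r ξ * V 0 ξ * W 0 ξ)) := by
      rw [← intervalIntegral.integral_add ((hVS.mul_intervalIntegrable hWc le_rfl (by norm_num)
        (by norm_num)).sub (by
          simp_rw [mul_comm (V 0 _)]
          exact hWc.mul_intervalIntegrable hVS le_rfl (by norm_num) (by norm_num))) hΦi,
        intervalIntegral.integral_of_le (by norm_num),
        intervalIntegral.integral_of_le (by norm_num), integral_Ioc_eq_integral_Ioo,
        integral_Ioc_eq_integral_Ioo]
      refine integral_congr_ae ?_
      filter_upwards [hW.equation] with ξ hξ
      have h2 : (W 4 ξ : ℂ) + α * Ψ ξ * W 0 ξ = 0 := by exact_mod_cast hξ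
      simp only [hk]
      push_cast
      linear_combination (-V 0 ξ) * h2
    have hbound : ‖∫ ξ in (-1 : ℝ)..1, (k ξ * W 0 ξ -
        (ε * ((β * Φ ξ : ℝ) : ℂ) * (V 0 ξ - m * W 0 ξ) * W 0 ξ + ε ^ 2 * r ξ * V 0 ξ * W 0 ξ))‖ ≤
        w * (1 + 2 * (Q * C) + 2 * (P * C)) * (ε ^ 3 * A) := by
      have hN : 0 ≤ (Q * C + P * C) * (ε ^ 3 * A) * w := by positivity
      calc _ ≤ ∫ ξ in (-1 : ℝ)..1, (‖k ξ‖ * w + (Q * C + P * C) * (ε ^ 3 * A) * w) := by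
            refine intervalIntegral.norm_integral_le_of_norm_le (by norm_num)
              (Eventually.of_forall fun ξ hξ' => ?_) ((hki.norm.mul_const w).add
                intervalIntegrable_const)
            have hξ := Ioc_subset_Icc_self hξ'
            have hWξ : ‖(W 0 ξ : ℂ)‖ ≤ w := by rw [Complex.norm_real]; exact hw ξ hξ
            refine (norm_sub_le _ _).trans (add_le_add ?_ ((norm_add_le _ _).trans ?_))
            · rw [norm_mul]; gcongr
            · have e1 : ‖(ε : ℂ) * ((β * Φ ξ : ℝ) : ℂ) * (V 0 ξ - m * W 0 ξ) * W 0 ξ‖ ≤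
                  ε * Q * (C * (ε ^ 2 * A)) * w := by
                rw [norm_mul, norm_mul, norm_mul, Complex.norm_real ε, Complex.norm_real (β * Φ ξ),
                  Real.norm_of_nonneg hε0.le, Real.norm_eq_abs]
                gcongr
                · exact hQ ξ hξ
                · exact hR 0 (by norm_num) ξ hξ
              have e2 : ‖(ε : ℂ) ^ 2 * r ξ * V 0 ξ * W 0 ξ‖ ≤ ε ^ 2 * P * (C * (ε * A)) * w := by
                rw [norm_mul, norm_mul, norm_mul, norm_pow, Complex.norm_real ε,
                  Complex.norm_real (r ξ), Real.norm_of_nonneg hε0.le, Real.norm_eq_abs]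
                gcongr
                · exact hrP ξ hξ
                · exact h0 ξ hξ
              calc _ ≤ _ := add_le_add e1 e2
                _ = _ := by ring
        _ = (∫ ξ in (-1 : ℝ)..1, ‖k ξ‖) * w + 2 * ((Q * C + P * C) * (ε ^ 3 * A) * w) := by
            rw [intervalIntegral.integral_add (hki.norm.mul_const w) intervalIntegrable_const,
              intervalIntegral.integral_mul_const, intervalIntegral.integral_const, smul_eq_mul]
            norm_num
        _ ≤ ε ^ 3 * A * w + 2 * ((Q * C + P * C) * (ε ^ 3 * A) * w) := by
            gcongr
            exact hV.rhs
        _ = _ := by ring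
    have hend : ∀ ξ ∈ Icc (-1 : ℝ) 1, ‖V 3 ξ‖ ≤ ε ^ 3 * A → ‖V 3 ξ * W 0 ξ‖ ≤ w * (ε ^ 3 * A) := by
      intro ξ hξ h3
      rw [norm_mul, Complex.norm_real, mul_comm w]
      exact mul_le_mul h3 (hw ξ hξ) (norm_nonneg _) (by positivity)
    have hfin : V 2 1 * W 1 1 - V 2 (-1) * W 1 (-1) -
        ε * ((β * ∫ ξ in (-1 : ℝ)..1, Φ ξ * W 0 ξ ^ 2 : ℝ) : ℂ) * m =
        V 3 1 * W 0 1 - V 3 (-1) * W 0 (-1) -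
        ∫ ξ in (-1 : ℝ)..1, (k ξ * W 0 ξ -
          (ε * ((β * Φ ξ : ℝ) : ℂ) * (V 0 ξ - m * W 0 ξ) * W 0 ξ +
            ε ^ 2 * r ξ * V 0 ξ * W 0 ξ)) := by
      rw [← hsum, hg, hI]
      ring
    rw [hfin]
    calc _ ≤ w * (ε ^ 3 * A) + w * (ε ^ 3 * A) +
          w * (1 + 2 * (Q * C) + 2 * (P * C)) * (ε ^ 3 * A) := by
          refine (norm_sub_le _ _).trans (add_le_add ((norm_sub_le _ _).trans (add_le_add ?_ ?_))
            hbound)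
          · exact hend 1 (by norm_num) hV.three_right
          · exact hend (-1) (by norm_num) hV.three_left
      _ = (w * (3 + 2 * (Q * C) + 2 * (P * C))) * (ε ^ 3 * A) := by ring
      _ ≤ _ := by gcongr; linarith

end Inner

/-! ### The outer region -/

section Outer

/-- Green's formula against (x - c)ⁿ with n ≥ 4 has no boundary terms at `c`, so it bounds one
combination of the second and third derivatives at `d` by L₁ norms. The cases n = 4 and n = 5 give
independent combinations: l times the first minus the second leaves l⁴ D 2 d. -/
theorem exists_endpoint_bound {c d : ℝ} (hcd : c < d) :
    ∃ C : ℝ, 0 ≤ C ∧ ∀ D : ℕ → ℝ → ℂ, IsSobolevFour c d D → D 0 d = 0 → D 1 d = 0 →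
      ∀ N, ∫ x in c..d, ‖D 0 x‖ ≤ N → ∫ x in c..d, ‖D 4 x‖ ≤ N → ∀ j < 4, ‖D j d‖ ≤ C * N := by
  set l := d - c with hl
  have hl0 : 0 < l := sub_pos.2 hcd
  have key : ∀ n : ℕ, 4 ≤ n → ∃ K : ℝ, 0 ≤ K ∧ ∀ D : ℕ → ℝ → ℂ, IsSobolevFour c d D →
      D 0 d = 0 → D 1 d = 0 → ∀ N, ∫ x in c..d, ‖D 0 x‖ ≤ N → ∫ x in c..d, ‖D 4 x‖ ≤ N →
      ‖(l : ℂ) ^ n * D 3 d - n * (l : ℂ) ^ (n - 1) * D 2 d‖ ≤ K * N := by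
    intro n hn
    have hEs := isSobolevFour_monomialFamily c n c d
    set E := monomialFamily c n with hE
    obtain ⟨K₀, hK₀⟩ := isCompact_Icc.exists_bound_of_continuousOn
      (hEs.continuousOn (j := 0) (by norm_num))
    have hE4c : Continuous (E 4) := by
      rw [hE]; unfold monomialFamily; fun_prop
    obtain ⟨K₄, hK₄⟩ := isCompact_Icc.exists_bound_of_continuousOn
      (hE4c.continuousOn (s := Icc c d))
    have hK₀0 : 0 ≤ K₀ := (norm_nonneg _).trans (hK₀ c (left_mem_Icc.2 hcd.le))
    have hK₄0 : 0 ≤ K₄ := (norm_nonneg _).trans (hK₄ c (left_mem_Icc.2 hcd.le))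
    refine ⟨K₀ + K₄, by positivity, fun D hD h0 h1 N hN0 hN4 => ?_⟩
    have hEc : ∀ j < 4, E j c = 0 := fun j hj => by
      simp only [hE, monomialFamily, sub_self, Complex.ofReal_zero]
      rw [zero_pow (by omega), mul_zero]
    have hEd0 : E 0 d = (l : ℂ) ^ n := by simp [hE, monomialFamily, hl]
    have hEd1 : E 1 d = n * (l : ℂ) ^ (n - 1) := by simp [hE, monomialFamily, hl]
    have hg := hD.green hEs hcd.le
    rw [hEc 0 (by norm_num), hEc 1 (by norm_num), hEc 2 (by norm_num), hEc 3 (by norm_num), h0, h1,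
      hEd0, hEd1] at hg
    have hg' : (l : ℂ) ^ n * D 3 d - n * (l : ℂ) ^ (n - 1) * D 2 d =
        (∫ x in c..d, D 4 x * E 0 x) - ∫ x in c..d, D 0 x * E 4 x := by
      rw [hg]; ring
    have hi : ∀ j ≤ 4, IntervalIntegrable (fun x => ‖D j x‖) volume c d := fun j hj =>
      (hD.intervalIntegrable hj (right_mem_Icc.2 hcd.le)).norm
    have hb : ∀ (i j : ℕ) (K : ℝ), j ≤ 4 → (∀ x ∈ Icc c d, ‖E i x‖ ≤ K) →
        ‖∫ x in c..d, D j x * E i x‖ ≤ (∫ x in c..d, ‖D j x‖) * K := by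
      intro i j K hj hK
      rw [← intervalIntegral.integral_mul_const]
      refine intervalIntegral.norm_integral_le_of_norm_le hcd.le
        (Eventually.of_forall fun x hx => ?_) ((hi j hj).mul_const K)
      rw [norm_mul]
      gcongr
      exact hK x (Ioc_subset_Icc_self hx)
    rw [hg']
    refine (norm_sub_le _ _).trans ?_
    calc _ ≤ (∫ x in c..d, ‖D 4 x‖) * K₀ + (∫ x in c..d, ‖D 0 x‖) * K₄ :=
          add_le_add (hb 0 4 K₀ le_rfl hK₀) (hb 4 0 K₄ (by norm_num) hK₄)
      _ ≤ N * K₀ + N * K₄ := by gcongr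
      _ = _ := by ring
  obtain ⟨K₁, hK₁, h₁⟩ := key 4 le_rfl
  obtain ⟨K₂, hK₂, h₂⟩ := key 5 (by norm_num)
  set C₂ := (l * K₁ + K₂) / l ^ 4 with hC₂
  set C₃ := (K₁ + 4 * l ^ 3 * C₂) / l ^ 4 with hC₃
  have hC₂0 : 0 ≤ C₂ := by positivity
  have hC₃0 : 0 ≤ C₃ := by positivity
  refine ⟨C₂ + C₃, by positivity, fun D hD h0 h1 N hN0 hN4 j hj => ?_⟩
  have hN : 0 ≤ N := (intervalIntegral.integral_nonneg hcd.le fun _ _ => norm_nonneg _).trans hN0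
  have e₁ := h₁ D hD h0 h1 N hN0 hN4
  have e₂ := h₂ D hD h0 h1 N hN0 hN4
  have hnl : ∀ k : ℕ, ‖(l : ℂ) ^ k‖ = l ^ k := fun k => by
    rw [norm_pow, Complex.norm_real, Real.norm_of_nonneg hl0.le]
  have f₂ : ‖D 2 d‖ ≤ C₂ * N := by
    have h3 : (l : ℂ) ^ 4 * D 2 d = l * ((l : ℂ) ^ 4 * D 3 d -
      (4 : ℕ) * (l : ℂ) ^ (4 - 1) * D 2 d) -
        ((l : ℂ) ^ 5 * D 3 d - (5 : ℕ) * (l : ℂ) ^ (5 - 1) * D 2 d) := by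
      push_cast; ring
    have h4 : l ^ 4 * ‖D 2 d‖ ≤ (l * K₁ + K₂) * N := by
      rw [← hnl, ← norm_mul, h3]
      refine (norm_sub_le _ _).trans ?_
      rw [norm_mul, Complex.norm_real, Real.norm_of_nonneg hl0.le]
      calc _ ≤ l * (K₁ * N) + K₂ * N := by gcongr
        _ = _ := by ring
    rw [hC₂, div_mul_eq_mul_div, le_div_iff₀ (by positivity)]
    linarith
  have f₃ : ‖D 3 d‖ ≤ C₃ * N := by
    have h3 : (l : ℂ) ^ 4 * D 3 d = ((l : ℂ) ^ 4 * D 3 d - (4 : ℕ) * (l : ℂ) ^ (4 - 1) * D 2 d) +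
        (4 : ℕ) * (l : ℂ) ^ 3 * D 2 d := by
      push_cast; ring
    have h4 : l ^ 4 * ‖D 3 d‖ ≤ (K₁ + 4 * l ^ 3 * C₂) * N := by
      rw [← hnl, ← norm_mul, h3]
      refine (norm_add_le _ _).trans ?_
      rw [norm_mul, norm_mul, hnl]
      calc _ ≤ K₁ * N + 4 * l ^ 3 * (C₂ * N) := by
            have : ‖((4 : ℕ) : ℂ)‖ = 4 := by simp
            rw [this]
            gcongr
        _ = _ := by ring
    rw [hC₃, div_mul_eq_mul_div, le_div_iff₀ (by positivity)]
    linarith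
  interval_cases j
  · rw [h0, norm_zero]; positivity
  · rw [h1, norm_zero]; positivity
  · refine f₂.trans ?_; gcongr; linarith
  · refine f₃.trans ?_; gcongr; linarith

theorem integral_norm_mono {E : Type*} [NormedAddCommGroup E] {f : ℝ → E} {a b c d : ℝ}
    (hac : a ≤ c) (hcd : c ≤ d) (hdb : d ≤ b) (hf : IntervalIntegrable f volume a b) :
    ∫ x in c..d, ‖f x‖ ≤ ∫ x in a..b, ‖f x‖ := by
  have hab : a ≤ b := hac.trans (hcd.trans hdb)
  rw [intervalIntegral.integral_of_le hcd, intervalIntegral.integral_of_le hab]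
  exact setIntegral_mono_set ((intervalIntegrable_iff_integrableOn_Ioc_of_le hab).1 hf).norm
    (Eventually.of_forall fun _ => norm_nonneg _)
    (LE.le.eventuallyLE (Ioc_subset_Ioc hac hdb))

/-- The constant does not depend on ε: the traces at `b` are bounded on the fixed interval [b/2, b],
and integrating back from `b` to ε costs a factor depending on `b` only. -/
theorem exists_outer_bound_right {b : ℝ} (hb : 0 < b) :
    ∃ C : ℝ, 0 ≤ C ∧ ∀ ε, 0 ≤ ε → ε ≤ b / 2 → ∀ D : ℕ → ℝ → ℂ, IsSobolevFour ε b D →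
      D 0 b = 0 → D 1 b = 0 → ∀ N, ∫ x in ε..b, ‖D 0 x‖ ≤ N → ∫ x in ε..b, ‖D 4 x‖ ≤ N →
      ∀ j < 4, ∀ x ∈ Icc ε b, ‖D j x‖ ≤ C * N := by
  obtain ⟨C, hC, h⟩ := exists_endpoint_bound (c := b / 2) (d := b) (by linarith)
  refine ⟨2 * (1 + b) ^ 3 * (1 + C), by positivity,
    fun ε hε0 hε D hD h0 h1 N hN0 hN4 j hj x hx => ?_⟩
  have hεb : ε ≤ b := by linarith
  have hi : ∀ j ≤ 4, IntervalIntegrable (D j) volume ε b := fun j hj =>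
    hD.intervalIntegrable hj (right_mem_Icc.2 hεb)
  have hN : 0 ≤ N := (intervalIntegral.integral_nonneg hεb fun _ _ => norm_nonneg _).trans hN0
  have h2 := h D (hD.mono hε le_rfl) h0 h1 N
    ((integral_norm_mono hε (by linarith) le_rfl (hi 0 (by norm_num))).trans hN0)
    ((integral_norm_mono hε (by linarith) le_rfl (hi 4 le_rfl)).trans hN4)
  have := hD.norm_le (p := b) (right_mem_Icc.2 hεb) (A := (1 + C) * N)
    (fun j hj => (h2 j hj).trans (by nlinarith)) (hN4.trans (by nlinarith)) hj hx
  refine this.trans ?_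
  rw [mul_assoc (2 * (1 + b) ^ 3)]
  gcongr
  linarith

theorem exists_outer_bound_left {a : ℝ} (ha : a < 0) :
    ∃ C : ℝ, 0 ≤ C ∧ ∀ ε, 0 ≤ ε → ε ≤ -a / 2 → ∀ D : ℕ → ℝ → ℂ, IsSobolevFour a (-ε) D →
      D 0 a = 0 → D 1 a = 0 → ∀ N, ∫ x in a..(-ε), ‖D 0 x‖ ≤ N → ∫ x in a..(-ε), ‖D 4 x‖ ≤ N →
      ∀ j < 4, ∀ x ∈ Icc a (-ε), ‖D j x‖ ≤ C * N := by
  obtain ⟨C, hC, h⟩ := exists_outer_bound_right (b := -a) (by linarith)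
  refine ⟨C, hC, fun ε hε0 hε D hD h0 h1 N hN0 hN4 j hj x hx => ?_⟩
  have hr := hD.reflect
  rw [neg_neg] at hr
  have hi : ∀ j, ∫ x in ε..(-a), ‖(-1 : ℂ) ^ j * D j (-x)‖ = ∫ x in a..(-ε), ‖D j x‖ := by
    intro j
    simp only [norm_mul, norm_pow, norm_neg, norm_one, one_pow, one_mul]
    rw [intervalIntegral.integral_comp_neg (fun x => ‖D j x‖), neg_neg]
  have := h ε hε0 hε _ hr (by simp [h0]) (by simp [h1]) N (by rwa [hi 0]) (by rwa [hi 4]) j hj (-x)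
    ⟨by linarith [hx.2], by linarith [hx.1]⟩
  simpa using this

end Outer

/-! ### Uniform estimates for the perturbed operators -/

section Uniform

/-- `D 0` represents `u`, satisfies the clamped boundary conditions, and `h = D 4 + q (D 0)`. -/
structure IsClampedSolution (a b : ℝ) (q : ℝ → ℝ) (D : ℕ → ℝ → ℂ) (u h : L2 a b) : Prop where
  sobolev : IsSobolevFour a b D
  coe_eq : ∀ᵐ x ∂(volume.restrict (Ioo a b)), u x = D 0 x
  equation : ∀ᵐ x ∂(volume.restrict (Ioo a b)), h x = D 4 x + (q x : ℂ) * D 0 x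
  left_zero : D 0 a = 0
  left_one : D 1 a = 0
  right_zero : D 0 b = 0
  right_one : D 1 b = 0

theorem exists_isClampedSolution {a b : ℝ} {q : ℝ → ℝ} {u h : L2 a b}
    (hg : (u, h) ∈ (clampedOp a b q).graph) : ∃ D, IsClampedSolution a b q D u h := by
  obtain ⟨D, h1, h2, h3, h4, h5, h6, h7⟩ := mem_clampedOp_graph.1 hg
  exact ⟨D, h1, h2, h3, h4, h5, h6, h7⟩

theorem eq_zero_of_tsupport_subset {f : ℝ → ℝ} (hf : tsupport f ⊆ Icc (-1) 1) {ξ : ℝ}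
    (hξ : 1 < |ξ|) : f ξ = 0 := by
  refine image_eq_zero_of_notMem_tsupport fun h => ?_
  have := abs_le.2 (hf h)
  linarith

variable {Ψ Φ Υ₁ Υ₂ : ℝ → ℝ} (α β γ₁ γ₂ : ℝ)

theorem scaledPotential_eq_zero (hΨ : tsupport Ψ ⊆ Icc (-1) 1) (hΦ : tsupport Φ ⊆ Icc (-1) 1)
    (h₁ : tsupport Υ₁ ⊆ Icc (-1) 1) (h₂ : tsupport Υ₂ ⊆ Icc (-1) 1) {ε x : ℝ} (hε : 0 < ε)
    (hx : ε < |x|) : scaledPotential α β γ₁ γ₂ Ψ Φ Υ₁ Υ₂ ε x = 0 := by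
  have : 1 < |ε⁻¹ * x| := by
    rw [abs_mul, abs_of_pos (inv_pos.2 hε), inv_mul_eq_div, lt_div_iff₀ hε]
    linarith
  simp [scaledPotential, eq_zero_of_tsupport_subset hΨ this, eq_zero_of_tsupport_subset hΦ this,
    eq_zero_of_tsupport_subset h₁ this, eq_zero_of_tsupport_subset h₂ this]

/-- Grouped by powers of ε so that the two weaker profiles and U end up in the bounded remainder r
of the inner problem. -/
theorem scaledPotential_mul (u : ℝ) {ε : ℝ} (hε : 0 < ε) (ξ : ℝ) :
    ε ^ 4 * (u + scaledPotential α β γ₁ γ₂ Ψ Φ Υ₁ Υ₂ ε (ε * ξ)) =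
      α * Ψ ξ + ε * (β * Φ ξ + ε * (γ₁ * Υ₁ ξ + ε * (γ₂ * Υ₂ ξ) + ε ^ 2 * u)) := by
  rw [scaledPotential, inv_mul_cancel_left₀ hε.ne']
  field_simp
  ring

/-- Away from the inner region D 4 = h - U D 0, so ‖u‖ + ‖h‖ controls both L₁ norms that the
one-sided bounds require. -/
theorem exists_outer_bound {a b : ℝ} (ha : a < 0) (hb : 0 < b) {U : ℝ → ℝ}
    (hU : ContinuousOn U (Icc a b)) :
    ∃ C : ℝ, 0 ≤ C ∧ ∀ ε, 0 < ε → ε ≤ b / 2 → ε ≤ -a / 2 → ∀ q : ℝ → ℝ,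
      (∀ x ∈ Ioo a b, ε < |x| → q x = U x) → ∀ D u h, IsClampedSolution a b q D u h →
      (∀ j < 4, ∀ x ∈ Icc ε b, ‖D j x‖ ≤ C * (‖u‖ + ‖h‖)) ∧
      (∀ j < 4, ∀ x ∈ Icc a (-ε), ‖D j x‖ ≤ C * (‖u‖ + ‖h‖)) := by
  obtain ⟨C₁, hC₁, H₁⟩ := exists_outer_bound_right hb
  obtain ⟨C₂, hC₂, H₂⟩ := exists_outer_bound_left ha
  obtain ⟨Q, hQ⟩ := isCompact_Icc.exists_bound_of_continuousOn hU
  have hab : a ≤ b := (ha.trans hb).le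
  have hQ0 : 0 ≤ Q := (norm_nonneg _).trans (hQ a (left_mem_Icc.2 hab))
  set L := √(b - a) with hL
  refine ⟨(C₁ + C₂) * (L * (1 + Q)), by positivity,
    fun ε hε hεb hεa q hq D u h hD => ?_⟩
  set A := ‖u‖ + ‖h‖ with hA
  have hA0 : 0 ≤ A := by positivity
  have hDu : ∫ x in a..b, ‖D 0 x‖ ≤ L * ‖u‖ := by
    refine le_trans (le_of_eq ?_) (L2.integral_norm_le hab u)
    rw [intervalIntegral.integral_of_le hab, intervalIntegral.integral_of_le hab,
      integral_Ioc_eq_integral_Ioo, integral_Ioc_eq_integral_Ioo]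
    refine integral_congr_ae ?_
    filter_upwards [hD.coe_eq] with x hx
    rw [hx]
  have hD0 : ∀ c d, a ≤ c → c ≤ d → d ≤ b → ∫ x in c..d, ‖D 0 x‖ ≤ L * (1 + Q) * A := by
    intro c d hac hcd hdb
    refine (integral_norm_mono hac hcd hdb
      (hD.sobolev.intervalIntegrable (by norm_num) (right_mem_Icc.2 hab))).trans (hDu.trans ?_)
    calc L * ‖u‖ ≤ L * (1 * A) := by gcongr; rw [one_mul, hA]; linarith [norm_nonneg h]
      _ ≤ L * ((1 + Q) * A) := by gcongr; linarith
      _ = _ := by ring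
  have hD4 : ∀ c d, a ≤ c → c ≤ d → d ≤ b → (∀ x ∈ Ioo c d, ε < |x|) →
      ∫ x in c..d, ‖D 4 x‖ ≤ L * (1 + Q) * A := by
    intro c d hac hcd hdb hout
    have hih := (L2.intervalIntegrable h hab).norm
    have hi0 := (hD.sobolev.intervalIntegrable (j := 0) (by norm_num) (right_mem_Icc.2 hab)).norm
    have hsub : uIcc c d ⊆ uIcc a b := by
      rw [uIcc_of_le hcd, uIcc_of_le hab]; exact Icc_subset_Icc hac hdb
    calc ∫ x in c..d, ‖D 4 x‖ ≤ ∫ x in c..d, (‖h x‖ + Q * ‖D 0 x‖) := by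
          rw [intervalIntegral.integral_of_le hcd, intervalIntegral.integral_of_le hcd,
            integral_Ioc_eq_integral_Ioo, integral_Ioc_eq_integral_Ioo]
          refine integral_mono_ae ?_ ?_ ?_
          · exact (((hD.sobolev.mono hac hdb).memLp.integrable (by norm_num))).norm
          · exact ((intervalIntegrable_iff_integrableOn_Ioo_of_le hcd).1
              ((hih.mono_set hsub).add ((hi0.mono_set hsub).const_mul Q)))
          · have := ae_restrict_of_ae_restrict_of_subset (Ioo_subset_Ioo hac hdb) hD.equation
            filter_upwards [this, ae_restrict_mem measurableSet_Ioo] with x hx hxI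
            have hxab : x ∈ Ioo a b := Ioo_subset_Ioo hac hdb hxI
            rw [hq x hxab (hout x hxI)] at hx
            have h1 : D 4 x = h x - U x * D 0 x := by rw [hx]; ring
            rw [h1]
            refine (norm_sub_le _ _).trans ?_
            rw [norm_mul, Complex.norm_real]
            gcongr
            exact hQ x (Ioo_subset_Icc_self hxab)
      _ = (∫ x in c..d, ‖h x‖) + Q * ∫ x in c..d, ‖D 0 x‖ := by
          rw [intervalIntegral.integral_add (hih.mono_set hsub)
            ((hi0.mono_set hsub).const_mul Q), intervalIntegral.integral_const_mul]
      _ ≤ L * ‖h‖ + Q * (L * ‖u‖) := by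
          gcongr
          · exact (integral_norm_mono hac hcd hdb (L2.intervalIntegrable h hab)).trans
              (L2.integral_norm_le hab h)
          · exact (integral_norm_mono hac hcd hdb (hD.sobolev.intervalIntegrable (by norm_num)
              (right_mem_Icc.2 hab))).trans hDu
      _ ≤ _ := by
          rw [hA]
          have h1 : 0 ≤ L * ‖u‖ := by positivity
          have h2 : 0 ≤ L * Q * ‖h‖ := by positivity
          nlinarith
  constructor
  · intro j hj x hx
    refine (H₁ ε hε.le hεb D (hD.sobolev.mono (by linarith) le_rfl) hD.right_zero hD.right_one _
      (hD0 ε b (by linarith) (by linarith) le_rfl)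
      (hD4 ε b (by linarith) (by linarith) le_rfl fun x hx => hx.1.trans_le (le_abs_self x))
      j hj x hx).trans ?_
    calc C₁ * (L * (1 + Q) * A) = C₁ * (L * (1 + Q)) * A := by ring
      _ ≤ _ := by gcongr; linarith
  · intro j hj x hx
    refine (H₂ ε hε.le hεa D (hD.sobolev.mono le_rfl (by linarith)) hD.left_zero hD.left_one _
      (hD0 a (-ε) le_rfl (by linarith) (by linarith))
      (hD4 a (-ε) le_rfl (by linarith) (by linarith) fun x hx => by
        have := hx.2; exact lt_of_lt_of_le (by linarith) (neg_le_abs x))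
      j hj x hx).trans ?_
    calc C₂ * (L * (1 + Q) * A) = C₂ * (L * (1 + Q)) * A := by ring
      _ ≤ _ := by gcongr; linarith

/-- Estimates, uniform in small `ε`, for the solutions of `S_ε u = h`. -/
structure UniformEstimate (a b ε : ℝ) (W : ℕ → ℝ → ℝ) (κ : ℝ) (D : ℕ → ℝ → ℂ) (B : ℝ) : Prop where
  slope : ∀ x ∈ Icc a b, ‖D 1 x‖ ≤ B
  right : ∀ j < 4, ∀ x ∈ Icc ε b, ‖D j x‖ ≤ B
  left : ∀ j < 4, ∀ x ∈ Icc a (-ε), ‖D j x‖ ≤ B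
  zero_right : ‖D 0 ε‖ ≤ B * ε
  zero_left : ‖D 0 (-ε)‖ ≤ B * ε
  one_right : ‖D 1 ε - W 1 1 * D 1 (-ε)‖ ≤ B * ε
  one_left : ‖D 1 (-ε) - W 1 (-1) * D 1 (-ε)‖ ≤ B * ε
  two : ‖W 1 1 * D 2 ε - W 1 (-1) * D 2 (-ε) - κ * D 1 (-ε)‖ ≤ B * ε

/-- The outer bounds at ±ε are the boundary data of the inner problem; its estimates, divided by the
power of ε that each derivative carries, become transition conditions with error O(ε). The field
`one_left` is void at resonance, where W'(-1) = 1, and makes the slope at -ε small when W = 0. -/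
theorem exists_uniform_estimate {a b : ℝ} (ha : a < 0) (hb : 0 < b) {U : ℝ → ℝ}
    (hU : ContinuousOn U (Icc a b)) (hΨ : Continuous Ψ) (hΦ : Continuous Φ)
    (hΥ₁ : Continuous Υ₁) (hΥ₂ : Continuous Υ₂)
    (hΨs : tsupport Ψ ⊆ Icc (-1) 1) (hΦs : tsupport Φ ⊆ Icc (-1) 1)
    (h₁s : tsupport Υ₁ ⊆ Icc (-1) 1) (h₂s : tsupport Υ₂ ⊆ Icc (-1) 1)
    {σ : ℝ} {W : ℕ → ℝ → ℝ}
    (hinj : ∀ W : ℕ → ℝ → ℝ, IsResonantSolution Ψ α W → σ * W 1 (-1) = 0 →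
      ∀ ξ ∈ Icc (-1 : ℝ) 1, W 0 ξ = 0)
    (hW : IsResonantSolution Ψ α W) (hWσ : σ * (1 - W 1 (-1)) = 0) :
    ∃ C ε₀ : ℝ, 0 ≤ C ∧ 0 < ε₀ ∧ ε₀ ≤ b / 2 ∧ ε₀ ≤ -a / 2 ∧ ∀ ε ∈ Ioo 0 ε₀, ∀ D u h,
      IsClampedSolution a b (fun x => U x + scaledPotential α β γ₁ γ₂ Ψ Φ Υ₁ Υ₂ ε x) D u h →
      UniformEstimate a b ε W (β * ∫ ξ in (-1 : ℝ)..1, Φ ξ * W 0 ξ ^ 2) D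
        (C * (‖u‖ + ‖h‖)) := by
  obtain ⟨C₁, hC₁, H₁⟩ := exists_outer_bound ha hb hU
  have hab : a ≤ b := (ha.trans hb).le
  obtain ⟨Q, hQ⟩ := isCompact_Icc.exists_bound_of_continuousOn hU
  have hQ0 : 0 ≤ Q := (norm_nonneg _).trans (hQ a (left_mem_Icc.2 hab))
  obtain ⟨P₁, hP₁⟩ := isCompact_Icc.exists_bound_of_continuousOn
    (s := Icc (-1 : ℝ) 1) (f := fun ξ => γ₁ * Υ₁ ξ) (by fun_prop)
  obtain ⟨P₂, hP₂⟩ := isCompact_Icc.exists_bound_of_continuousOn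
    (s := Icc (-1 : ℝ) 1) (f := fun ξ => γ₂ * Υ₂ ξ) (by fun_prop)
  have hP₁0 : 0 ≤ P₁ := (norm_nonneg _).trans (hP₁ 0 (by norm_num))
  have hP₂0 : 0 ≤ P₂ := (norm_nonneg _).trans (hP₂ 0 (by norm_num))
  obtain ⟨C₂, ε₂, hC₂, hε₂, hε₂1, H₂⟩ := exists_inner_estimate (β := β) hΨ hΦ hinj hW hWσ
    (P := P₁ + P₂ + Q) (by positivity)
  set L := √(b - a) with hL
  have hL0 : 0 ≤ L := Real.sqrt_nonneg _
  refine ⟨C₁ + C₂ * (C₁ + L), min ε₂ (min (b / 2) (-a / 2)), by positivity,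
    lt_min hε₂ (lt_min (by linarith) (by linarith)),
    (min_le_right _ _).trans (min_le_left _ _), (min_le_right _ _).trans (min_le_right _ _),
    fun ε hε D u h hD => ?_⟩
  have hε0 : 0 < ε := hε.1
  have hεε₂ : ε < ε₂ := hε.2.trans_le (min_le_left _ _)
  have hε1 : ε ≤ 1 := hεε₂.le.trans hε₂1
  have hεb : ε ≤ b / 2 := hε.2.le.trans ((min_le_right _ _).trans (min_le_left _ _))
  have hεa : ε ≤ -a / 2 := hε.2.le.trans ((min_le_right _ _).trans (min_le_right _ _))
  set A := ‖u‖ + ‖h‖ with hA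
  have hA0 : 0 ≤ A := by positivity
  set q : ℝ → ℝ := fun x => U x + scaledPotential α β γ₁ γ₂ Ψ Φ Υ₁ Υ₂ ε x with hq
  obtain ⟨hR, hLft⟩ := H₁ ε hε0 hεb hεa q (fun x _ hx => by
    rw [hq]; simp only
    rw [scaledPotential_eq_zero α β γ₁ γ₂ hΨs hΦs h₁s h₂s hε0 hx, add_zero]) D u h hD
  have hmem : ∀ ξ ∈ Icc (-1 : ℝ) 1, ε * ξ ∈ Icc a b := fun ξ hξ =>
    ⟨by nlinarith [hξ.1], by nlinarith [hξ.2]⟩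
  set r : ℝ → ℝ := fun ξ => γ₁ * Υ₁ ξ + ε * (γ₂ * Υ₂ ξ) + ε ^ 2 * U (ε * ξ) with hr
  have hrc : ContinuousOn r (Icc (-1) 1) := by
    have : ContinuousOn (fun ξ => U (ε * ξ)) (Icc (-1) 1) :=
      hU.comp (by fun_prop) hmem
    have h' : ContinuousOn (fun ξ => γ₁ * Υ₁ ξ + ε * (γ₂ * Υ₂ ξ)) (Icc (-1) 1) := by fun_prop
    exact h'.add (continuousOn_const.mul this)
  have hrP : ∀ ξ ∈ Icc (-1 : ℝ) 1, |r ξ| ≤ P₁ + P₂ + Q := by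
    intro ξ hξ
    refine (abs_add_le _ _).trans (add_le_add ((abs_add_le _ _).trans
      (add_le_add (hP₁ ξ hξ) ?_)) ?_)
    · rw [abs_mul, abs_of_pos hε0]
      calc ε * |γ₂ * Υ₂ ξ| ≤ 1 * P₂ := by gcongr; exact hP₂ ξ hξ
        _ = _ := one_mul _
    · rw [abs_mul, abs_of_nonneg (by positivity : 0 ≤ ε ^ 2)]
      calc ε ^ 2 * |U (ε * ξ)| ≤ 1 * Q := by
            gcongr
            · exact pow_le_one₀ hε0.le hε1
            · exact hQ _ (hmem ξ hξ)
        _ = _ := one_mul _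
  set V : ℕ → ℝ → ℂ := fun j ξ => (ε : ℂ) ^ j * D j (ε * ξ) with hV
  have hεV : ∀ j : ℕ, ‖(ε : ℂ) ^ j‖ = ε ^ j := fun j => by
    rw [norm_pow, Complex.norm_real, Real.norm_of_nonneg hε0.le]
  have hDε : IsSobolevFour (ε * (-1)) (ε * 1) D := hD.sobolev.mono (by linarith) (by linarith)
  have hVS : IsSobolevFour (-1) 1 V := hDε.rescale hε0
  set B := (C₁ + L) * A with hB
  have hC₁B : C₁ * A ≤ B := by rw [hB]; gcongr; linarith
  have hεR : ∀ j < 4, ‖V j 1‖ ≤ ε ^ j * B := fun j hj => by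
    simp only [hV, norm_mul, hεV, mul_one]
    gcongr
    exact (hR j hj ε ⟨le_rfl, by linarith⟩).trans hC₁B
  have hεL : ∀ j < 4, ‖V j (-1)‖ ≤ ε ^ j * B := fun j hj => by
    simp only [hV, norm_mul, hεV, mul_neg, mul_one]
    gcongr
    exact (hLft j hj (-ε) ⟨by linarith, le_rfl⟩).trans hC₁B
  -- The factor ε⁴ from four derivatives against ε⁻¹ from the change of variable leaves ε³.
  have hrhs : ∫ ξ in (-1 : ℝ)..1, ‖V 4 ξ + ((α * Ψ ξ + ε * (β * Φ ξ + ε * r ξ) : ℝ) : ℂ) * V 0 ξ‖ ≤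
      ε ^ 3 * B := by
    have e1 : ∀ ξ, ‖V 4 ξ + ((α * Ψ ξ + ε * (β * Φ ξ + ε * r ξ) : ℝ) : ℂ) * V 0 ξ‖ =
        ε ^ 4 * ‖D 4 (ε * ξ) + q (ε * ξ) * D 0 (ε * ξ)‖ := by
      intro ξ
      have e0 : V 4 ξ + ((α * Ψ ξ + ε * (β * Φ ξ + ε * r ξ) : ℝ) : ℂ) * V 0 ξ =
          (ε : ℂ) ^ 4 * (D 4 (ε * ξ) + q (ε * ξ) * D 0 (ε * ξ)) := by
        rw [← scaledPotential_mul α β γ₁ γ₂ (U (ε * ξ)) hε0 ξ]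
        simp only [hV, hq]
        push_cast
        ring
      rw [e0, norm_mul, hεV]
    simp_rw [e1]
    rw [intervalIntegral.integral_const_mul,
      intervalIntegral.integral_comp_mul_left (fun x => ‖D 4 x + q x * D 0 x‖) hε0.ne', smul_eq_mul]
    have e2 : ∫ x in (ε * (-1))..(ε * 1), ‖D 4 x + q x * D 0 x‖ =
        ∫ x in (ε * (-1))..(ε * 1), ‖h x‖ := by
      rw [intervalIntegral.integral_of_le (by linarith), intervalIntegral.integral_of_le
        (by linarith), integral_Ioc_eq_integral_Ioo, integral_Ioc_eq_integral_Ioo]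
      refine integral_congr_ae ?_
      filter_upwards [ae_restrict_of_ae_restrict_of_subset
        (Ioo_subset_Ioo (by linarith) (by linarith)) hD.equation] with x hx
      rw [hx]
    have e3 : ∫ x in (ε * (-1))..(ε * 1), ‖h x‖ ≤ B := by
      refine (integral_norm_mono (by linarith) (by linarith) (by linarith)
        (L2.intervalIntegrable h hab)).trans ((L2.integral_norm_le hab h).trans ?_)
      rw [hB, hA]
      have : 0 ≤ C₁ * (‖u‖ + ‖h‖) := by positivity
      have : 0 ≤ L * ‖u‖ := by positivity
      nlinarith
    rw [e2]
    calc ε ^ 4 * (ε⁻¹ * ∫ x in (ε * (-1))..(ε * 1), ‖h x‖) =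
        ε ^ 3 * ∫ x in (ε * (-1))..(ε * 1), ‖h x‖ := by field_simp
      _ ≤ _ := by gcongr
  have hin : InnerDataLE (fun ξ => α * Ψ ξ + ε * (β * Φ ξ + ε * r ξ)) ε V B :=
    ⟨hVS, hrhs, by simpa using hεL 1 (by norm_num), hεL 2 (by norm_num), hεL 3 (by norm_num),
      hεR 2 (by norm_num), hεR 3 (by norm_num)⟩
  obtain ⟨i0, i1, i2, i3⟩ := H₂ ε ⟨hε0, hεε₂⟩ r hrc hrP V B hin
  have hfin : C₂ * B ≤ (C₁ + C₂ * (C₁ + L)) * A := by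
    have : 0 ≤ C₁ * A := by positivity
    rw [hB]; linarith
  have hfin' : C₁ * A ≤ (C₁ + C₂ * (C₁ + L)) * A := by
    gcongr
    have : 0 ≤ C₂ * (C₁ + L) := by positivity
    linarith
  have hcancel : ∀ (j : ℕ) (z : ℂ) (R : ℝ), ‖(ε : ℂ) ^ j * z‖ ≤ ε ^ j * R → ‖z‖ ≤ R := by
    intro j z R hz
    rw [norm_mul, hεV] at hz
    exact le_of_mul_le_mul_left hz (by positivity)
  refine ⟨fun x hx => ?_, fun j hj x hx => (hR j hj x hx).trans hfin',
    fun j hj x hx => (hLft j hj x hx).trans hfin', ?_, ?_, ?_, ?_, ?_⟩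
  · rcases le_total x (-ε) with h1 | h1
    · exact (hLft 1 (by norm_num) x ⟨hx.1, h1⟩).trans hfin'
    rcases le_total ε x with h2 | h2
    · exact (hR 1 (by norm_num) x ⟨h2, hx.2⟩).trans hfin'
    refine (hcancel 1 _ (C₂ * B) ?_).trans hfin
    have h3 := i1 (x / ε) ⟨by rw [le_div_iff₀ hε0]; linarith, by rw [div_le_iff₀ hε0]; linarith⟩
    simp only [hV] at h3
    rw [mul_div_cancel₀ _ hε0.ne'] at h3
    calc _ ≤ _ := h3
      _ = _ := by ring
  · have h3 := i0 1 (by norm_num)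
    simp only [hV, pow_zero, one_mul, mul_one] at h3
    calc _ ≤ _ := h3
      _ = C₂ * B * ε := by ring
      _ ≤ _ := by gcongr
  · have h3 := i0 (-1) (by norm_num)
    simp only [hV, pow_zero, one_mul, mul_neg, mul_one] at h3
    calc _ ≤ _ := h3
      _ = C₂ * B * ε := by ring
      _ ≤ _ := by gcongr
  · have h3 := i2 1 (by norm_num)
    refine (hcancel 1 _ (C₂ * B * ε) ?_).trans (by gcongr)
    calc _ = ‖V 1 1 - V 1 (-1) * W 1 1‖ := by
          simp only [hV, mul_neg, mul_one]; congr 1; ring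
      _ ≤ _ := h3
      _ = _ := by ring
  · have h3 := i2 (-1) (by norm_num)
    refine (hcancel 1 _ (C₂ * B * ε) ?_).trans (by gcongr)
    calc _ = ‖V 1 (-1) - V 1 (-1) * W 1 (-1)‖ := by
          simp only [hV, mul_neg, mul_one]; congr 1; ring
      _ ≤ _ := h3
      _ = _ := by ring
  · refine (hcancel 2 _ (C₂ * B * ε) ?_).trans (by gcongr)
    calc _ = ‖V 2 1 * W 1 1 - V 2 (-1) * W 1 (-1) -
          ε * ((β * ∫ ξ in (-1 : ℝ)..1, Φ ξ * W 0 ξ ^ 2 : ℝ) : ℂ) * V 1 (-1)‖ := by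
          simp only [hV, mul_neg, mul_one]; congr 1; ring
      _ ≤ _ := i3
      _ = _ := by ring

end Uniform

/-! ### Passage to the limit -/

section Limit

/-- The end ε n moves, so the limit is integrated from the fixed end `b`. Uniform convergence on [ε
n, b] and continuity of `E` at 0 then identify the limits of the traces at ε n. -/
theorem exists_half_limit {b : ℝ} {ε : ℕ → ℝ} (hε0 : ∀ n, 0 < ε n) (hεb : ∀ n, ε n ≤ b)
    (hε : Tendsto ε atTop (𝓝 0)) {D : ℕ → ℕ → ℝ → ℂ} (hD : ∀ n, IsSobolevFour (ε n) b (D n))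
    {F : ℝ → ℂ} (hF : MemLp F 2 (volume.restrict (Ioo 0 b)))
    (h4 : Tendsto (fun n => ∫ x in (ε n)..b, ‖D n 4 x - F x‖) atTop (𝓝 0)) {e : ℕ → ℂ}
    (he : ∀ j < 4, Tendsto (fun n => D n j b) atTop (𝓝 (e j))) {g : ℝ → ℂ}
    (hg : ∀ x ∈ Ioc 0 b, Tendsto (fun n => D n 0 x) atTop (𝓝 (g x))) :
    ∃ E : ℕ → ℝ → ℂ, IsSobolevFour 0 b E ∧ E 4 = F ∧ (∀ j < 4, E j b = e j) ∧
      (∀ j < 4, Tendsto (fun n => D n j (ε n)) atTop (𝓝 (E j 0))) ∧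
      ∀ x ∈ Ioc 0 b, E 0 x = g x := by
  have hb : 0 ≤ b := (hε0 0).le.trans (hεb 0)
  set E := primitiveFour b F e with hE
  have hES : IsSobolevFour 0 b E := isSobolevFour_primitiveFour e (right_mem_Icc.2 hb) hF
  have hE4 : E 4 = F := primitiveFour_four _ _ _
  have hEb : ∀ j < 4, E j b = e j := fun j hj => primitiveFour_base _ _ _ hj
  obtain ⟨δ, hδ, hδE⟩ := exists_uniform_bound_of_tendsto (c := 0) (d := b) (p := b) (c' := ε)
    (fun n => (hε0 n).le) (fun n => right_mem_Icc.2 (hεb n)) hD hES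
    (fun j hj => by rw [hEb j hj]; exact he j hj) (by rwa [hE4])
  refine ⟨E, hES, hE4, hEb, fun j hj => ?_, fun x hx => ?_⟩
  · have h1 : Tendsto (fun n => E j (ε n)) atTop (𝓝 (E j 0)) := by
      have := (hES.continuousOn hj) 0 (left_mem_Icc.2 hb)
      exact this.tendsto.comp (tendsto_nhdsWithin_iff.2
        ⟨hε, Eventually.of_forall fun n => ⟨(hε0 n).le, hεb n⟩⟩)
    have h2 : Tendsto (fun n => D n j (ε n) - E j (ε n)) atTop (𝓝 0) :=
      squeeze_zero_norm (fun n => hδE n j hj (ε n) (left_mem_Icc.2 (hεb n))) hδ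
    simpa using h2.add h1
  · refine tendsto_nhds_unique ?_ (hg x hx)
    have h2 : Tendsto (fun n => D n 0 x - E 0 x) atTop (𝓝 0) := by
      refine squeeze_zero_norm' ?_ hδ
      filter_upwards [hε.eventually (gt_mem_nhds hx.1)] with n hn
      exact hδE n 0 (by norm_num) x ⟨hn.le, hx.2⟩
    simpa using h2.add (tendsto_const_nhds (x := E 0 x))

theorem exists_half_limit_left {a : ℝ} {ε : ℕ → ℝ} (hε0 : ∀ n, 0 < ε n) (hεa : ∀ n, ε n ≤ -a)
    (hε : Tendsto ε atTop (𝓝 0)) {D : ℕ → ℕ → ℝ → ℂ} (hD : ∀ n, IsSobolevFour a (-ε n) (D n))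
    {F : ℝ → ℂ} (hF : MemLp F 2 (volume.restrict (Ioo a 0)))
    (h4 : Tendsto (fun n => ∫ x in a..(-ε n), ‖D n 4 x - F x‖) atTop (𝓝 0)) {e : ℕ → ℂ}
    (he : ∀ j < 4, Tendsto (fun n => D n j a) atTop (𝓝 (e j))) {g : ℝ → ℂ}
    (hg : ∀ x ∈ Ico a 0, Tendsto (fun n => D n 0 x) atTop (𝓝 (g x))) :
    ∃ E : ℕ → ℝ → ℂ, IsSobolevFour a 0 E ∧ E 4 = F ∧ (∀ j < 4, E j a = e j) ∧
      (∀ j < 4, Tendsto (fun n => D n j (-ε n)) atTop (𝓝 (E j 0))) ∧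
      ∀ x ∈ Ico a 0, E 0 x = g x := by
  have hsign : ∀ j : ℕ, (-1 : ℂ) ^ j * (-1) ^ j = 1 := fun j => by
    rw [← mul_pow]; norm_num
  have hFr : MemLp (fun x => F (-x)) 2 (volume.restrict (Ioo 0 (-a))) := by
    have := hF.comp_measurePreserving (measurePreserving_neg_Ioo a 0)
    rwa [neg_zero] at this
  obtain ⟨E, hES, hE4, hEb, hE0, hEg⟩ := exists_half_limit (b := -a) hε0 hεa hε
    (D := fun n j x => (-1) ^ j * D n j (-x)) (F := fun x => F (-x))
    (e := fun j => (-1) ^ j * e j) (g := fun x => g (-x))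
    (fun n => by have := (hD n).reflect; rwa [neg_neg] at this) hFr
    (by
      convert h4 using 2 with n
      have := intervalIntegral.integral_comp_neg (a := ε n) (b := -a) (fun x => ‖D n 4 x - F x‖)
      rw [neg_neg] at this
      rw [← this]
      congr 1
      ext x
      norm_num)
    (fun j hj => by
      simp only [neg_neg]
      exact (he j hj).const_mul _)
    (fun x hx => by
      simpa using hg (-x) ⟨by linarith [hx.2], by linarith [hx.1]⟩)
  refine ⟨fun j x => (-1) ^ j * E j (-x), ?_, ?_, fun j hj => ?_, fun j hj => ?_, fun x hx => ?_⟩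
  · have := hES.reflect
    rwa [neg_neg, neg_zero] at this
  · ext x
    change (-1 : ℂ) ^ 4 * E 4 (-x) = F x
    rw [hE4]
    norm_num
  · change (-1 : ℂ) ^ j * E j (-a) = e j
    rw [hEb j hj, ← mul_assoc, hsign, one_mul]
  · have := (hE0 j hj).const_mul ((-1) ^ j)
    simp only [neg_zero]
    refine this.congr fun n => ?_
    rw [← mul_assoc, hsign, one_mul]
  · have := hEg (-x) ⟨by linarith [hx.2], by linarith [hx.1]⟩
    rw [neg_neg] at this
    simpa using this

/-- The limits of solutions satisfy the coupling conditions at the origin. -/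
theorem exists_coupled_limit {a b : ℝ} (ha : a < 0) (hb : 0 < b) {U : ℝ → ℝ}
    (hU : ContinuousOn U (Icc a b)) {ε : ℕ → ℝ} (hε0 : ∀ n, 0 < ε n) (hεb : ∀ n, ε n ≤ b)
    (hεa : ∀ n, ε n ≤ -a) (hε : Tendsto ε atTop (𝓝 0)) {q : ℕ → ℝ → ℝ}
    (hq : ∀ n, ∀ x ∈ Ioo a b, ε n < |x| → q n x = U x) {D : ℕ → ℕ → ℝ → ℂ} {u h : ℕ → L2 a b}
    (hD : ∀ n, IsClampedSolution a b (q n) (D n) (u n) (h n)) {W : ℕ → ℝ → ℝ} {κ B : ℝ}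
    (hB : ∀ n, UniformEstimate a b (ε n) W κ (D n) B) :
    ∃ φ : ℕ → ℕ, StrictMono φ ∧ ∃ v : L2 a b, Tendsto (fun n => u (φ n)) atTop (𝓝 v) ∧
      ∀ k, Tendsto (fun n => h (φ n)) atTop (𝓝 k) →
        ∃ E E' : ℕ → ℝ → ℂ, IsSobolevFour a 0 E ∧ IsSobolevFour 0 b E' ∧
          (∀ᵐ x ∂(volume.restrict (Ioo a b)), v x = if x < 0 then E 0 x else E' 0 x) ∧
          (∀ᵐ x ∂(volume.restrict (Ioo a b)),
            k x = (if x < 0 then E 4 x else E' 4 x) + (U x : ℂ) * v x) ∧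
          E 0 a = 0 ∧ E 1 a = 0 ∧ E' 0 b = 0 ∧ E' 1 b = 0 ∧
          E 0 0 = 0 ∧ E' 0 0 = 0 ∧ E' 1 0 = W 1 1 * E 1 0 ∧ E 1 0 = W 1 (-1) * E 1 0 ∧
          W 1 1 * E' 2 0 - W 1 (-1) * E 2 0 - κ * E 1 0 = 0 := by
  have hab : a ≤ b := (ha.trans hb).le
  obtain ⟨φ, hφ, v, g, hg, hvg, hunif, hv⟩ := exists_subseq_of_deriv_bound hab
    (fun n => (hD n).sobolev) (fun n => (hD n).coe_eq) (fun n => (hD n).left_zero)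
    (fun n x hx => (hB n).slope x hx)
  have hB0 : 0 ≤ B := (norm_nonneg _).trans ((hB 0).slope a (left_mem_Icc.2 hab))
  -- A second extraction, by compactness in a finite-dimensional space, makes the derivatives at
  -- both outer ends converge.
  obtain ⟨e, -, ψ, hψ, he⟩ := (isCompact_closedBall (0 : Fin 4 → ℂ × ℂ) B).tendsto_subseq
    (x := fun n (j : Fin 4) => (D (φ n) j a, D (φ n) j b)) (fun n => by
      rw [mem_closedBall_zero_iff, pi_norm_le_iff_of_nonneg hB0]
      intro j
      refine max_le ?_ ?_
      · exact (hB (φ n)).left j j.2 a ⟨le_rfl, by linarith [hεa (φ n)]⟩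
      · exact (hB (φ n)).right j j.2 b ⟨hεb (φ n), le_rfl⟩)
  rw [tendsto_pi_nhds] at he
  have hχ : StrictMono (φ ∘ ψ) := hφ.comp hψ
  refine ⟨φ ∘ ψ, hχ, v, hv.comp hψ.tendsto_atTop, fun k hk => ?_⟩
  have hlimu := hv.comp hψ.tendsto_atTop
  have hεχ : Tendsto (fun n => ε (φ (ψ n))) atTop (𝓝 0) := hε.comp hχ.tendsto_atTop
  obtain ⟨Q, hQ⟩ := isCompact_Icc.exists_bound_of_continuousOn hU
  have hQ0 : 0 ≤ Q := (norm_nonneg _).trans (hQ a (left_mem_Icc.2 hab))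
  -- The fourth derivative that the limit equation prescribes on each side of the origin.
  set F : ℝ → ℂ := fun x => k x - U x * g x with hF
  have hFm : MemLp F 2 (volume.restrict (Ioo a b)) := (Lp.memLp k).sub
    (memLp_of_continuousOn ((Complex.continuous_ofReal.comp_continuousOn hU).mul hg))
  have hFi : IntervalIntegrable F volume a b := by
    rw [intervalIntegrable_iff_integrableOn_Ioo_of_le hab]
    exact hFm.integrable (by norm_num)
  -- Off the inner region the equations for `D n` and for the limit have the same potential, so the
  -- L₁ distance of the fourth derivatives is governed by L₂ distances of right-hand sides and
  -- solutions.
  have hbound : ∀ n c d, a ≤ c → c ≤ d → d ≤ b → (∀ x ∈ Ioo c d, ε n < |x|) →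
      ∫ x in c..d, ‖D n 4 x - F x‖ ≤ √(b - a) * ‖h n - k‖ + Q * (√(b - a) * ‖u n - v‖) := by
    intro n c d hac hcd hdb hout
    have hsub : uIcc c d ⊆ uIcc a b := by
      rw [uIcc_of_le hcd, uIcc_of_le hab]; exact Icc_subset_Icc hac hdb
    have hi1 := (L2.intervalIntegrable (h n - k) hab).norm
    have hi2 := (L2.intervalIntegrable (u n - v) hab).norm
    have hi4 : IntervalIntegrable (fun x => ‖D n 4 x - F x‖) volume a b :=
      (((hD n).sobolev.intervalIntegrable le_rfl (right_mem_Icc.2 hab)).sub hFi).norm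
    calc ∫ x in c..d, ‖D n 4 x - F x‖ ≤ ∫ x in c..d, (‖(h n - k) x‖ + Q * ‖(u n - v) x‖) := by
          rw [intervalIntegral.integral_of_le hcd, intervalIntegral.integral_of_le hcd,
            integral_Ioc_eq_integral_Ioo, integral_Ioc_eq_integral_Ioo]
          refine integral_mono_ae ?_ ?_ ?_
          · exact (intervalIntegrable_iff_integrableOn_Ioo_of_le hcd).1 (hi4.mono_set hsub)
          · exact (intervalIntegrable_iff_integrableOn_Ioo_of_le hcd).1
              ((hi1.mono_set hsub).add ((hi2.mono_set hsub).const_mul Q))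
          · have hss := Ioo_subset_Ioo hac hdb
            filter_upwards [ae_restrict_of_ae_restrict_of_subset hss (hD n).equation,
              ae_restrict_of_ae_restrict_of_subset hss (hD n).coe_eq,
              ae_restrict_of_ae_restrict_of_subset hss hvg,
              ae_restrict_of_ae_restrict_of_subset hss (Lp.coeFn_sub (h n) k),
              ae_restrict_of_ae_restrict_of_subset hss (Lp.coeFn_sub (u n) v),
              ae_restrict_mem measurableSet_Ioo] with x h1 h2 h3 h4 h5 hx
            rw [hq n x (hss hx) (hout x hx)] at h1
            have h6 : D n 4 x - F x = (h n - k) x - U x * (u n - v) x := by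
              rw [h4, h5, Pi.sub_apply, Pi.sub_apply, h1, h2, h3, hF]
              ring
            rw [h6]
            refine (norm_sub_le _ _).trans ?_
            rw [norm_mul, Complex.norm_real]
            gcongr
            exact hQ x (Ioo_subset_Icc_self (hss hx))
      _ = (∫ x in c..d, ‖(h n - k) x‖) + Q * ∫ x in c..d, ‖(u n - v) x‖ := by
          rw [intervalIntegral.integral_add (hi1.mono_set hsub)
            ((hi2.mono_set hsub).const_mul Q), intervalIntegral.integral_const_mul]
      _ ≤ _ := by
          gcongr
          · exact (integral_norm_mono hac hcd hdb (L2.intervalIntegrable _ hab)).trans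
              (L2.integral_norm_le hab _)
          · exact (integral_norm_mono hac hcd hdb (L2.intervalIntegrable _ hab)).trans
              (L2.integral_norm_le hab _)
  have hzero : Tendsto (fun n => √(b - a) * ‖h (φ (ψ n)) - k‖ +
      Q * (√(b - a) * ‖u (φ (ψ n)) - v‖)) atTop (𝓝 0) := by
    have h1 := (tendsto_iff_norm_sub_tendsto_zero.1 hk).const_mul (√(b - a))
    have h2 := ((tendsto_iff_norm_sub_tendsto_zero.1 hlimu).const_mul (√(b - a))).const_mul Q
    simpa using h1.add h2
  have hptw : ∀ x ∈ Icc a b, Tendsto (fun n => D (φ (ψ n)) 0 x) atTop (𝓝 (g x)) := fun x hx =>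
    (hunif.tendsto_at hx).comp hψ.tendsto_atTop
  obtain ⟨E', hE', hE'4, hE'b, hE'0, hE'g⟩ := exists_half_limit (b := b)
    (fun n => hε0 (φ (ψ n))) (fun n => hεb _) hεχ (D := fun n => D (φ (ψ n)))
    (fun n => (hD _).sobolev.mono (by linarith [hε0 (φ (ψ n))]) le_rfl)
    (hFm.mono_measure (Measure.restrict_mono (Ioo_subset_Ioo ha.le le_rfl) le_rfl))
    (squeeze_zero (fun n => intervalIntegral.integral_nonneg (hεb _) fun _ _ => norm_nonneg _)
      (fun n => hbound (φ (ψ n)) _ b (by linarith [hε0 (φ (ψ n))]) (hεb _) le_rfl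
        fun x hx => hx.1.trans_le (le_abs_self x)) hzero)
    (e := fun j => if hj : j < 4 then (e ⟨j, hj⟩).2 else 0)
    (fun j hj => by
      rw [dif_pos hj]
      exact (Prod.tendsto_iff _ _).1 (he ⟨j, hj⟩) |>.2)
    (fun x hx => hptw x ⟨by linarith [hx.1], hx.2⟩)
  obtain ⟨E, hE, hE4, hEa, hE0, hEg⟩ := exists_half_limit_left (a := a)
    (fun n => hε0 (φ (ψ n))) (fun n => hεa _) hεχ (D := fun n => D (φ (ψ n)))
    (fun n => (hD _).sobolev.mono le_rfl (by linarith [hε0 (φ (ψ n))]))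
    (hFm.mono_measure (Measure.restrict_mono (Ioo_subset_Ioo le_rfl hb.le) le_rfl))
    (squeeze_zero (fun n => intervalIntegral.integral_nonneg (by linarith [hεa (φ (ψ n))])
      fun _ _ => norm_nonneg _)
      (fun n => hbound (φ (ψ n)) a _ le_rfl (by linarith [hεa (φ (ψ n))])
        (by linarith [hε0 (φ (ψ n))]) fun x hx => by
          exact lt_of_lt_of_le (by linarith [hx.2]) (neg_le_abs x)) hzero)
    (e := fun j => if hj : j < 4 then (e ⟨j, hj⟩).1 else 0)
    (fun j hj => by
      rw [dif_pos hj]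
      exact (Prod.tendsto_iff _ _).1 (he ⟨j, hj⟩) |>.1)
    (fun x hx => hptw x ⟨hx.1, by linarith [hx.2]⟩)
  -- Each defect in the transition conditions is at most B ε and so disappears in the limit.
  have hz : ∀ {w : ℕ → ℂ} {l : ℂ}, Tendsto w atTop (𝓝 l) →
      (∀ n : ℕ, ‖w n‖ ≤ B * ε (φ (ψ n))) → l = 0 := fun hw hb =>
    tendsto_nhds_unique hw (squeeze_zero_norm hb (by simpa using hεχ.const_mul B))
  have hconst : ∀ {w : ℕ → ℂ} {l : ℂ}, Tendsto w atTop (𝓝 l) → (∀ n, w n = 0) → l = 0 :=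
    fun hw h0 => tendsto_nhds_unique hw (tendsto_const_nhds.congr fun n => (h0 n).symm)
  have hEaj : ∀ j < 4, Tendsto (fun n => D (φ (ψ n)) j a) atTop (𝓝 (E j a)) := fun j hj => by
    rw [hEa j hj, dif_pos hj]
    exact (Prod.tendsto_iff _ _).1 (he ⟨j, hj⟩) |>.1
  have hE'bj : ∀ j < 4, Tendsto (fun n => D (φ (ψ n)) j b) atTop (𝓝 (E' j b)) := fun j hj => by
    rw [hE'b j hj, dif_pos hj]
    exact (Prod.tendsto_iff _ _).1 (he ⟨j, hj⟩) |>.2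
  refine ⟨E, E', hE, hE', ?_, ?_, hconst (hEaj 0 (by norm_num)) fun n => (hD _).left_zero,
    hconst (hEaj 1 (by norm_num)) fun n => (hD _).left_one,
    hconst (hE'bj 0 (by norm_num)) fun n => (hD _).right_zero,
    hconst (hE'bj 1 (by norm_num)) fun n => (hD _).right_one,
    hz (hE0 0 (by norm_num)) fun n => (hB _).zero_left,
    hz (hE'0 0 (by norm_num)) fun n => (hB _).zero_right, ?_, ?_, ?_⟩
  · filter_upwards [hvg, ae_restrict_mem measurableSet_Ioo,
      ae_restrict_of_ae (Measure.ae_ne volume 0)] with x hx hxI hx0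
    rw [hx]
    split_ifs with hlt
    · exact (hEg x ⟨hxI.1.le, hlt⟩).symm
    · exact (hE'g x ⟨lt_of_le_of_ne (not_lt.1 hlt) (Ne.symm hx0), hxI.2.le⟩).symm
  · filter_upwards [hvg] with x hx
    rw [hE4, hE'4, ite_self, hx, hF]
    ring
  · refine sub_eq_zero.1 (hz ((hE'0 1 (by norm_num)).sub
      ((hE0 1 (by norm_num)).const_mul ((W 1 1 : ℝ) : ℂ))) fun n => (hB _).one_right)
  · refine sub_eq_zero.1 (hz ((hE0 1 (by norm_num)).sub
      ((hE0 1 (by norm_num)).const_mul ((W 1 (-1) : ℝ) : ℂ))) fun n => (hB _).one_left)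
  · exact hz ((((hE'0 2 (by norm_num)).const_mul ((W 1 1 : ℝ) : ℂ)).sub
      ((hE0 2 (by norm_num)).const_mul ((W 1 (-1) : ℝ) : ℂ))).sub
      ((hE0 1 (by norm_num)).const_mul (κ : ℂ))) fun n => (hB _).two

end Limit

/-! ### Graph convergence to the limit operator, and symmetry of the limit operator. -/

section LimitOperator

variable {a b α β γ₁ γ₂ : ℝ} {U Ψ Φ Υ₁ Υ₂ : ℝ → ℝ}

theorem IsResonantSolution.smul {W : ℕ → ℝ → ℝ} (h : IsResonantSolution Ψ α W) (r : ℝ) :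
    IsResonantSolution Ψ α (r • W) where
  sobolev := h.sobolev.smul r
  equation := by
    filter_upwards [h.equation] with ξ hξ
    simp only [Pi.smul_apply, smul_eq_mul]
    linear_combination r * hξ
  left := by simp [h.left]
  right := by simp [h.right]

theorem IsResonantSolution.zero : IsResonantSolution Ψ α 0 where
  sobolev := IsSobolevFour.zero
  equation := by simp
  left := by simp
  right := by simp

theorem resonantEigenfunction_spec (h : α ∈ resonantSet Ψ) :
    IsResonantEigenfunction Ψ α (resonantEigenfunction Ψ α) := by
  rw [resonantEigenfunction, dif_pos h]
  exact h.choose_spec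

theorem UniformEstimate.mono {ε κ B B' : ℝ} {W : ℕ → ℝ → ℝ} {D : ℕ → ℝ → ℂ} (hε : 0 ≤ ε)
    (h : UniformEstimate a b ε W κ D B) (hB : B ≤ B') : UniformEstimate a b ε W κ D B' where
  slope x hx := (h.slope x hx).trans hB
  right j hj x hx := (h.right j hj x hx).trans hB
  left j hj x hx := (h.left j hj x hx).trans hB
  zero_right := h.zero_right.trans (by gcongr)
  zero_left := h.zero_left.trans (by gcongr)
  one_right := h.one_right.trans (by gcongr)
  one_left := h.one_left.trans (by gcongr)
  two := h.two.trans (by gcongr)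

/-- A solution of the resonance problem, normalised by `w'(-1) = 1` if there is a nonzero one, such
that `w'(-1) = σ` singles it out. -/
theorem exists_normalized_solution (hα : α ∈ resonantSet Ψ → IsNondegenerate Ψ α) :
    ∃ (σ : ℝ) (W : ℕ → ℝ → ℝ), IsResonantSolution Ψ α W ∧ σ * (1 - W 1 (-1)) = 0 ∧
      (∀ V : ℕ → ℝ → ℝ, IsResonantSolution Ψ α V → σ * V 1 (-1) = 0 →
        ∀ ξ ∈ Icc (-1 : ℝ) 1, V 0 ξ = 0) ∧
      (α ∈ resonantSet Ψ → W 1 (-1) = 1 ∧ W 1 1 = theta Ψ α ∧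
        ∀ Φ : ℝ → ℝ, ∫ ξ in (-1 : ℝ)..1, Φ ξ * W 0 ξ ^ 2 = vartheta Ψ Φ α) ∧
      (α ∉ resonantSet Ψ → W = 0) := by
  by_cases h : α ∈ resonantSet Ψ
  · set w := resonantEigenfunction Ψ α with hw
    have hs := resonantEigenfunction_spec h
    obtain ⟨h1, h2⟩ := hα h _ hs
    have hl : w 1 (-1) ≠ 0 := left_ne_zero_of_mul h2
    -- Simplicity gives V = c w for every solution, and V'(-1) = 0 forces c = 0 because w'(-1) ≠ 0.
    refine ⟨1, (w 1 (-1))⁻¹ • w, hs.1.smul _, ?_, fun V hV hV1 ξ hξ => ?_, fun _ => ⟨?_, ?_, ?_⟩,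
      fun h' => absurd h h'⟩
    · simp [hl]
    · obtain ⟨c, hc⟩ := h1 V hV
      have := hV.sobolev.eqOn_of_ae_eq (hs.1.smul c).sobolev (by norm_num)
        (ae_restrict_Ioo_of_forall fun x hx => by
          simpa using hc x (Ioo_subset_Icc_self hx)) (j := 1) (by norm_num)
        (left_mem_Icc.2 (by norm_num : (-1 : ℝ) ≤ 1))
      rw [one_mul] at hV1
      rw [hV1] at this
      have hc0 : c = 0 := by
        have h0 : c * w 1 (-1) = 0 := this.symm
        exact (mul_eq_zero.1 h0).resolve_right hl
      rw [hc ξ hξ, hc0, zero_mul]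
    · simp [hl]
    · simp [theta, ← hw, div_eq_inv_mul]
    · intro Φ
      rw [vartheta]
      congr 1
      ext ξ
      simp [← hw, div_eq_inv_mul]
  -- Off resonance every solution vanishes, so no slope condition is needed.
  · refine ⟨0, 0, IsResonantSolution.zero, by simp, fun V hV _ ξ hξ => ?_, fun h' => absurd h' h,
      fun _ => rfl⟩
    by_contra h0
    exact h ⟨V, hV, ξ, hξ, h0⟩

/-- The perturbed operators converge to the limit operator in the sense of graphs, with
precompactness of the first components. -/
theorem exists_subseq_mem_limitOp_graph (ha : a < 0) (hb : 0 < b) (hU : ContinuousOn U (Icc a b))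
    (hΨ : Continuous Ψ) (hΦ : Continuous Φ) (hΥ₁ : Continuous Υ₁) (hΥ₂ : Continuous Υ₂)
    (hΨs : tsupport Ψ ⊆ Icc (-1) 1) (hΦs : tsupport Φ ⊆ Icc (-1) 1)
    (h₁s : tsupport Υ₁ ⊆ Icc (-1) 1) (h₂s : tsupport Υ₂ ⊆ Icc (-1) 1)
    (hα : α ∈ resonantSet Ψ → IsNondegenerate Ψ α) {ε : ℕ → ℝ} (hε : Tendsto ε atTop (𝓝[>] 0))
    {u h : ℕ → L2 a b} {M : ℝ}
    (hg : ∀ n, (u n, h n) ∈ (perturbedOp a b U α β γ₁ γ₂ Ψ Φ Υ₁ Υ₂ (ε n)).graph)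
    (hM : ∀ n, ‖u n‖ + ‖h n‖ ≤ M) :
    ∃ φ : ℕ → ℕ, StrictMono φ ∧ ∃ v : L2 a b, Tendsto (fun n => u (φ n)) atTop (𝓝 v) ∧
      ∀ k, Tendsto (fun n => h (φ n)) atTop (𝓝 k) →
        (v, k) ∈ (limitOp a b U α β Ψ Φ).graph := by
  obtain ⟨σ, W, hW, hWσ, hinj, hres, hnon⟩ := exists_normalized_solution hα
  obtain ⟨C, ε₀, hC, hε₀, hε₀b, hε₀a, hest⟩ := exists_uniform_estimate (γ₁ := γ₁) (γ₂ := γ₂)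
    (α := α) (β := β) ha hb hU hΨ hΦ hΥ₁ hΥ₂ hΨs hΦs h₁s h₂s hinj hW hWσ
  -- The uniform estimates hold for small ε only; the sequence is shifted by `N` to start there.
  obtain ⟨N, hN⟩ := eventually_atTop.1 (hε.eventually (Ioo_mem_nhdsGT hε₀))
  have hN' : ∀ n, ε (n + N) ∈ Ioo 0 ε₀ := fun n => hN _ (by omega)
  choose D hD using fun n => exists_isClampedSolution (hg n)
  obtain ⟨φ, hφ, v, hv, hk⟩ := exists_coupled_limit ha hb hU (ε := fun n => ε (n + N))
    (fun n => (hN' n).1) (fun n => by linarith [(hN' n).2]) (fun n => by linarith [(hN' n).2])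
    ((tendsto_add_atTop_iff_nat N).2 (hε.mono_right nhdsWithin_le_nhds))
    (q := fun n x => U x + scaledPotential α β γ₁ γ₂ Ψ Φ Υ₁ Υ₂ (ε (n + N)) x)
    (fun n x _ hx => by
      rw [scaledPotential_eq_zero α β γ₁ γ₂ hΨs hΦs h₁s h₂s (hN' n).1 hx, add_zero])
    (fun n => hD (n + N)) (B := C * M)
    (fun n => (hest _ (hN' n) _ _ _ (hD (n + N))).mono (hN' n).1.le (by gcongr; exact hM _))
  refine ⟨fun n => φ n + N, fun m n hmn => by simpa using hφ hmn, v, hv, fun k hk' => ?_⟩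
  obtain ⟨E, E', hE, hE', h1, h2, e1, e2, e3, e4, c1, c2, c3, c4, c5⟩ := hk k hk'
  have h2' : ∀ᵐ x ∂(volume.restrict (Ioo a b)),
      k x = (if x < 0 then E 4 x else E' 4 x) + (U x : ℂ) * v x := h2
  by_cases hr : α ∈ resonantSet Ψ
  · obtain ⟨w1, w2, w3⟩ := hres hr
    rw [limitOp, if_pos hr, coupledOp_graph ha hb]
    refine ⟨E, E', hE, hE', h1, h2', e1, e2, e3, e4, c1, c2, ?_, ?_⟩
    · change E' 1 0 - (theta Ψ α : ℂ) * E 1 0 = 0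
      rw [c3, w2, sub_self]
    · change (theta Ψ α : ℂ) * E' 2 0 - E 2 0 - ((β * vartheta Ψ Φ α : ℝ) : ℂ) * E 1 0 = 0
      rw [w1, w2, w3] at c5
      simpa using c5
  · have hW0 := hnon hr
    rw [limitOp, if_neg hr, coupledOp_graph ha hb]
    refine ⟨E, E', hE, hE', h1, h2', e1, e2, e3, e4, c1, ?_, c2, ?_⟩
    · change E 1 0 = 0
      rw [c4, hW0]
      simp
    · change E' 1 0 = 0
      rw [c3, hW0]
      simp

/-- Green's formula on both sides of the origin. -/
theorem isSymmetricOp_coupledOp (ha : a < 0) (hb : 0 < b)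
    {K : Submodule ℂ ((Fin 4 → ℂ) × (Fin 4 → ℂ))}
    (hK : ∀ v ∈ K, ∀ w ∈ K,
      (v.2 3 * star (w.2 0) - v.2 2 * star (w.2 1) + v.2 1 * star (w.2 2) - v.2 0 * star (w.2 3)) =
      (v.1 3 * star (w.1 0) - v.1 2 * star (w.1 1) + v.1 1 * star (w.1 2) -
        v.1 0 * star (w.1 3))) :
    IsSymmetricOp (coupledOp a b U K) := by
  have hab : a ≤ b := (ha.trans hb).le
  intro p hp p' hp'
  rw [coupledOp_graph ha hb] at hp hp'
  obtain ⟨D, E, hD, hE, h1, h2, e1, e2, e3, e4, hC⟩ := hp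
  obtain ⟨D', E', hD', hE', h1', h2', e1', e2', e3', e4', hC'⟩ := hp'
  set g : ℝ → ℂ := fun x => (starRingEnd ℂ) (D 4 x) * D' 0 x - (starRingEnd ℂ) (D 0 x) * D' 4 x
    with hgdef
  set g' : ℝ → ℂ := fun x => (starRingEnd ℂ) (E 4 x) * E' 0 x - (starRingEnd ℂ) (E 0 x) * E' 4 x
    with hgdef'
  have hi1 : IntervalIntegrable (fun x => (starRingEnd ℂ) (D 4 x) * D' 0 x) volume a 0 :=
    hD.conj.mul_intervalIntegrable hD' le_rfl (by norm_num) ha.le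
  have hi2 : IntervalIntegrable (fun x => (starRingEnd ℂ) (D 0 x) * D' 4 x) volume a 0 := by
    simp_rw [mul_comm _ (D' 4 _)]
    exact hD'.mul_intervalIntegrable hD.conj le_rfl (by norm_num) ha.le
  have hi3 : IntervalIntegrable (fun x => (starRingEnd ℂ) (E 4 x) * E' 0 x) volume 0 b :=
    hE.conj.mul_intervalIntegrable hE' le_rfl (by norm_num) hb.le
  have hi4 : IntervalIntegrable (fun x => (starRingEnd ℂ) (E 0 x) * E' 4 x) volume 0 b := by
    simp_rw [mul_comm _ (E' 4 _)]
    exact hE'.mul_intervalIntegrable hE.conj le_rfl (by norm_num) hb.le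
  rw [← sub_eq_zero, L2.inner_sub_inner hab p.1 p'.1 p.2 p'.2
    (f := fun x => if x < 0 then g x else g' x)]
  · have k1 : EqOn (fun x => if x < 0 then g x else g' x) g (Ioo a 0) := fun x hx => if_pos hx.2
    have k2 : EqOn (fun x => if x < 0 then g x else g' x) g' (Ioo 0 b) := fun x hx =>
      if_neg (not_lt.2 hx.1.le)
    have i1 : IntervalIntegrable (fun x => if x < 0 then g x else g' x) volume a 0 := by
      rw [intervalIntegrable_iff_integrableOn_Ioo_of_le ha.le]
      exact ((intervalIntegrable_iff_integrableOn_Ioo_of_le ha.le).1 (hi1.sub hi2)).congr_fun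
        k1.symm measurableSet_Ioo
    have i2 : IntervalIntegrable (fun x => if x < 0 then g x else g' x) volume 0 b := by
      rw [intervalIntegrable_iff_integrableOn_Ioo_of_le hb.le]
      exact ((intervalIntegrable_iff_integrableOn_Ioo_of_le hb.le).1 (hi3.sub hi4)).congr_fun
        k2.symm measurableSet_Ioo
    have j1 : ∫ x in a..0, (if x < 0 then g x else g' x) = ∫ x in a..0, g x := by
      rw [intervalIntegral.integral_of_le ha.le, intervalIntegral.integral_of_le ha.le,
        integral_Ioc_eq_integral_Ioo, integral_Ioc_eq_integral_Ioo]
      exact setIntegral_congr_fun measurableSet_Ioo k1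
    have j2 : ∫ x in (0 : ℝ)..b, (if x < 0 then g x else g' x) = ∫ x in (0 : ℝ)..b, g' x := by
      rw [intervalIntegral.integral_of_le hb.le, intervalIntegral.integral_of_le hb.le,
        integral_Ioc_eq_integral_Ioo, integral_Ioc_eq_integral_Ioo]
      exact setIntegral_congr_fun measurableSet_Ioo k2
    rw [← intervalIntegral.integral_add_adjacent_intervals i1 i2, j1, j2,
      intervalIntegral.integral_sub hi1 hi2, intervalIntegral.integral_sub hi3 hi4,
      hD.conj.green hD' ha.le, hE.conj.green hE' hb.le]
    -- Only the traces at the origin are left, and the hypothesis on `K` equates the boundary forms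
    -- of the two sides.
    have := hK _ hC' _ hC
    simp only [e1, e2, e3, e4, e1', e2', e3', e4', map_zero, zero_mul, mul_zero, sub_zero, add_zero]
    change E' 3 0 * (starRingEnd ℂ) (E 0 0) - E' 2 0 * (starRingEnd ℂ) (E 1 0) +
      E' 1 0 * (starRingEnd ℂ) (E 2 0) - E' 0 0 * (starRingEnd ℂ) (E 3 0) =
      D' 3 0 * (starRingEnd ℂ) (D 0 0) - D' 2 0 * (starRingEnd ℂ) (D 1 0) +
      D' 1 0 * (starRingEnd ℂ) (D 2 0) - D' 0 0 * (starRingEnd ℂ) (D 3 0) at this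
    linear_combination this
  · filter_upwards [h1, h2, h1', h2'] with x k1 k2 k3 k4
    rw [k2, k4, k1, k3, hgdef, hgdef']
    split_ifs
    all_goals
      simp only [map_add, map_mul, Complex.conj_ofReal]
      ring

/-- When f and g vanish at ±0 the boundary form reduces to products of first and second derivatives.
The resonant conditions make it the same on both sides: θ and κ are real, so the two κ terms cancel.
In the clamped case it is zero. -/
theorem isSymmetricOp_limitOp (ha : a < 0) (hb : 0 < b) :
    IsSymmetricOp (limitOp a b U α β Ψ Φ) := by
  rw [limitOp]
  split_ifs
  · refine isSymmetricOp_coupledOp ha hb ?_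
    rintro v ⟨v1, v2, v3, v4⟩ w ⟨w1, w2, w3, w4⟩
    set θ := theta Ψ α
    set κ := β * vartheta Ψ Φ α
    have w3' : star (w.2 1) = θ * star (w.1 1) := by
      rw [sub_eq_zero.1 w3]; simp
    have w4' : θ * star (w.2 2) - star (w.1 2) = κ * star (w.1 1) := by
      have := congrArg star (sub_eq_zero.1 w4)
      simpa using this
    rw [v1, v2, w1, w2, w3', sub_eq_zero.1 v3, star_zero]
    linear_combination v.1 1 * w4' - star (w.1 1) * v4
  · refine isSymmetricOp_coupledOp ha hb ?_
    rintro v ⟨v1, v2, v3, v4⟩ w ⟨w1, w2, w3, w4⟩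
    simp [*]

end LimitOperator

/-! ### Bounds for the eigenvalues -/

section EigenvalueBounds

variable {a b : ℝ} {q q' : ℝ → ℝ}

theorem IsEigenvalueEnumeration.exists_clamped_eigenbasis (hab : a < b)
    (hq : ContinuousOn q (Icc a b)) {lam : ℕ → ℝ}
    (hlam : IsEigenvalueEnumeration (clampedOp a b q) lam) :
    ∃ e : HilbertBasis ℕ ℂ (L2 a b), ∀ k, (e k, (lam k : ℂ) • e k) ∈ (clampedOp a b q).graph :=
  exists_eigenbasis (isSymmetricOp_clampedOp hab.le) (hasCompactResolvent_clampedOp hab hq) hlam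

/-- Eigenvalues depend on the potential in a Lipschitz way. -/
theorem eigenvalue_le_add (hab : a < b) (hq : ContinuousOn q (Icc a b))
    (hq' : ContinuousOn q' (Icc a b)) {lam lam' : ℕ → ℝ}
    (hlam : IsEigenvalueEnumeration (clampedOp a b q) lam)
    (hlam' : IsEigenvalueEnumeration (clampedOp a b q') lam') {η : ℝ}
    (hη : ∀ x ∈ Icc a b, |q' x - q x| ≤ η) (k : ℕ) : lam' k ≤ lam k + η := by
  obtain ⟨e, he⟩ := hlam.exists_clamped_eigenbasis hab hq
  obtain ⟨e', he'⟩ := hlam'.exists_clamped_eigenbasis hab hq'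
  obtain ⟨W, hWf, hWk, hW⟩ := exists_spectral_subspace hlam.monotone e he k
  obtain ⟨M, hM, hMη⟩ := exists_mulOp (hq'.sub hq)
  refine eigenvalue_le (isSymmetricOp_clampedOp hab.le) hlam'.monotone e' he' W (by omega)
    fun u hu => ?_
  obtain ⟨h, hg, hle⟩ := hW u hu
  refine ⟨h + M u, clampedOp_graph_add (r := fun x => q' x - q x) (fun x _ => by ring)
    (hM u) hg, ?_⟩
  rw [inner_add_left, Complex.add_re, add_mul]
  refine add_le_add hle ?_
  calc (inner ℂ (M u) u).re ≤ ‖M u‖ * ‖u‖ := re_inner_le_norm (𝕜 := ℂ) _ _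
    _ ≤ (η * ‖u‖) * ‖u‖ := by gcongr; exact hMη η hη u
    _ = η * ‖u‖ ^ 2 := by ring

theorem abs_eigenvalue_sub_le (hab : a < b) (hq : ContinuousOn q (Icc a b))
    (hq' : ContinuousOn q' (Icc a b)) {lam lam' : ℕ → ℝ}
    (hlam : IsEigenvalueEnumeration (clampedOp a b q) lam)
    (hlam' : IsEigenvalueEnumeration (clampedOp a b q') lam') {η : ℝ}
    (hη : ∀ x ∈ Icc a b, |q' x - q x| ≤ η) (k : ℕ) : |lam' k - lam k| ≤ η := by
  have h1 := eigenvalue_le_add hab hq hq' hlam hlam' hη k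
  have h2 := eigenvalue_le_add hab hq' hq hlam' hlam
    (fun x hx => by rw [abs_sub_comm]; exact hη x hx) k
  rw [abs_le]
  constructor <;> linarith

/-- Compact support in the open interval makes the clamped conditions automatic, and it hides the
potential outside the ball from this test function. -/
theorem exists_bump_mem_graph (q : ℝ → ℝ) (hq : ContinuousOn q (Icc a b)) {c r : ℝ} (hr : 0 < r)
    (hcr : Metric.closedBall c r ⊆ Ioo a b) :
    ∃ u h : L2 a b, u ≠ 0 ∧ (u, h) ∈ (clampedOp a b q).graph ∧
      ∀ᵐ x ∂(volume.restrict (Ioo a b)), x ∉ Metric.ball c r → u x = 0 := by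
  let f : ContDiffBump c := ⟨r / 2, r, by positivity, by linarith⟩
  have hc : c ∈ Ioo a b := hcr (Metric.mem_closedBall_self hr.le)
  have hD : IsSobolevFour a b (fun j => iteratedDeriv j f) := by
    refine isSobolevFour_of_hasDerivAt (fun j _ x => ?_)
      (ContDiff.continuous_iteratedDeriv' 4 (f.contDiff (n := 4)))
    have := (f.contDiff (n := (j + 1 : ℕ))).differentiable_iteratedDeriv j
      (by exact_mod_cast Nat.lt_succ_self j)
    rw [iteratedDeriv_succ]
    exact (this x).hasDerivAt
  have hD' := hD.ofReal
  have hz : ∀ j, ∀ x ∉ Metric.closedBall c r, iteratedDeriv j f x = 0 := by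
    intro j x hx
    have h1 : (f : ℝ → ℝ) =ᶠ[𝓝 x] fun _ => 0 := by
      filter_upwards [Metric.isClosed_closedBall.isOpen_compl.mem_nhds hx] with y hy
      exact f.zero_of_le_dist (not_le.1 (fun h => hy h)).le
    rw [h1.iteratedDeriv_eq j]
    simp
  have hm : MemLp (fun x => ((f x : ℝ) : ℂ)) 2 (volume.restrict (Ioo a b)) :=
    memLp_of_continuousOn (Complex.continuous_ofReal.comp f.continuous).continuousOn
  have hm' : MemLp (fun x => ((iteratedDeriv 4 f x : ℝ) : ℂ) + (q x : ℂ) * (f x : ℂ)) 2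
      (volume.restrict (Ioo a b)) := hD'.memLp.add
    (memLp_of_continuousOn ((Complex.continuous_ofReal.comp_continuousOn hq).mul
      (Complex.continuous_ofReal.comp f.continuous).continuousOn))
  have ha : a ∉ Metric.closedBall c r := fun h => lt_irrefl _ (hcr h).1
  have hb : b ∉ Metric.closedBall c r := fun h => lt_irrefl _ (hcr h).2
  refine ⟨hm.toLp _, hm'.toLp _, fun h0 => ?_, mem_clampedOp_graph.2 ⟨_, hD', ?_, ?_, ?_⟩, ?_⟩
  · have h1 : ∀ᵐ x ∂(volume.restrict (Ioo a b)), ((f x : ℝ) : ℂ) = (fun _ => (0 : ℂ)) x := by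
      filter_upwards [hm.coeFn_toLp, (Lp.eq_zero_iff_ae_eq_zero).1 h0] with x hx hx'
      rw [← hx, hx']
      rfl
    have h2 := Measure.eqOn_Icc_of_ae_eq volume (hc.1.trans hc.2).ne
      (by rw [← Measure.restrict_congr_set Ioo_ae_eq_Icc]; exact h1)
      (Complex.continuous_ofReal.comp f.continuous).continuousOn continuousOn_const
      (Ioo_subset_Icc_self hc)
    have h3 : f c = 1 := f.one_of_mem_closedBall (Metric.mem_closedBall_self (by positivity))
    simp [h3] at h2
  · filter_upwards [hm.coeFn_toLp] with x hx
    simpa using hx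
  · filter_upwards [hm'.coeFn_toLp] with x hx
    simpa using hx
  · simp only [hz _ _ ha, hz _ _ hb]
    simp
  · filter_upwards [hm.coeFn_toLp] with x hx hxb
    rw [hx, f.zero_of_le_dist (not_lt.1 hxb)]
    simp

/-- Test functions supported away from the origin bound the eigenvalues of all operators that
differ from a given one only near the origin. -/
theorem exists_eigenvalue_upper_bound (ha : a < 0) (hb : 0 < b) (hq : ContinuousOn q (Icc a b))
    (k : ℕ) : ∃ Λ : ℝ, ∀ q' : ℝ → ℝ, ContinuousOn q' (Icc a b) →
      (∀ x ∈ Ioo a b, b / 2 < |x| → q' x = q x) → ∀ lam : ℕ → ℝ,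
      IsEigenvalueEnumeration (clampedOp a b q') lam → lam k ≤ Λ := by
  -- The balls with centres b/2 + s(i + 1), i ≤ k, and radius s/3 are disjoint and lie in (b/2, b).
  set s : ℝ := b / 2 / (k + 2) with hs
  have hs0 : 0 < s := by positivity
  have hsb : s * (k + 2) = b / 2 := by rw [hs]; field_simp
  have hik : ∀ i : Fin (k + 1), ((i : ℕ) : ℝ) ≤ k := fun i =>
    by exact_mod_cast Nat.lt_succ_iff.1 i.2
  have hball : ∀ i : Fin (k + 1),
      Metric.closedBall (b / 2 + s * (i + 1)) (s / 3) ⊆ Ioo (b / 2) b := by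
    intro i x hx
    rw [Real.closedBall_eq_Icc] at hx
    have h0 : (0 : ℝ) ≤ (i : ℕ) := by positivity
    have h1 := mul_le_mul_of_nonneg_left (hik i) hs0.le
    have h2 := mul_nonneg hs0.le h0
    constructor <;> nlinarith [hx.1, hx.2]
  choose u h hu0 hg hsupp using fun i : Fin (k + 1) => exists_bump_mem_graph q hq
    (by positivity : 0 < s / 3)
    ((hball i).trans (Ioo_subset_Ioo (by linarith) le_rfl))
  have horth : Pairwise fun i j => inner ℂ (u i) (u j) = 0 := by
    intro i j hij
    rw [L2.inner_eq_integral (ha.trans hb).le (u i) (u j) (f := fun _ => 0)]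
    · simp
    · filter_upwards [hsupp i, hsupp j] with x hi hj
      by_cases hx : x ∈ Metric.ball (b / 2 + s * (i + 1)) (s / 3)
      · rw [hj, zero_mul]
        intro hx'
        rw [Real.ball_eq_Ioo] at hx hx'
        rcases lt_or_gt_of_ne (Fin.val_injective.ne hij) with hlt | hlt
        · have : ((i : ℕ) : ℝ) + 1 ≤ (j : ℕ) := by exact_mod_cast hlt
          nlinarith [hx.1, hx.2, hx'.1, hx'.2]
        · have : ((j : ℕ) : ℝ) + 1 ≤ (i : ℕ) := by exact_mod_cast hlt
          nlinarith [hx.1, hx.2, hx'.1, hx'.2]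
      · rw [hi hx, map_zero, mul_zero]
  have hli : LinearIndependent ℂ u := linearIndependent_of_ne_zero_of_inner_eq_zero hu0 horth
  -- The span is taken inside the graph. On this finite-dimensional space the projection to the
  -- first component is injective, hence bounded below, which yields ‖h‖ ≤ C‖u‖ with `C` chosen
  -- before the other potential.
  set V : Submodule ℂ (L2 a b × L2 a b) := Submodule.span ℂ (range fun i => (u i, h i)) with hV
  have hVg : V ≤ (clampedOp a b q).graph :=
    Submodule.span_le.2 (by rintro _ ⟨i, rfl⟩; exact hg i)
  have hVs : ∀ p ∈ V, ∀ᵐ x ∂(volume.restrict (Ioo a b)), ¬ b / 2 < |x| → p.1 x = 0 := by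
    intro p hp
    induction hp using Submodule.span_induction with
    | mem p hp =>
      obtain ⟨i, rfl⟩ := hp
      filter_upwards [hsupp i] with x hx hxb
      refine hx fun hxm => hxb ?_
      exact ((hball i) (Metric.ball_subset_closedBall hxm)).1.trans_le (le_abs_self x)
    | zero =>
      filter_upwards [Lp.coeFn_zero ℂ 2 (volume.restrict (Ioo a b))] with x hx _
      simpa using hx
    | add p p' _ _ hp hp' =>
      filter_upwards [hp, hp', Lp.coeFn_add p.1 p'.1] with x h1 h2 h3 hx
      rw [Prod.fst_add, h3, Pi.add_apply, h1 hx, h2 hx, add_zero]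
    | smul c p _ hp =>
      filter_upwards [hp, Lp.coeFn_smul c p.1] with x h1 h3 hx
      rw [Prod.smul_fst, h3, Pi.smul_apply, h1 hx, smul_zero]
  have hVf : FiniteDimensional ℂ V := FiniteDimensional.span_of_finite ℂ (finite_range _)
  have hinj : LinearMap.ker ((LinearMap.fst ℂ (L2 a b) (L2 a b)).domRestrict V) = ⊥ := by
    rw [LinearMap.ker_eq_bot']
    rintro ⟨⟨p, p'⟩, hp⟩ hp0
    obtain rfl : p = 0 := hp0
    have := (clampedOp a b q).graph_fst_eq_zero_snd (hVg hp) rfl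
    change p' = 0 at this
    subst this
    rfl
  obtain ⟨C, -, hC⟩ := LinearMap.exists_antilipschitzWith _ hinj
  refine ⟨C, fun q' hq' hqq lam hlam => ?_⟩
  obtain ⟨e, he⟩ := hlam.exists_clamped_eigenbasis (ha.trans hb) hq'
  refine eigenvalue_le (isSymmetricOp_clampedOp (ha.trans hb).le) hlam.monotone e he
    (V.map (LinearMap.fst ℂ _ _)) ?_ ?_
  · have : V.map (LinearMap.fst ℂ (L2 a b) (L2 a b)) = Submodule.span ℂ (range u) := by
      rw [hV, Submodule.map_span, ← range_comp]
      rfl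
    rw [this, finrank_span_eq_card hli]
    simp
  · rintro _ ⟨p, hp, rfl⟩
    refine ⟨p.2, ?_, ?_⟩
    · have := clampedOp_graph_add (q' := q') (r := fun x => q' x - q x) (k := 0)
        (fun x _ => by ring) (u := p.1) (h := p.2) ?_ (hVg hp)
      · simpa using this
      · filter_upwards [hVs p hp, Lp.coeFn_zero ℂ 2 (volume.restrict (Ioo a b)),
          ae_restrict_mem measurableSet_Ioo] with x h1 h2 h3
        rw [h2, Pi.zero_apply]
        by_cases hx : b / 2 < |x|
        · rw [hqq x h3 hx, sub_self]; simp
        · rw [h1 hx, mul_zero]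
    · have h1 : ‖p‖ ≤ C * ‖p.1‖ := by
        have := hC.le_mul_dist ⟨p, hp⟩ 0
        simpa using this
      calc (inner ℂ p.2 p.1).re ≤ ‖p.2‖ * ‖p.1‖ := re_inner_le_norm (𝕜 := ℂ) _ _
        _ ≤ (C * ‖p.1‖) * ‖p.1‖ := by gcongr; exact (norm_snd_le p).trans h1
        _ = C * ‖p.1‖ ^ 2 := by ring

/-- Each point imposes two linear conditions, one on the value and one on the slope; uniqueness of
the representing family makes these traces linear on `W`. -/
theorem exists_ne_zero_vanishing (hab : a < b) (W : Submodule ℂ (L2 a b)) [FiniteDimensional ℂ W]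
    (hW : ∀ u ∈ W, ∃ D, IsSobolevFour a b D ∧ ∀ᵐ x ∂(volume.restrict (Ioo a b)), u x = D 0 x)
    {ι : Type*} [Fintype ι] (p : ι → ℝ) (hp : ∀ i, p i ∈ Icc a b)
    (hcard : 2 * Fintype.card ι < Module.finrank ℂ W) :
    ∃ u ∈ W, u ≠ 0 ∧ ∀ D, IsSobolevFour a b D →
      (∀ᵐ x ∂(volume.restrict (Ioo a b)), u x = D 0 x) → ∀ i, D 0 (p i) = 0 ∧ D 1 (p i) = 0 := by
  choose D hD hDu using fun u : W => hW u u.2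
  have huniq : ∀ (u : W) (E), IsSobolevFour a b E →
      (∀ᵐ x ∂(volume.restrict (Ioo a b)), (u : L2 a b) x = E 0 x) → ∀ j < 4, ∀ x ∈ Icc a b,
      D u j x = E j x := fun u E hE hu j hj x hx =>
    (hD u).eqOn_of_ae_eq hE hab (by
      filter_upwards [hu, hDu u] with y h1 h2; rw [← h1, ← h2]) hj hx
  have hlt : ∀ j : Fin 2, (j : ℕ) < 4 := fun j => by omega
  let φ : W →ₗ[ℂ] (Fin 2 × ι → ℂ) :=
    { toFun := fun u i => D u i.1 (p i.2)
      map_add' := fun u v => by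
        ext i
        exact huniq (u + v) _ ((hD u).add (hD v)) (by
          filter_upwards [hDu u, hDu v, Lp.coeFn_add (u : L2 a b) v] with x h1 h2 h3
          rw [Submodule.coe_add, h3, Pi.add_apply, h1, h2]; rfl) _ (hlt _) _ (hp _)
      map_smul' := fun c u => by
        ext i
        exact huniq (c • u) _ ((hD u).smul c) (by
          filter_upwards [hDu u, Lp.coeFn_smul c (u : L2 a b)] with x h1 h3
          rw [Submodule.coe_smul, h3, Pi.smul_apply, h1]; rfl) _ (hlt _) _ (hp _) }
  have hker : LinearMap.ker φ ≠ ⊥ := LinearMap.ker_ne_bot_of_finrank_lt (by simpa using hcard)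
  obtain ⟨u, huk, hu0⟩ := (Submodule.ne_bot_iff _).1 hker
  refine ⟨u, u.2, by simpa using hu0, fun E hE hu i => ?_⟩
  have h : ∀ j : Fin 2, D u j (p i) = 0 := fun j => congrFun (LinearMap.mem_ker.1 huk) (j, i)
  exact ⟨(huniq u E hE hu 0 (by norm_num) _ (hp i)).symm.trans (h 0),
    (huniq u E hE hu 1 (by norm_num) _ (hp i)).symm.trans (h 1)⟩

/-- Poincaré's inequality for functions that vanish to the first order at the points of a uniform
partition. -/
theorem IsSobolevFour.poincare_partition {c d : ℝ} {D : ℕ → ℝ → ℂ} (h : IsSobolevFour c d D)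
    (hcd : c ≤ d) {n : ℕ} (hn : 0 < n)
    (h0 : ∀ i < n, D 0 (c + i * ((d - c) / n)) = 0 ∧ D 1 (c + i * ((d - c) / n)) = 0) :
    ∫ t in c..d, ‖D 0 t‖ ^ 2 ≤ ((d - c) / n) ^ 4 * ∫ t in c..d, ‖D 2 t‖ ^ 2 := by
  set s := (d - c) / n with hs
  have hn' : (0 : ℝ) < n := by exact_mod_cast hn
  have hs0 : 0 ≤ s := div_nonneg (by linarith) hn'.le
  have hns : n * s = d - c := by rw [hs]; field_simp
  have hmem : ∀ i : ℕ, i ≤ n → c + i * s ∈ Icc c d := fun i hi => by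
    have h1 : (i : ℝ) * s ≤ n * s := by gcongr
    have h2 : 0 ≤ (i : ℝ) * s := by positivity
    constructor <;> linarith
  have hsub : ∀ i < n, ∀ j < 4, IntervalIntegrable (fun t => ‖D j t‖ ^ 2) volume
      (c + i * s) (c + (i + 1 : ℕ) * s) := fun i hi j hj => by
    refine (h.intervalIntegrable_norm_sq hj hcd).mono_set ?_
    rw [uIcc_of_le hcd]
    exact uIcc_subset_Icc (hmem i hi.le) (hmem (i + 1) hi)
  have hsum : ∀ j < 4, ∑ i ∈ Finset.range n,
    ∫ t in (c + i * s)..(c + (i + 1 : ℕ) * s), ‖D j t‖ ^ 2 =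
      ∫ t in c..d, ‖D j t‖ ^ 2 := fun j hj => by
    rw [intervalIntegral.sum_integral_adjacent_intervals (a := fun i : ℕ => c + i * s)
      fun i hi => hsub i hi j hj]
    simp [hns]
  rw [← hsum 0 (by norm_num), ← hsum 2 (by norm_num), Finset.mul_sum]
  refine Finset.sum_le_sum fun i hi => ?_
  have hi' := Finset.mem_range.1 hi
  have := (h.mono (hmem i hi'.le).1 (hmem (i + 1) hi').2).poincare
    (by push_cast; linarith) (h0 i hi').1 (h0 i hi').2
  have h2 : c + ((i + 1 : ℕ) : ℝ) * s - (c + i * s) = s := by push_cast; ring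
  rwa [h2] at this

end EigenvalueBounds

/-! ### Bounds for the perturbed eigenvalues uniform in ε, and their continuity in ε. -/

section PerturbedEigenvalues

variable {a b α β γ₁ γ₂ : ℝ} {U Ψ Φ Υ₁ Υ₂ : ℝ → ℝ}

theorem continuous_scaledPotential (hΨ : Continuous Ψ) (hΦ : Continuous Φ)
    (hΥ₁ : Continuous Υ₁) (hΥ₂ : Continuous Υ₂) (ε : ℝ) :
    Continuous (scaledPotential α β γ₁ γ₂ Ψ Φ Υ₁ Υ₂ ε) := by
  unfold scaledPotential
  fun_prop

/-- As a function of (ε, x/ε), ε⁴ times the potential extends continuously to the compact set [0, 1]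
× [-1, 1]. The summand with factor 0 is there to match `scaledPotential_mul` at u = 0. -/
theorem exists_scaledPotential_bound (α β γ₁ γ₂ : ℝ) (hΨ : Continuous Ψ) (hΦ : Continuous Φ)
    (hΥ₁ : Continuous Υ₁) (hΥ₂ : Continuous Υ₂) :
    ∃ P : ℝ, 0 ≤ P ∧ ∀ ε ∈ Ioo (0 : ℝ) 1, ∀ x ∈ Icc (-ε) ε,
      |scaledPotential α β γ₁ γ₂ Ψ Φ Υ₁ Υ₂ ε x| ≤ P / ε ^ 4 := by
  obtain ⟨P, hP⟩ := (isCompact_Icc.prod isCompact_Icc).exists_bound_of_continuousOn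
    (s := Icc (0 : ℝ) 1 ×ˢ Icc (-1 : ℝ) 1) (f := fun p : ℝ × ℝ =>
      α * Ψ p.2 + p.1 * (β * Φ p.2 + p.1 * (γ₁ * Υ₁ p.2 + p.1 * (γ₂ * Υ₂ p.2) + p.1 ^ 2 * 0)))
    (by fun_prop)
  refine ⟨P, (norm_nonneg _).trans (hP (0, 0) ⟨by norm_num, by norm_num⟩), fun ε hε x hx => ?_⟩
  have hξ : ε * (ε⁻¹ * x) = x := mul_inv_cancel_left₀ hε.1.ne' x
  have h1 := hP (ε, ε⁻¹ * x) ⟨⟨hε.1.le, hε.2.le⟩, by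
    rw [inv_mul_eq_div, le_div_iff₀ hε.1]; linarith [hx.1], by
    rw [inv_mul_eq_div, div_le_one hε.1]; exact hx.2⟩
  have h2 := scaledPotential_mul α β γ₁ γ₂ (Ψ := Ψ) (Φ := Φ) (Υ₁ := Υ₁) (Υ₂ := Υ₂) 0 hε.1 (ε⁻¹ * x)
  simp only at h1
  rw [← h2, hξ, zero_add, Real.norm_eq_abs, abs_mul, abs_of_pos (pow_pos hε.1 4)] at h1
  rw [le_div_iff₀ (pow_pos hε.1 4), mul_comm]
  exact h1

/-- For each `Λ` there are only boundedly many eigenvalues below `Λ`, uniformly in `ε`. -/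
theorem exists_eigenvalue_lower_bound (ha : a < 0) (hb : 0 < b) (hU : ContinuousOn U (Icc a b))
    (hΨ : Continuous Ψ) (hΦ : Continuous Φ) (hΥ₁ : Continuous Υ₁) (hΥ₂ : Continuous Υ₂)
    (hΨs : tsupport Ψ ⊆ Icc (-1) 1) (hΦs : tsupport Φ ⊆ Icc (-1) 1)
    (h₁s : tsupport Υ₁ ⊆ Icc (-1) 1) (h₂s : tsupport Υ₂ ⊆ Icc (-1) 1) (Λ : ℝ) :
    ∃ K : ℕ, ∃ ε₀ > 0, ∀ ε ∈ Ioo 0 ε₀, ∀ lam : ℕ → ℝ,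
      IsEigenvalueEnumeration (perturbedOp a b U α β γ₁ γ₂ Ψ Φ Υ₁ Υ₂ ε) lam → Λ ≤ lam K := by
  have hab : a < b := ha.trans hb
  obtain ⟨P, hP0, hP⟩ := exists_scaledPotential_bound α β γ₁ γ₂ hΨ hΦ hΥ₁ hΥ₂
  obtain ⟨Q, hQ⟩ := isCompact_Icc.exists_bound_of_continuousOn hU
  -- On a partition of [-ε, ε] into m + 1 cells Poincaré's constant is (2ε/(m + 1))⁴. Against the
  -- bound P/ε⁴ the powers of ε cancel, and m ≥ 32 P makes the product at most 1/2, independently of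
  -- ε.
  obtain ⟨m, hm⟩ := exists_nat_ge (32 * P)
  -- Likewise n + 1 cells in [a, b] make |Λ + Q|‖u‖² at most half of the bending energy ∫|u''|².
  obtain ⟨n, hn⟩ := exists_nat_ge (2 * |Λ + Q| * (b - a) ^ 4)
  refine ⟨2 * ((m + 1) + (n + 1)), min 1 (min b (-a)), by simp [ha, hb], fun ε hε lam hlam => ?_⟩
  obtain ⟨hε0, hε⟩ := hε
  obtain ⟨hε1, hε⟩ := lt_min_iff.1 hε
  obtain ⟨hεb, hεa⟩ := lt_min_iff.1 hε
  set sp := scaledPotential α β γ₁ γ₂ Ψ Φ Υ₁ Υ₂ ε with hsp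
  have hspc : Continuous sp := continuous_scaledPotential hΨ hΦ hΥ₁ hΥ₂ ε
  have hqc : ContinuousOn (fun x => U x + sp x) (Icc a b) := hU.add hspc.continuousOn
  obtain ⟨e, he⟩ := hlam.exists_clamped_eigenbasis hab hqc
  obtain ⟨W, hWf, hWk, hW⟩ := exists_spectral_subspace hlam.monotone e he (2 * ((m + 1) + (n + 1)))
  have hpart : ∀ {c d : ℝ} (N : ℕ), c ≤ d → a ≤ c → d ≤ b → ∀ i : Fin (N + 1),
      c + (i : ℕ) * ((d - c) / (N + 1 : ℕ)) ∈ Icc a b := by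
    intro c d N hcd hac hdb i
    have h1 : ((i : ℕ) : ℝ) ≤ (N + 1 : ℕ) := by exact_mod_cast i.2.le
    have h2 : 0 ≤ (d - c) / (N + 1 : ℕ) := div_nonneg (by linarith) (by positivity)
    have h3 : ((i : ℕ) : ℝ) * ((d - c) / (N + 1 : ℕ)) ≤ (N + 1 : ℕ) * ((d - c) / (N + 1 : ℕ)) := by
      gcongr
    rw [mul_div_cancel₀ _ (by positivity : ((N + 1 : ℕ) : ℝ) ≠ 0)] at h3
    have h4 : 0 ≤ ((i : ℕ) : ℝ) * ((d - c) / (N + 1 : ℕ)) := by positivity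
    constructor <;> linarith
  -- The spectral subspace has dimension one more than twice the number of nodes. For the chosen u
  -- one half of ∫|u''|² compensates the singular potential, the other half dominates |Λ + Q|‖u‖².
  obtain ⟨u, huW, hu0, hu⟩ := exists_ne_zero_vanishing hab W (fun u hu => by
      obtain ⟨h, hg, -⟩ := hW u hu
      obtain ⟨D, hD⟩ := exists_isClampedSolution hg
      exact ⟨D, hD.sobolev, hD.coe_eq⟩)
    (Sum.elim (fun i : Fin (m + 1) => -ε + (i : ℕ) * ((ε - -ε) / (m + 1 : ℕ)))
      (fun i : Fin (n + 1) => a + (i : ℕ) * ((b - a) / (n + 1 : ℕ))))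
    (by
      rintro (i | i)
      · exact hpart m (by linarith) (by linarith) hεb.le i
      · exact hpart n hab.le le_rfl le_rfl i)
    (by rw [hWk]; simp)
  obtain ⟨h, hg, hle⟩ := hW u huW
  obtain ⟨D, hD⟩ := exists_isClampedSolution hg
  have hz := hu D hD.sobolev hD.coe_eq
  have hin := (hD.sobolev.mono (by linarith : a ≤ -ε) hεb.le).poincare_partition
    (by linarith) (Nat.succ_pos m) (fun i hi => hz (Sum.inl ⟨i, hi⟩))
  have hout := hD.sobolev.poincare_partition hab.le (Nat.succ_pos n)
    (fun i hi => hz (Sum.inr ⟨i, hi⟩))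
  rw [← L2.norm_sq_eq hab.le u hD.coe_eq] at hout
  rw [clampedOp_energy hab.le hqc hD.sobolev hD.coe_eq hD.equation hD.left_zero hD.left_one
    hD.right_zero hD.right_one] at hle
  have hD0 := hD.sobolev.continuousOn (j := 0) (by norm_num)
  have hDi : ∀ {c d : ℝ}, a ≤ c → c ≤ d → d ≤ b → ∀ {f : ℝ → ℝ}, ContinuousOn f (Icc a b) →
      IntervalIntegrable (fun x => f x * ‖D 0 x‖ ^ 2) volume c d := fun hac hcd hdb f hf =>
    ContinuousOn.intervalIntegrable (by
      rw [uIcc_of_le hcd]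
      exact (hf.mul (hD0.norm.pow 2)).mono (Icc_subset_Icc hac hdb))
  have hspi : ∀ {c d : ℝ}, a ≤ c → c ≤ d → d ≤ b →
      IntervalIntegrable (fun x => sp x * ‖D 0 x‖ ^ 2) volume c d := fun hac hcd hdb =>
    hDi hac hcd hdb hspc.continuousOn
  have hUlow : -Q * ‖u‖ ^ 2 ≤ ∫ x in a..b, U x * ‖D 0 x‖ ^ 2 := by
    rw [L2.norm_sq_eq hab.le u hD.coe_eq, ← intervalIntegral.integral_const_mul]
    refine intervalIntegral.integral_mono_on hab.le (hDi le_rfl hab.le le_rfl continuousOn_const)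
      (hDi le_rfl hab.le le_rfl hU) fun x hx => ?_
    gcongr
    exact (abs_le.1 (hQ x hx)).1
  have hzero : ∀ {c d : ℝ}, c ≤ d → (∀ x ∈ Ioo c d, ε < |x|) →
      ∫ x in c..d, sp x * ‖D 0 x‖ ^ 2 = 0 := by
    intro c d hcd hx
    rw [intervalIntegral.integral_of_le hcd, integral_Ioc_eq_integral_Ioo]
    refine setIntegral_eq_zero_of_forall_eq_zero fun x hxI => ?_
    rw [hsp, scaledPotential_eq_zero α β γ₁ γ₂ hΨs hΦs h₁s h₂s hε0 (hx x hxI), zero_mul]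
  have hsplow : -(1 / 2) * (∫ x in a..b, ‖D 2 x‖ ^ 2) ≤ ∫ x in a..b, sp x * ‖D 0 x‖ ^ 2 := by
    rw [← intervalIntegral.integral_add_adjacent_intervals
        (hspi le_rfl (by linarith : a ≤ -ε) (by linarith))
          (hspi (by linarith) (by linarith) le_rfl),
      ← intervalIntegral.integral_add_adjacent_intervals
        (hspi (by linarith) (by linarith : -ε ≤ ε) hεb.le) (hspi (by linarith) hεb.le le_rfl),
      hzero (by linarith) fun x hx => lt_of_lt_of_le (by linarith [hx.2]) (neg_le_abs x),
      hzero hεb.le fun x hx => hx.1.trans_le (le_abs_self x), zero_add, add_zero]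
    have h1 : -(P / ε ^ 4) * ∫ x in (-ε)..ε, ‖D 0 x‖ ^ 2 ≤
        ∫ x in (-ε)..ε, sp x * ‖D 0 x‖ ^ 2 := by
      rw [← intervalIntegral.integral_const_mul]
      refine intervalIntegral.integral_mono_on (by linarith)
        (hDi (by linarith) (by linarith) hεb.le continuousOn_const)
        (hspi (by linarith) (by linarith) hεb.le) fun x hx => ?_
      gcongr
      exact (abs_le.1 (hP ε ⟨hε0, hε1⟩ x hx)).1
    have h2 : ∫ x in (-ε)..ε, ‖D 2 x‖ ^ 2 ≤ ∫ x in a..b, ‖D 2 x‖ ^ 2 := by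
      refine intervalIntegral.integral_mono_interval (by linarith) (by linarith) hεb.le ?_
        (hD.sobolev.intervalIntegrable_norm_sq (by norm_num) hab.le)
      exact Eventually.of_forall fun x => by positivity
    have h3 : 0 ≤ ∫ x in (-ε)..ε, ‖D 2 x‖ ^ 2 :=
      intervalIntegral.integral_nonneg (by linarith) fun x _ => by positivity
    have h4 : P / ε ^ 4 * ((ε - -ε) / (m + 1 : ℕ)) ^ 4 ≤ 1 / 2 := by
      have hm1 : (1 : ℝ) ≤ (m + 1 : ℕ) := by norm_num
      have h5 : ((m + 1 : ℕ) : ℝ) ≤ ((m + 1 : ℕ) : ℝ) ^ 4 := le_self_pow₀ hm1 (by norm_num)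
      have h6 : 32 * P ≤ ((m + 1 : ℕ) : ℝ) ^ 4 := by
        refine le_trans ?_ h5
        push_cast
        linarith
      have h7 : P / ε ^ 4 * ((ε - -ε) / (m + 1 : ℕ)) ^ 4 = 16 * P / ((m + 1 : ℕ) : ℝ) ^ 4 := by
        field_simp
        ring
      rw [h7, div_le_iff₀ (by positivity)]
      linarith
    calc -(1 / 2) * (∫ x in a..b, ‖D 2 x‖ ^ 2) ≤ -(1 / 2) * ∫ x in (-ε)..ε, ‖D 2 x‖ ^ 2 := by
          linarith
      _ ≤ -(P / ε ^ 4 * ((ε - -ε) / (m + 1 : ℕ)) ^ 4) * ∫ x in (-ε)..ε, ‖D 2 x‖ ^ 2 := by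
          gcongr
      _ = -(P / ε ^ 4 * (((ε - -ε) / (m + 1 : ℕ)) ^ 4 * ∫ x in (-ε)..ε, ‖D 2 x‖ ^ 2)) := by ring
      _ ≤ -(P / ε ^ 4 * ∫ x in (-ε)..ε, ‖D 0 x‖ ^ 2) := by
          gcongr
      _ ≤ _ := by linarith
  have hsplit : ∫ x in a..b, (U x + sp x) * ‖D 0 x‖ ^ 2 =
      (∫ x in a..b, U x * ‖D 0 x‖ ^ 2) + ∫ x in a..b, sp x * ‖D 0 x‖ ^ 2 := by
    rw [← intervalIntegral.integral_add (hDi le_rfl hab.le le_rfl hU) (hspi le_rfl hab.le le_rfl)]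
    congr 1
    ext x
    ring
  have hkin : |Λ + Q| * ‖u‖ ^ 2 ≤ 1 / 2 * ∫ x in a..b, ‖D 2 x‖ ^ 2 := by
    have h3 : 0 ≤ ∫ x in a..b, ‖D 2 x‖ ^ 2 :=
      intervalIntegral.integral_nonneg hab.le fun x _ => by positivity
    have h4 : |Λ + Q| * ((b - a) / (n + 1 : ℕ)) ^ 4 ≤ 1 / 2 := by
      have h5 : ((n + 1 : ℕ) : ℝ) ≤ ((n + 1 : ℕ) : ℝ) ^ 4 :=
        le_self_pow₀ (by norm_num) (by norm_num)
      have h6 : 2 * |Λ + Q| * (b - a) ^ 4 ≤ ((n + 1 : ℕ) : ℝ) ^ 4 := by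
        refine le_trans ?_ h5
        push_cast
        linarith
      rw [div_pow, ← mul_div_assoc, div_le_iff₀ (by positivity)]
      linarith
    calc |Λ + Q| * ‖u‖ ^ 2
        ≤ |Λ + Q| * (((b - a) / (n + 1 : ℕ)) ^ 4 * ∫ x in a..b, ‖D 2 x‖ ^ 2) := by gcongr
      _ = |Λ + Q| * ((b - a) / (n + 1 : ℕ)) ^ 4 * ∫ x in a..b, ‖D 2 x‖ ^ 2 := by ring
      _ ≤ _ := by gcongr
  have hpos : 0 < ‖u‖ ^ 2 := by positivity
  have habs : (Λ + Q) * ‖u‖ ^ 2 ≤ |Λ + Q| * ‖u‖ ^ 2 := by gcongr; exact le_abs_self _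
  refine le_of_mul_le_mul_right ?_ hpos
  rw [hsplit] at hle
  linarith

theorem exists_perturbed_eigenvalue_upper_bound (ha : a < 0) (hb : 0 < b)
    (hU : ContinuousOn U (Icc a b))
    (hΨ : Continuous Ψ) (hΦ : Continuous Φ) (hΥ₁ : Continuous Υ₁) (hΥ₂ : Continuous Υ₂)
    (hΨs : tsupport Ψ ⊆ Icc (-1) 1) (hΦs : tsupport Φ ⊆ Icc (-1) 1)
    (h₁s : tsupport Υ₁ ⊆ Icc (-1) 1) (h₂s : tsupport Υ₂ ⊆ Icc (-1) 1) (k : ℕ) :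
    ∃ Λ : ℝ, ∃ ε₀ > 0, ∀ ε ∈ Ioo 0 ε₀, ∀ lam : ℕ → ℝ,
      IsEigenvalueEnumeration (perturbedOp a b U α β γ₁ γ₂ Ψ Φ Υ₁ Υ₂ ε) lam → lam k ≤ Λ := by
  obtain ⟨Λ, hΛ⟩ := exists_eigenvalue_upper_bound ha hb hU k
  refine ⟨Λ, b / 2, by positivity, fun ε hε lam hlam => hΛ _ ?_ (fun x _ hx => ?_) lam hlam⟩
  · exact hU.add (continuous_scaledPotential hΨ hΦ hΥ₁ hΥ₂ ε).continuousOn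
  · rw [scaledPotential_eq_zero α β γ₁ γ₂ hΨs hΦs h₁s h₂s hε.1 (hε.2.trans hx), add_zero]

/-- For ε away from zero the potentials depend on ε continuously in the uniform norm, and
eigenvalues are Lipschitz in that norm. Continuity is what the intermediate value argument for
branches uses. -/
theorem continuousOn_eigenvalue (hab : a < b) (hU : ContinuousOn U (Icc a b))
    (hΨ : Continuous Ψ) (hΦ : Continuous Φ) (hΥ₁ : Continuous Υ₁) (hΥ₂ : Continuous Υ₂)
    {lam : ℝ → ℕ → ℝ} (hlam : ∀ ε ∈ Ioo (0 : ℝ) 1,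
      IsEigenvalueEnumeration (perturbedOp a b U α β γ₁ γ₂ Ψ Φ Υ₁ Υ₂ ε) (lam ε)) (k : ℕ) :
    ContinuousOn (fun ε => lam ε k) (Ioo 0 1) := by
  have hq : ∀ ε, ContinuousOn (fun x => U x + scaledPotential α β γ₁ γ₂ Ψ Φ Υ₁ Υ₂ ε x) (Icc a b) :=
    fun ε => hU.add (continuous_scaledPotential hΨ hΦ hΥ₁ hΥ₂ ε).continuousOn
  intro δ hδ
  rw [ContinuousWithinAt, isOpen_Ioo.nhdsWithin_eq hδ, Metric.tendsto_nhds]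
  intro η hη
  have hunif : ∀ᶠ ε in 𝓝 δ, ∀ x ∈ Icc a b, |scaledPotential α β γ₁ γ₂ Ψ Φ Υ₁ Υ₂ ε x -
      scaledPotential α β γ₁ γ₂ Ψ Φ Υ₁ Υ₂ δ x| ≤ η / 2 := by
    refine isCompact_Icc.eventually_forall_of_forall_eventually fun x _ => ?_
    have hc : ContinuousAt (fun z : ℝ × ℝ => |scaledPotential α β γ₁ γ₂ Ψ Φ Υ₁ Υ₂ z.1 z.2 -
        scaledPotential α β γ₁ γ₂ Ψ Φ Υ₁ Υ₂ δ z.2|) (δ, x) := by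
      have h0 : δ ≠ 0 := hδ.1.ne'
      have hf : ∀ {f : ℝ → ℝ}, Continuous f →
          ContinuousAt (fun z : ℝ × ℝ => f (z.1⁻¹ * z.2)) (δ, x) := fun hf =>
        hf.continuousAt.comp ((continuousAt_fst.inv₀ h0).mul continuousAt_snd)
      have hp : ∀ m : ℕ, ContinuousAt (fun z : ℝ × ℝ => (z.1 ^ m)⁻¹) (δ, x) := fun m =>
        (continuousAt_fst.pow m).inv₀ (pow_ne_zero m h0)
      have h1 : ContinuousAt (fun z : ℝ × ℝ =>
          scaledPotential α β γ₁ γ₂ Ψ Φ Υ₁ Υ₂ z.1 z.2) (δ, x) := by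
        unfold scaledPotential
        exact ((((continuousAt_const.mul (hp 4)).mul (hf hΨ)).add
          ((continuousAt_const.mul (hp 3)).mul (hf hΦ))).add
          ((continuousAt_const.mul (hp 2)).mul (hf hΥ₁))).add
          ((continuousAt_const.mul (continuousAt_fst.inv₀ h0)).mul (hf hΥ₂))
      exact (h1.sub (((continuous_scaledPotential hΨ hΦ hΥ₁ hΥ₂ δ).comp
        continuous_snd).continuousAt)).abs
    have h0 : |scaledPotential α β γ₁ γ₂ Ψ Φ Υ₁ Υ₂ δ x -
        scaledPotential α β γ₁ γ₂ Ψ Φ Υ₁ Υ₂ δ x| < η / 2 := by simpa using hη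
    exact hc (Iic_mem_nhds h0)
  filter_upwards [hunif, isOpen_Ioo.mem_nhds hδ] with ε h1 h2
  rw [Real.dist_eq]
  refine (abs_eigenvalue_sub_le hab (hq δ) (hq ε) (hlam δ hδ) (hlam ε h2)
    (fun x hx => ?_) k).trans_lt
    (half_lt_self hη)
  rw [add_sub_add_left_eq_sub]
  exact h1 x hx

end PerturbedEigenvalues

/-! ### Spectral convergence -/

section Approximation

theorem exists_seq_tendsto_nhdsGT_zero :
    ∃ ε : ℕ → ℝ, Tendsto ε atTop (𝓝[>] 0) ∧ ∀ n, ε n ∈ Ioo (0 : ℝ) 1 := by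
  have h : ∀ᶠ ε in 𝓝[>] (0 : ℝ), ε ∈ Ioo (0 : ℝ) 1 := Ioo_mem_nhdsGT one_pos
  exact exists_seq_forall_of_frequently h.frequently

variable {H : Type*} [NormedAddCommGroup H] [InnerProductSpace ℂ H]

/-- The self-adjoint operators `T ε` with eigenvalues `lam ε 0 ≤ lam ε 1 ≤ …` converge to the
symmetric operator `S` as `ε → 0`, precompactly and in the sense of graphs. -/
structure SpectralApproximation (T : ℝ → H →ₗ.[ℂ] H) (S : H →ₗ.[ℂ] H) (lam : ℝ → ℕ → ℝ) : Prop where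
  symmetric : ∀ ε ∈ Ioo (0 : ℝ) 1, IsSymmetricOp (T ε)
  compact : ∀ ε ∈ Ioo (0 : ℝ) 1, HasCompactResolvent (T ε)
  enumeration : ∀ ε ∈ Ioo (0 : ℝ) 1, IsEigenvalueEnumeration (T ε) (lam ε)
  symmetric_limit : IsSymmetricOp S
  graph_limit : ∀ (ε : ℕ → ℝ), Tendsto ε atTop (𝓝[>] 0) → ∀ (u h : ℕ → H) (M : ℝ),
    (∀ n, (u n, h n) ∈ (T (ε n)).graph) → (∀ n, ‖u n‖ + ‖h n‖ ≤ M) →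
    ∃ φ : ℕ → ℕ, StrictMono φ ∧ ∃ v, Tendsto (fun n => u (φ n)) atTop (𝓝 v) ∧
      ∀ k, Tendsto (fun n => h (φ n)) atTop (𝓝 k) → (v, k) ∈ S.graph
  upper : ∀ k, ∃ Λ, ∀ᶠ ε in 𝓝[>] 0, lam ε k ≤ Λ
  lower : ∀ Λ, ∃ K, ∀ᶠ ε in 𝓝[>] 0, Λ ≤ lam ε K
  continuousOn : ∀ k, ContinuousOn (fun ε => lam ε k) (Ioo 0 1)

namespace SpectralApproximation

variable {T : ℝ → H →ₗ.[ℂ] H} {S : H →ₗ.[ℂ] H} {lam : ℝ → ℕ → ℝ}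

/-- Convergence of the eigenvectors is in norm, so the limit stays a unit vector and cannot
degenerate. -/
theorem exists_limit_eigenvector (hA : SpectralApproximation T S lam) {ε : ℕ → ℝ}
    (hε : Tendsto ε atTop (𝓝[>] 0)) {u : ℕ → H} {r : ℕ → ℝ} {μ : ℝ} (hr : Tendsto r atTop (𝓝 μ))
    (hu : ∀ n, (u n, (r n : ℂ) • u n) ∈ (T (ε n)).graph) (hu1 : ∀ n, ‖u n‖ = 1) :
    ∃ φ : ℕ → ℕ, StrictMono φ ∧ ∃ v, Tendsto (fun n => u (φ n)) atTop (𝓝 v) ∧ ‖v‖ = 1 ∧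
      (v, (μ : ℂ) • v) ∈ S.graph := by
  obtain ⟨M, hM⟩ := hr.abs.bddAbove_range
  obtain ⟨φ, hφ, v, hv, hg⟩ := hA.graph_limit ε hε u (fun n => (r n : ℂ) • u n) (1 + M) hu
    (fun n => by
      rw [norm_smul, hu1, Complex.norm_real, mul_one, Real.norm_eq_abs]
      gcongr
      exact hM (mem_range_self n))
  refine ⟨φ, hφ, v, hv, ?_, hg _ ?_⟩
  · exact tendsto_nhds_unique hv.norm (by simp [hu1])
  · exact ((Complex.continuous_ofReal.tendsto μ).comp (hr.comp hφ.tendsto_atTop)).smul hv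

variable [CompleteSpace H]

theorem exists_eigenbasis (hA : SpectralApproximation T S lam) {ε : ℝ} (hε : ε ∈ Ioo 0 1) :
    ∃ e : HilbertBasis ℕ ℂ H, ∀ k, (e k, (lam ε k : ℂ) • e k) ∈ (T ε).graph :=
  SingularFourthOrder.exists_eigenbasis (hA.symmetric ε hε) (hA.compact ε hε) (hA.enumeration ε hε)

theorem exists_eigenvector (hA : SpectralApproximation T S lam) {ε : ℕ → ℝ}
    (hε : Tendsto ε atTop (𝓝[>] 0)) (hε1 : ∀ n, ε n ∈ Ioo (0 : ℝ) 1) {k : ℕ} {μ : ℝ}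
    (hμ : Tendsto (fun n => lam (ε n) k) atTop (𝓝 μ)) :
    ∃ u, u ≠ 0 ∧ (u, (μ : ℂ) • u) ∈ S.graph := by
  choose e he using fun n => hA.exists_eigenbasis (hε1 n)
  obtain ⟨φ, -, v, -, hv1, hv⟩ := hA.exists_limit_eigenvector hε hμ (fun n => he n k)
    (fun n => (e n).orthonormal.1 k)
  exact ⟨v, norm_ne_zero_iff.1 (by rw [hv1]; exact one_ne_zero), hv⟩

/-- A branch that lies on both sides of c for arbitrarily small ε takes the value c there by the
intermediate value theorem; eigenvectors at these points would then accumulate at an eigenvector of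
`S` for c. -/
theorem eventually_lt_or_gt (hA : SpectralApproximation T S lam) (k : ℕ) {c : ℝ}
    (hc : ¬ ∃ u, u ≠ 0 ∧ (u, (c : ℂ) • u) ∈ S.graph) :
    (∀ᶠ ε in 𝓝[>] 0, lam ε k < c) ∨ ∀ᶠ ε in 𝓝[>] 0, c < lam ε k := by
  by_contra! h
  obtain ⟨h1, h2⟩ := h
  have hfreq : ∃ᶠ ε in 𝓝[>] (0 : ℝ), ε ∈ Ioo (0 : ℝ) 1 ∧ lam ε k = c := by
    rw [frequently_iff]
    intro V hV
    obtain ⟨δ, hδ, hδV⟩ := mem_nhdsGT_iff_exists_Ioo_subset.1 hV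
    have hδ0 : 0 < min δ 1 := lt_min hδ one_pos
    have hI := Ioo_mem_nhdsGT hδ0
    obtain ⟨x, hx, hxI⟩ := (h1.and_eventually hI).exists
    obtain ⟨y, hy, hyI⟩ := (h2.and_eventually hI).exists
    have hsub : Ioo 0 (min δ 1) ⊆ Ioo (0 : ℝ) 1 := Ioo_subset_Ioo_right (min_le_right _ _)
    obtain ⟨z, hz, hzc⟩ := isPreconnected_Ioo.intermediate_value hyI hxI
      ((hA.continuousOn k).mono hsub) ⟨hy, hx⟩
    exact ⟨z, hδV ⟨hz.1, hz.2.trans_le (min_le_left _ _)⟩, hsub hz, hzc⟩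
  obtain ⟨ε, hε, hεc⟩ := exists_seq_forall_of_frequently hfreq
  refine hc (hA.exists_eigenvector hε (fun n => (hεc n).1) (k := k) ?_)
  simp [(hεc _).2]

/-- Along a common subsequence the two branches carry orthonormal eigenvectors, whose limits are
orthonormal in a one-dimensional eigenspace. -/
theorem index_unique (hA : SpectralApproximation T S lam) {μ : ℝ} (hμ : IsSimpleEigenvalue S μ)
    {k l : ℕ} (hk : Tendsto (fun ε => lam ε k) (𝓝[>] 0) (𝓝 μ))
    (hl : Tendsto (fun ε => lam ε l) (𝓝[>] 0) (𝓝 μ)) : k = l := by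
  by_contra hkl
  obtain ⟨ε, hε, hε1⟩ := exists_seq_tendsto_nhdsGT_zero
  choose e he using fun n => hA.exists_eigenbasis (hε1 n)
  obtain ⟨φ, hφ, v, hv, hv1, hvS⟩ := hA.exists_limit_eigenvector hε (hk.comp hε)
    (fun n => he n k) (fun n => (e n).orthonormal.1 k)
  obtain ⟨ψ, hψ, w, hw, hw1, hwS⟩ := hA.exists_limit_eigenvector (hε.comp hφ.tendsto_atTop)
    ((hl.comp hε).comp hφ.tendsto_atTop) (fun n => he (φ n) l)
    (fun n => (e (φ n)).orthonormal.1 l)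
  have hvw : inner ℂ v w = 0 := by
    refine tendsto_nhds_unique ((hv.comp hψ.tendsto_atTop).inner hw) ?_
    simp only [Function.comp_def, (e _).orthonormal.2 hkl]
    exact tendsto_const_nhds
  have hv0 : (⟨v, mem_eigenspace_iff.2 hvS⟩ : eigenspace S μ) ≠ 0 := fun h => by
    rw [Subtype.ext_iff] at h
    change v = 0 at h
    simp [h] at hv1
  obtain ⟨c, hc⟩ := (finrank_eq_one_iff_of_nonzero' _ hv0).1 hμ ⟨w, mem_eigenspace_iff.2 hwS⟩
  have hc' : c • v = w := congrArg Subtype.val hc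
  rw [← hc', inner_smul_right, inner_self_eq_norm_sq_to_K, hv1] at hvw
  have hc0 : c = 0 := by simpa using hvw
  rw [← hc', hc0] at hw1
  simp at hw1

variable [SecondCountableTopology H]

/-- Each eigenvalue either tends to `-∞` or converges to an eigenvalue of the limit operator. -/
theorem tendsto_atBot_or (hA : SpectralApproximation T S lam) (k : ℕ) :
    Tendsto (fun ε => lam ε k) (𝓝[>] 0) atBot ∨
      ∃ μ : ℝ, Tendsto (fun ε => lam ε k) (𝓝[>] 0) (𝓝 μ) ∧
        ∃ u, u ≠ 0 ∧ (u, (μ : ℂ) • u) ∈ S.graph := by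
  refine or_iff_not_imp_left.2 fun hbot => ?_
  -- The eigenvalues of `S` are countable, so barriers that a branch cannot keep crossing are dense;
  -- absence of upcrossings between such levels forces convergence.
  have hdense : Dense {c : ℝ | ∃ u, u ≠ 0 ∧ (u, (c : ℂ) • u) ∈ S.graph}ᶜ :=
    hA.symmetric_limit.countable_eigenvalues.dense_compl ℝ
  obtain ⟨m, hm⟩ : ∃ m, ¬ ∀ᶠ ε in 𝓝[>] 0, lam ε k ≤ m := by
    by_contra! h
    exact hbot (tendsto_atBot.2 h)
  obtain ⟨c, hc, hcm⟩ := hdense.exists_lt m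
  have hlow : ∀ᶠ ε in 𝓝[>] 0, c < lam ε k := (hA.eventually_lt_or_gt k hc).resolve_left
    fun h => hm (h.mono fun ε hε => (hε.trans hcm).le)
  obtain ⟨Λ, hΛ⟩ := hA.upper k
  obtain ⟨μ, hμ⟩ := tendsto_of_no_upcrossings (f := 𝓝[>] (0 : ℝ)) (u := fun ε => lam ε k) hdense
    (fun x hx y _ hxy ⟨h1, h2⟩ => by
      rcases hA.eventually_lt_or_gt k hx with h | h
      · exact h2 (h.mono fun ε hε => by simpa using (hε.trans hxy).le)
      · exact h1 (h.mono fun ε hε => by simpa using hε.le))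
    (isBoundedUnder_of_eventually_le hΛ)
    (isBoundedUnder_of_eventually_ge (hlow.mono fun ε hε => le_of_lt hε))
  refine ⟨μ, hμ, ?_⟩
  obtain ⟨ε, hε, hε1⟩ := exists_seq_tendsto_nhdsGT_zero
  exact hA.exists_eigenvector hε hε1 (hμ.comp hε)

/-- The dichotomy is proved for all small ε, so a lower bound along any finer filter already
excludes -∞; the limit found there is the limit of the whole branch. -/
theorem tendsto_of_eventually_ge (hA : SpectralApproximation T S lam) {l : Filter ℝ} [l.NeBot]
    (hl : l ≤ 𝓝[>] 0) {k : ℕ} {m : ℝ} (hm : ∀ᶠ ε in l, m ≤ lam ε k) :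
    ∃ μ : ℝ, Tendsto (fun ε => lam ε k) l (𝓝 μ) ∧ (μ : ℂ) ∈ opSpectrum S := by
  rcases hA.tendsto_atBot_or k with h | ⟨μ, hμ, u, hu0, hu⟩
  · obtain ⟨ε, h1, h2⟩ := (((h.mono_left hl).eventually_lt_atBot m).and hm).exists
    exact absurd h2 (not_le.2 h1)
  · exact ⟨μ, hμ.mono_left hl, mem_opSpectrum_of_eigenvector hu hu0⟩

/-- If no branch approaches μ, the equations (T ε - μ)u = f have bounded solutions, whose limit v
satisfies (S - μ)v = f. Symmetry then gives ‖f‖² = ⟨v, (S - μ)f⟩ = 0. Neither simplicity of μ nor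
self-adjointness of `S` is involved. -/
theorem exists_index (hA : SpectralApproximation T S lam) {μ : ℝ} {f : H} (hf0 : f ≠ 0)
    (hf : (f, (μ : ℂ) • f) ∈ S.graph) :
    ∃ k, Tendsto (fun ε => lam ε k) (𝓝[>] 0) (𝓝 μ) := by
  by_contra! hno
  have hgap : ∀ k, ∃ δ > 0, ∀ᶠ ε in 𝓝[>] 0, δ ≤ |lam ε k - μ| := by
    intro k
    rcases hA.tendsto_atBot_or k with h | ⟨ν, hν, -⟩
    · refine ⟨1, one_pos, (h.eventually_le_atBot (μ - 1)).mono fun ε hε => ?_⟩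
      rw [abs_sub_comm]
      exact (by linarith : 1 ≤ μ - lam ε k).trans (le_abs_self _)
    · have hne : 0 < |ν - μ| := abs_pos.2 (sub_ne_zero.2 fun h => hno k (h ▸ hν))
      exact ⟨|ν - μ| / 2, half_pos hne, ((hν.sub_const μ).abs.eventually
        (lt_mem_nhds (half_lt_self hne))).mono fun ε hε => le_of_lt hε⟩
  have hgap' : ∀ K : ℕ, ∃ δ > 0, ∀ᶠ ε in 𝓝[>] 0, ∀ k < K, δ ≤ |lam ε k - μ| := by
    intro K
    induction K with
    | zero => exact ⟨1, one_pos, Eventually.of_forall fun _ k hk => absurd hk (Nat.not_lt_zero k)⟩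
    | succ K ih =>
      obtain ⟨δ, hδ, h⟩ := ih
      obtain ⟨δ', hδ', h'⟩ := hgap K
      refine ⟨min δ δ', lt_min hδ hδ', ?_⟩
      filter_upwards [h, h'] with ε h1 h2 k hk
      rcases Nat.lt_succ_iff_lt_or_eq.1 hk with hk | rfl
      · exact (min_le_left _ _).trans (h1 k hk)
      · exact (min_le_right _ _).trans h2
  -- From index `K` on, monotonicity keeps all eigenvalues at distance at least 1 above μ, so only
  -- finitely many gaps have to be combined.
  obtain ⟨K, hK⟩ := hA.lower (μ + 1)
  obtain ⟨δ, hδ, hδK⟩ := hgap' K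
  have hall : ∀ᶠ ε in 𝓝[>] (0 : ℝ), ε ∈ Ioo (0 : ℝ) 1 ∧ ∀ k, min δ 1 ≤ |lam ε k - μ| := by
    filter_upwards [hK, hδK, Ioo_mem_nhdsGT (zero_lt_one' ℝ)] with ε h1 h2 hε
    refine ⟨hε, fun k => ?_⟩
    rcases lt_or_ge k K with hk | hk
    · exact (min_le_left _ _).trans (h2 k hk)
    · have := (hA.enumeration ε hε).monotone hk
      exact (min_le_right _ _).trans ((by linarith : 1 ≤ lam ε k - μ).trans (le_abs_self _))
  obtain ⟨ε, hε, hε1⟩ := exists_seq_forall_of_frequently hall.frequently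
  have hδ1 : 0 < min δ 1 := lt_min hδ one_pos
  choose u hu huf using fun n => exists_resolvent_solution (hA.symmetric _ (hε1 n).1)
    (hA.compact _ (hε1 n).1) (hA.enumeration _ (hε1 n).1) hδ1 (hε1 n).2 f
  have hub : ∀ n, ‖u n‖ ≤ ‖f‖ / min δ 1 := fun n => by
    rw [le_div_iff₀ hδ1, mul_comm]
    exact huf n
  obtain ⟨φ, -, v, hv, hg⟩ := hA.graph_limit ε hε u (fun n => f + (μ : ℂ) • u n)
    (‖f‖ / min δ 1 + (‖f‖ + |μ| * (‖f‖ / min δ 1))) hu (fun n => by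
      refine add_le_add (hub n) ((norm_add_le _ _).trans ?_)
      rw [norm_smul, Complex.norm_real, Real.norm_eq_abs]
      gcongr
      exact hub n)
  have hvS := hg (f + (μ : ℂ) • v) (tendsto_const_nhds.add (hv.const_smul _))
  have hsym := hA.symmetric_limit _ hvS _ hf
  simp only [inner_add_left, inner_smul_left, inner_smul_right, Complex.conj_ofReal,
    add_eq_right] at hsym
  exact hf0 (inner_self_eq_zero.1 hsym)

theorem existsUnique_index (hA : SpectralApproximation T S lam) {μ : ℝ}
    (hμ : IsSimpleEigenvalue S μ) : ∃! k, Tendsto (fun ε => lam ε k) (𝓝[>] 0) (𝓝 μ) := by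
  obtain ⟨⟨f, hf⟩, hf0, -⟩ := finrank_eq_one_iff'.1 hμ
  obtain ⟨k, hk⟩ := hA.exists_index (f := f) (fun h => hf0 (Subtype.ext h))
    (mem_eigenspace_iff.1 hf)
  exact ⟨k, hk, fun l hl => hA.index_unique hμ hl hk⟩

end SpectralApproximation

end Approximation

end SingularFourthOrder

/-! ### The theorem, by verifying the hypotheses of the abstract spectral approximation. -/

open SingularFourthOrder in
theorem theorem4
    (a b : ℝ) (ha : a < 0) (hb : 0 < b)
    (U : ℝ → ℝ) (hU : ContDiffOn ℝ ∞ U (Icc a b))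
    (Ψ Φ Υ₁ Υ₂ : ℝ → ℝ)
    (hΨ : ContDiff ℝ ∞ Ψ) (hΨs : tsupport Ψ = Icc (-1) 1)
    (hΦ : ContDiff ℝ ∞ Φ) (hΦs : tsupport Φ ⊆ Icc (-1) 1)
    (hΥ₁ : ContDiff ℝ ∞ Υ₁) (hΥ₁s : tsupport Υ₁ ⊆ Icc (-1) 1)
    (hΥ₂ : ContDiff ℝ ∞ Υ₂) (hΥ₂s : tsupport Υ₂ ⊆ Icc (-1) 1)
    (α β γ₁ γ₂ : ℝ) (hα : α ∈ resonantSet Ψ → IsNondegenerate Ψ α)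
    (lam : ℝ → ℕ → ℝ)
    (hlam : ∀ ε ∈ Ioo (0 : ℝ) 1,
      IsEigenvalueEnumeration (perturbedOp a b U α β γ₁ γ₂ Ψ Φ Υ₁ Υ₂ ε) (lam ε)) :
    (∀ I ⊆ Ioo (0 : ℝ) 1, (𝓝[I] (0 : ℝ)).NeBot → ∀ k : ℕ,
      (∃ m : ℝ, ∀ᶠ ε in 𝓝[I] 0, m ≤ lam ε k) →
      ∃ μ : ℝ, Tendsto (fun ε => lam ε k) (𝓝[I] 0) (𝓝 μ) ∧
        (μ : ℂ) ∈ opSpectrum (limitOp a b U α β Ψ Φ)) ∧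
    (∀ μ : ℝ, IsSimpleEigenvalue (limitOp a b U α β Ψ Φ) μ →
      ∃! k : ℕ, Tendsto (fun ε => lam ε k) (𝓝[>] 0) (𝓝 μ)) := by
  have hab : a < b := ha.trans hb
  -- Provides the separability of L₂(a, b), on which the countability of eigenvalues rests.
  have : Fact ((2 : ENNReal) ≠ ⊤) := ⟨ENNReal.ofNat_ne_top⟩
  have hA : SpectralApproximation (perturbedOp a b U α β γ₁ γ₂ Ψ Φ Υ₁ Υ₂)
      (limitOp a b U α β Ψ Φ) lam :=
    { symmetric := fun ε _ => isSymmetricOp_clampedOp hab.le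
      compact := fun ε _ => hasCompactResolvent_clampedOp hab (hU.continuousOn.add
        (continuous_scaledPotential hΨ.continuous hΦ.continuous hΥ₁.continuous hΥ₂.continuous
          ε).continuousOn)
      enumeration := hlam
      symmetric_limit := isSymmetricOp_limitOp ha hb
      graph_limit := fun ε hε u h M hg hM => exists_subseq_mem_limitOp_graph ha hb hU.continuousOn
        hΨ.continuous hΦ.continuous hΥ₁.continuous hΥ₂.continuous hΨs.subset hΦs hΥ₁s hΥ₂s
          hα hε hg hM
      upper := fun k => by
        obtain ⟨Λ, ε₀, hε₀, h⟩ := exists_perturbed_eigenvalue_upper_bound (α := α) (β := β)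
          (γ₁ := γ₁) (γ₂ := γ₂) ha hb hU.continuousOn hΨ.continuous hΦ.continuous hΥ₁.continuous
          hΥ₂.continuous hΨs.subset hΦs hΥ₁s hΥ₂s k
        refine ⟨Λ, ?_⟩
        filter_upwards [Ioo_mem_nhdsGT hε₀, Ioo_mem_nhdsGT (zero_lt_one' ℝ)] with ε h1 h2
        exact h ε h1 _ (hlam ε h2)
      lower := fun Λ => by
        obtain ⟨K, ε₀, hε₀, h⟩ := exists_eigenvalue_lower_bound (α := α) (β := β)
          (γ₁ := γ₁) (γ₂ := γ₂) ha hb hU.continuousOn hΨ.continuous hΦ.continuous hΥ₁.continuous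
          hΥ₂.continuous hΨs.subset hΦs hΥ₁s hΥ₂s Λ
        refine ⟨K, ?_⟩
        filter_upwards [Ioo_mem_nhdsGT hε₀, Ioo_mem_nhdsGT (zero_lt_one' ℝ)] with ε h1 h2
        exact h ε h1 _ (hlam ε h2)
      continuousOn := continuousOn_eigenvalue hab hU.continuousOn hΨ.continuous hΦ.continuous
        hΥ₁.continuous hΥ₂.continuous hlam }
  refine ⟨fun I hI hne k ⟨m, hm⟩ => ?_, fun μ hμ => hA.existsUnique_index hμ⟩
  exact hA.tendsto_of_eventually_ge (nhdsWithin_mono 0 fun ε hε => (hI hε).1) hm
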